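/- Let $n\ge 2$. Periodic distributions are the continuous linear functionals on the space $C^\infty_\#$ of complex-valued $C^\infty$ functions on $\mathbb R^n$ that are $1$-periodic in each variable; $\hat g(\xi)=\langle g,e^{-2\pi i x\cdot\xi}\rangle$ for $\xi\in\mathbb Z^n$, and $\rho(\xi)=(1+|\xi|^2)^{1/2}$. For $s\in\mathbb R$ let $\dot H^s_\#$ be the space of periodic distributions $g$ with $\langle g,1\rangle=0$ and $\|g\|_{\dot H^s_\#}^2=\sum_{\xi\in\mathbb Z^n}\rho(\xi)^{2s}|\hat g(\xi)|^2<\infty$, let $\dot{\mathbf H}^s_\#=(\dot H^s_\#)^n$ with norm $\|\mathbf u\|_{\dot{\mathbf H}^s_\#}=(\sum_k\|u_k\|^2_{\dot H^s_\#})^{1/2}$, and let $\dot C^\infty_\#$, $\dot{\mathbf C}^\infty_\#=(\dot C^\infty_\#)^n$ be the smooth periodic functions with zero mean. Let $\mathbb A=(a_{kj}^{\alpha\beta})_{1\le k,j,\alpha,\beta\le n}$ be a constant real tensor with $a_{kj}^{\alpha\beta}=a_{\alpha j}^{k\beta}=a_{k\beta}^{\alpha j}$, put $\|\mathbb A\|=\max|a_{kj}^{\alpha\beta}|$,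 and assume (summing over repeated indices) that for some $C_{\mathbb A}>0$ $$C_{\mathbb A}\,a_{kj}^{\alpha\beta}\zeta_{k\alpha}\zeta_{j\beta}\ge|\zeta|^2\quad\text{for all symmetric }\zeta\in\mathbb R^{n\times n}\text{ with zero trace.}$$ Let $\mathbf U$ be a real-valued smooth periodic vector field with $\operatorname{div}\mathbf U=0$. With $(\mathfrak L\mathbf u)_k=\partial_\alpha\big(a_{kj}^{\alpha\beta}\tfrac12(\partial_ju_\beta+\partial_\beta u_j)\big)$, consider the anisotropic Oseen system, in the sense of distributions, $$S_U(\mathbf u,p):=\big(-\mathfrak L\mathbf u+\nabla p+(\mathbf U\cdot\nabla)\mathbf u,\ \operatorname{div}\mathbf u\big)=(\mathbf f,g).$$ (i) Let $s\ge1$. For any $(\mathbf f,g)\in\dot{\mathbf H}^{s-2}_\#\times\dot H^{s-1}_\#$ the system has a unique solution $(\mathbf u,p)\in\dot{\mathbf H}^s_\#\times\dot H^{s-1}_\#$. There is a constant $C_s>0$ depending only on $C_{\mathbb A},\|\mathbb A\|,n,\mathbf U,s$ such that $$\|\mathbf u\|_{\dot{\mathbf H}^s_\#}+\|p\|_{\dot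 H^{s-1}_\#}\le C_s\big(\|\mathbf f\|_{\dot{\mathbf H}^{s-2}_\#}+\|g\|_{\dot H^{s-1}_\#}\big),$$ and $S_U:\dot{\mathbf H}^s_\#\times\dot H^{s-1}_\#\to\dot{\mathbf H}^{s-2}_\#\times\dot H^{s-1}_\#$ is an isomorphism (a bounded linear bijection with bounded inverse). The solution $(\mathbf u,p)$ is real if and only if the data $(\mathbf f,g)$ are real, so that the same holds for the spaces of real distributions. (ii) If $(\mathbf f,g)\in\dot{\mathbf C}^\infty_\#\times\dot C^\infty_\#$, then the solution satisfies $(\mathbf u,p)\in\dot{\mathbf C}^\infty_\#\times\dot C^\infty_\#$. -/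

import Mathlib

open scoped ContDiff

noncomputable section

namespace PeriodicOseen

/-! ### Smooth periodic functions on `ℝⁿ` -/

/-- The algebra of complex-valued `C^∞` functions on `ℝⁿ` that are `1`-periodic in each variable,
i.e. of the smooth functions on the torus `ℝⁿ / ℤⁿ`. -/
def PSmooth (n : ℕ) : Subalgebra ℂ ((Fin n → ℝ) → ℂ) where
  carrier := {φ | ContDiff ℝ ∞ φ ∧ ∀ (ξ : Fin n → ℤ) (x : Fin n → ℝ), φ (fun i => x i + ξ i) = φ x}
  mul_mem' := by
    rintro φ ψ ⟨hφ, hφ'⟩ ⟨hψ, hψ'⟩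
    exact ⟨hφ.mul hψ, fun ξ x => by simp only [Pi.mul_apply, hφ', hψ']⟩
  add_mem' := by
    rintro φ ψ ⟨hφ, hφ'⟩ ⟨hψ, hψ'⟩
    exact ⟨hφ.add hψ, fun ξ x => by simp only [Pi.add_apply, hφ', hψ']⟩
  algebraMap_mem' := fun c => ⟨contDiff_const, fun _ _ => rfl⟩

/-- The exponential `x ↦ exp (2 π i x · ξ)`, for `ξ ∈ ℤⁿ`. -/
def expo {n : ℕ} (ξ : Fin n → ℤ) : PSmooth n :=
  ⟨fun x => Complex.exp (2 * Real.pi * Complex.I * ∑ i, (x i : ℂ) * (ξ i : ℂ)), by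
    constructor
    · refine Complex.contDiff_exp.comp (contDiff_const.mul (ContDiff.sum fun i _ => ?_))
      exact (Complex.ofRealCLM.contDiff.comp (contDiff_apply ℝ ℝ i)).mul contDiff_const
    · intro η x
      have h : 2 * Real.pi * Complex.I * ∑ i, ((x i + η i : ℝ) : ℂ) * (ξ i : ℂ)
          = 2 * Real.pi * Complex.I * ∑ i, (x i : ℂ) * (ξ i : ℂ)
            + ((∑ i, η i * ξ i : ℤ) : ℂ) * (2 * Real.pi * Complex.I) := by
        push_cast
        simp only [add_mul, Finset.sum_add_distrib]
        ring
      show Complex.exp (2 * Real.pi * Complex.I * ∑ i, ((x i + η i : ℝ) : ℂ) * (ξ i : ℂ)) = _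
      rw [h, Complex.exp_add, Complex.exp_int_mul_two_pi_mul_I, mul_one]⟩

/-- The partial derivative `∂ⱼ φ` of a smooth periodic function. -/
def pderivFun {n : ℕ} (j : Fin n) : PSmooth n →ₗ[ℂ] PSmooth n where
  toFun φ := ⟨fun x => fderiv ℝ φ.1 x (Pi.single j 1), by
    constructor
    · exact (φ.2.1.fderiv_right (m := ∞) (by simp)).clm_apply contDiff_const
    · intro ξ x
      have h : φ.1 = fun y => φ.1 (y + fun i => (ξ i : ℝ)) := by
        funext y
        exact (φ.2.2 ξ y).symm
      have h' : fderiv ℝ φ.1 x = fderiv ℝ φ.1 (x + fun i => (ξ i : ℝ)) := by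
        conv_lhs => rw [h]
        exact fderiv_comp_add_right _
      show _ = fderiv ℝ φ.1 x (Pi.single j 1)
      rw [h']
      rfl⟩
  map_add' φ ψ := by
    ext x
    have hφ := (φ.2.1.differentiable (by simp)) x
    have hψ := (ψ.2.1.differentiable (by simp)) x
    show fderiv ℝ (φ.1 + ψ.1) x _ = fderiv ℝ φ.1 x _ + fderiv ℝ ψ.1 x _
    rw [fderiv_add hφ hψ]
    rfl
  map_smul' c φ := by
    ext x
    have hφ := (φ.2.1.differentiable (by simp)) x
    show fderiv ℝ (c • φ.1) x _ = c • fderiv ℝ φ.1 x _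
    rw [fderiv_const_smul hφ]
    rfl

/-- Each derivative of a smooth periodic function is bounded. -/
theorem bounded_iteratedFDeriv {n : ℕ} (φ : PSmooth n) (N : ℕ) :
    ∃ B : ℝ, 0 ≤ B ∧ ∀ k ≤ N, ∀ x, ‖iteratedFDeriv ℝ k φ.1 x‖ ≤ B := by
  have one : ∀ k : ℕ, ∃ B : ℝ, ∀ x, ‖iteratedFDeriv ℝ k φ.1 x‖ ≤ B := by
    intro k
    have hc : Continuous (iteratedFDeriv ℝ k φ.1) :=
      φ.2.1.continuous_iteratedFDeriv (by exact_mod_cast le_top)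
    obtain ⟨B, hB⟩ := (isCompact_Icc (a := (0 : Fin n → ℝ)) (b := 1)).exists_bound_of_continuousOn
      hc.continuousOn
    refine ⟨B, fun x => ?_⟩
    have h : φ.1 = fun y => φ.1 (y + fun i => ((-⌊x i⌋ : ℤ) : ℝ)) := by
      funext y
      exact (φ.2.2 (fun i => -⌊x i⌋) y).symm
    rw [h, iteratedFDeriv_comp_add_right]
    refine hB _ ⟨fun i => ?_, fun i => ?_⟩
    · have := Int.floor_le (x i)
      simp only [Pi.zero_apply, Pi.add_apply, Int.cast_neg]
      linarith
    · have := Int.lt_floor_add_one (x i)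
      simp only [Pi.one_apply, Pi.add_apply, Int.cast_neg]
      linarith
  choose B hB using one
  refine ⟨∑ k ∈ Finset.range (N + 1), |B k|, Finset.sum_nonneg fun _ _ => abs_nonneg _,
    fun k hk x => ?_⟩
  exact ((hB k x).trans (le_abs_self _)).trans
    (Finset.single_le_sum (f := fun k => |B k|) (fun _ _ => abs_nonneg _)
      (Finset.mem_range.2 (Nat.lt_succ_of_le hk)))

/-! ### Periodic distributions -/

/-- The space of periodic (torus) distributions: the linear functionals `g` on the smooth periodic
functions that are continuous for the usual Fréchet topology, i.e. for some `N` and `C`,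
`|g φ| ≤ C · max_{k ≤ N} sup_x ‖D^k φ (x)‖` for all `φ`. -/
def PDist (n : ℕ) : Submodule ℂ (Module.Dual ℂ (PSmooth n)) where
  carrier := {g | ∃ (N : ℕ) (C : ℝ), 0 ≤ C ∧ ∀ (φ : PSmooth n) (M : ℝ),
    (∀ k ≤ N, ∀ x, ‖iteratedFDeriv ℝ k φ.1 x‖ ≤ M) → ‖g φ‖ ≤ C * M}
  zero_mem' := ⟨0, 0, le_rfl, fun φ M _ => by simp⟩
  add_mem' := by
    rintro g h ⟨N, C, hC, hg⟩ ⟨N', C', hC', hh⟩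
    refine ⟨max N N', C + C', add_nonneg hC hC', fun φ M hM => ?_⟩
    have h1 := hg φ M fun k hk => hM k (hk.trans (le_max_left _ _))
    have h2 := hh φ M fun k hk => hM k (hk.trans (le_max_right _ _))
    calc ‖(g + h) φ‖ ≤ ‖g φ‖ + ‖h φ‖ := norm_add_le _ _
      _ ≤ (C + C') * M := by linarith
  smul_mem' := by
    rintro c g ⟨N, C, hC, hg⟩
    refine ⟨N, ‖c‖ * C, mul_nonneg (norm_nonneg _) hC, fun φ M hM => ?_⟩
    rw [LinearMap.smul_apply, norm_smul, mul_assoc]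
    exact mul_le_mul_of_nonneg_left (hg φ M hM) (norm_nonneg _)

/-- The distributional derivative, `⟨∂ⱼ g, φ⟩ = -⟨g, ∂ⱼ φ⟩`. -/
def pderiv {n : ℕ} (j : Fin n) : PDist n →ₗ[ℂ] PDist n where
  toFun g := ⟨-(g.1 ∘ₗ pderivFun j), by
    obtain ⟨N, C, hC, hg⟩ := g.2
    refine ⟨N + 1, C * ‖(Pi.single j 1 : Fin n → ℝ)‖, by positivity, fun φ M hM => ?_⟩
    have h := hg (pderivFun j φ) (‖(Pi.single j 1 : Fin n → ℝ)‖ * M) fun k hk x => by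
      have h1 : ‖iteratedFDeriv ℝ k (fun y => fderiv ℝ φ.1 y (Pi.single j 1)) x‖
          ≤ ‖(Pi.single j 1 : Fin n → ℝ)‖ * ‖iteratedFDeriv ℝ k (fderiv ℝ φ.1) x‖ :=
        norm_iteratedFDeriv_clm_apply_const
          ((φ.2.1.fderiv_right (m := ∞) (by simp)).contDiffAt) (by exact_mod_cast le_top)
      rw [norm_iteratedFDeriv_fderiv] at h1
      exact h1.trans (mul_le_mul_of_nonneg_left (hM (k + 1) (by omega) x) (norm_nonneg _))
    rw [LinearMap.neg_apply, norm_neg, mul_assoc]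
    exact h⟩
  map_add' g h := by
    ext φ
    show -(g.1 _ + h.1 _) = -(g.1 _) + -(h.1 _)
    ring
  map_smul' c g := by
    ext φ
    show -(c * g.1 _) = c * -(g.1 _)
    ring

/-- The product `ψ g` of a distribution and a smooth function, `⟨ψ g, φ⟩ = ⟨g, ψ φ⟩`. -/
def mulSmooth {n : ℕ} (ψ : PSmooth n) : PDist n →ₗ[ℂ] PDist n where
  toFun g := ⟨g.1 ∘ₗ LinearMap.mulLeft ℂ ψ, by
    obtain ⟨N, C, hC, hg⟩ := g.2
    obtain ⟨B, hB, hψ⟩ := bounded_iteratedFDeriv ψ N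
    refine ⟨N, C * (2 ^ N * B), by positivity, fun φ M hM => ?_⟩
    have hM0 : 0 ≤ M := (norm_nonneg _).trans (hM 0 (Nat.zero_le _) 0)
    have h := hg (ψ * φ) (2 ^ N * B * M) fun k hk x => by
      have h1 : ‖iteratedFDeriv ℝ k (fun y => ψ.1 y * φ.1 y) x‖ ≤ _ :=
        norm_iteratedFDeriv_mul_le (N := (k : WithTop ℕ∞))
          (ψ.2.1.of_le (by exact_mod_cast le_top)) (φ.2.1.of_le (by exact_mod_cast le_top)) x le_rfl
      refine h1.trans ?_
      calc _ ≤ ∑ i ∈ Finset.range (k + 1), (k.choose i : ℝ) * B * M := by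
            refine Finset.sum_le_sum fun i hi => ?_
            have hi' : i ≤ k := Nat.lt_succ_iff.1 (Finset.mem_range.1 hi)
            gcongr
            · exact hψ i (hi'.trans hk) x
            · exact hM (k - i) ((Nat.sub_le _ _).trans hk) x
        _ = 2 ^ k * B * M := by
            rw [← Finset.sum_mul, ← Finset.sum_mul]
            congr 2
            exact_mod_cast Nat.sum_range_choose k
        _ ≤ 2 ^ N * B * M := by
            gcongr
            norm_num
    rw [LinearMap.comp_apply, mul_assoc]
    exact h⟩
  map_add' _ _ := rfl
  map_smul' _ _ := rfl

/-- The Fourier coefficient `ĝ(ξ) = ⟨g, exp (-2 π i x · ξ)⟩`. -/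
def fourierCoeff {n : ℕ} (g : PDist n) (ξ : Fin n → ℤ) : ℂ := g.1 (expo (-ξ))

/-- The distribution `g` is (represented by) a smooth periodic function `ψ`:
`⟨g, φ⟩ = ∫_{[0,1]ⁿ} ψ φ`. -/
def IsSmooth {n : ℕ} (g : PDist n) : Prop :=
  ∃ ψ : PSmooth n, ∀ φ : PSmooth n,
    g.1 φ = ∫ x in Set.Icc (0 : Fin n → ℝ) 1, ψ.1 x * φ.1 x

/-- A distribution is real if it takes real values on real test functions. -/
def IsReal {n : ℕ} (g : PDist n) : Prop :=
  ∀ φ : PSmooth n, (∀ x, (φ.1 x).im = 0) → (g.1 φ).im = 0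

/-! ### Periodic Sobolev spaces -/

/-- `ρ(ξ) = (1 + |ξ|²)^{1/2}`. -/
def rho {n : ℕ} (ξ : Fin n → ℤ) : ℝ := Real.sqrt (1 + ∑ i, (ξ i : ℝ) ^ 2)

/-- The periodic Sobolev (Bessel-potential) space `H^s_#`: the periodic distributions with
`∑_ξ ρ(ξ)^{2s} |ĝ(ξ)|² < ∞`. -/
def H (n : ℕ) (s : ℝ) : Submodule ℂ (PDist n) where
  carrier := {g | Summable fun ξ : Fin n → ℤ => rho ξ ^ (2 * s) * ‖fourierCoeff g ξ‖ ^ 2}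
  zero_mem' := by
    have h : ∀ ξ : Fin n → ℤ, fourierCoeff (0 : PDist n) ξ = 0 := fun _ => rfl
    simp [h, summable_zero]
  add_mem' := by
    intro g h hg hh
    refine Summable.of_nonneg_of_le (fun ξ => ?_) (fun ξ => ?_) ((hg.add hh).mul_left 2)
    · exact mul_nonneg (Real.rpow_nonneg (Real.sqrt_nonneg _) _) (sq_nonneg _)
    · have h1 : ‖fourierCoeff (g + h) ξ‖ ≤ ‖fourierCoeff g ξ‖ + ‖fourierCoeff h ξ‖ :=
        norm_add_le _ _
      have h2 : ‖fourierCoeff (g + h) ξ‖ ^ 2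
          ≤ 2 * (‖fourierCoeff g ξ‖ ^ 2 + ‖fourierCoeff h ξ‖ ^ 2) := by
        nlinarith [norm_nonneg (fourierCoeff (g + h) ξ),
          sq_nonneg (‖fourierCoeff g ξ‖ - ‖fourierCoeff h ξ‖)]
      have h3 := mul_le_mul_of_nonneg_left h2
        (show 0 ≤ rho ξ ^ (2 * s) from Real.rpow_nonneg (Real.sqrt_nonneg _) _)
      linarith
  smul_mem' := by
    intro c g hg
    have h : ∀ ξ, ‖fourierCoeff (c • g) ξ‖ ^ 2 = ‖c‖ ^ 2 * ‖fourierCoeff g ξ‖ ^ 2 := by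
      intro ξ
      rw [← mul_pow, ← norm_mul]
      rfl
    refine (Summable.mul_left (‖c‖ ^ 2) hg).congr fun ξ => ?_
    rw [h]
    ring

/-- The square of the norm of `H^s_#`. -/
def normSqH {n : ℕ} (s : ℝ) (g : PDist n) : ℝ :=
  ∑' ξ : Fin n → ℤ, rho ξ ^ (2 * s) * ‖fourierCoeff g ξ‖ ^ 2

/-- The norm `(∑_ξ ρ(ξ)^{2s} |ĝ(ξ)|²)^{1/2}` of `H^s_#`. -/
def normH {n : ℕ} (s : ℝ) (g : PDist n) : ℝ := Real.sqrt (normSqH s g)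

/-- The norm of `(H^s_#)ⁿ`, i.e. `(∑_ξ ρ(ξ)^{2s} |û(ξ)|²)^{1/2}` with `|û(ξ)|` Euclidean. -/
def normHVec {n : ℕ} (s : ℝ) (u : Fin n → PDist n) : ℝ := Real.sqrt (∑ k, normSqH s (u k))

/-- The periodic distributions with zero mean, `⟨g, 1⟩ = 0`. -/
def zeroMean (n : ℕ) : Submodule ℂ (PDist n) where
  carrier := {g | g.1 1 = 0}
  zero_mem' := rfl
  add_mem' := by
    intro g h (hg : g.1 1 = 0) (hh : h.1 1 = 0)
    show g.1 1 + h.1 1 = 0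
    rw [hg, hh, add_zero]
  smul_mem' := by
    intro c g (hg : g.1 1 = 0)
    show c * g.1 1 = 0
    rw [hg, mul_zero]

/-- The space of the elements of `H^s_#` with zero mean. -/
def Hdot (n : ℕ) (s : ℝ) : Submodule ℂ (PDist n) := H n s ⊓ zeroMean n

/-- The corresponding space of `n`-component vector distributions. -/
def HdotVec (n : ℕ) (s : ℝ) : Submodule ℂ (Fin n → PDist n) :=
  Submodule.pi Set.univ fun _ => Hdot n s

/-! ### The anisotropic Oseen operator

A viscosity tensor with components `a_{kj}^{αβ}` is written `a k j α β`. -/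

/-- The symmetry conditions `a_{kj}^{αβ} = a_{αj}^{kβ} = a_{kβ}^{αj}`. -/
def TensorSymmetric {n : ℕ} (a : Fin n → Fin n → Fin n → Fin n → ℝ) : Prop :=
  ∀ k j α β, a k j α β = a α j k β ∧ a k j α β = a k β α j

/-- The relaxed ellipticity condition with constant `CA`:
`CA a_{kj}^{αβ} ζ_{kα} ζ_{jβ} ≥ |ζ|²` for all real symmetric matrices `ζ` with zero trace. -/
def TensorElliptic {n : ℕ} (a : Fin n → Fin n → Fin n → Fin n → ℝ) (CA : ℝ) : Prop :=
  ∀ ζ : Matrix (Fin n) (Fin n) ℝ, ζ.transpose = ζ → ζ.trace = 0 →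
    ∑ k, ∑ α, ζ k α ^ 2 ≤ CA * ∑ k, ∑ j, ∑ α, ∑ β, a k j α β * ζ k α * ζ j β

/-- `E_{jβ}(u) = (∂ⱼ u_β + ∂_β uⱼ) / 2`. -/
def strain {n : ℕ} (u : Fin n → PDist n) (j β : Fin n) : PDist n :=
  (1 / 2 : ℂ) • (pderiv j (u β) + pderiv β (u j))

/-- `(𝔏 u)_k = ∂_α (a_{kj}^{αβ} E_{jβ}(u))`. -/
def viscous {n : ℕ} (a : Fin n → Fin n → Fin n → Fin n → ℝ) (u : Fin n → PDist n) (k : Fin n) :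
    PDist n :=
  ∑ α, pderiv α (∑ j, ∑ β, (a k j α β : ℂ) • strain u j β)

/-- `((U · ∇) u)_k = ∑ⱼ Uⱼ ∂ⱼ u_k`. -/
def advect {n : ℕ} (U : Fin n → PSmooth n) (u : Fin n → PDist n) (k : Fin n) : PDist n :=
  ∑ j, mulSmooth (U j) (pderiv j (u k))

/-- The Oseen operator `S_U (u, p) = (-𝔏 u + ∇p + (U · ∇) u, div u)`. -/
def oseen {n : ℕ} (a : Fin n → Fin n → Fin n → Fin n → ℝ) (U : Fin n → PSmooth n) :
    ((Fin n → PDist n) × PDist n) →ₗ[ℂ] ((Fin n → PDist n) × PDist n) where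
  toFun x := (fun k => -viscous a x.1 k + pderiv k x.2 + advect U x.1 k, ∑ j, pderiv j (x.1 j))
  map_add' x y := by
    refine Prod.ext (funext fun k => ?_) ?_
    · simp only [viscous, strain, advect, Prod.fst_add, Prod.snd_add, Pi.add_apply, map_add,
        smul_add, Finset.sum_add_distrib, map_sum, map_smul]
      abel
    · simp only [Prod.fst_add, Prod.snd_add, Pi.add_apply, map_add, Finset.sum_add_distrib]
  map_smul' c x := by
    refine Prod.ext (funext fun k => ?_) ?_
    · simp only [viscous, strain, advect, Prod.smul_fst, Prod.smul_snd, Pi.smul_apply, map_add,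
        smul_add, map_sum, map_smul, RingHom.id_apply, Finset.smul_sum, smul_neg]
      simp only [smul_comm c]
    · simp only [Prod.smul_fst, Prod.smul_snd, Pi.smul_apply, map_smul, Finset.smul_sum,
        RingHom.id_apply]

/-- The vector field `U` is real-valued and divergence-free. -/
def RealDivFree {n : ℕ} (U : Fin n → PSmooth n) : Prop :=
  (∀ j x, ((U j).1 x).im = 0) ∧ ∑ j, pderivFun j (U j) = 0

/-- The space of pairs `(u, p)`, with `u` in the vector version of `Hdot n s` and `p` in
`Hdot n t`. -/
def PairSpace (n : ℕ) (s t : ℝ) : Submodule ℂ ((Fin n → PDist n) × PDist n) :=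
  (HdotVec n s).prod (Hdot n t)

/-- The sum of the norms of the components of a pair. -/
def pairNorm {n : ℕ} (s t : ℝ) (x : (Fin n → PDist n) × PDist n) : ℝ :=
  normHVec s x.1 + normH t x.2

/-- Both components of a pair are zero-mean smooth functions. -/
def SmoothPair {n : ℕ} (x : (Fin n → PDist n) × PDist n) : Prop :=
  (∀ k, IsSmooth (x.1 k) ∧ x.1 k ∈ zeroMean n) ∧ IsSmooth x.2 ∧ x.2 ∈ zeroMean n

/-- Both components of a pair are real distributions. -/
def RealPair {n : ℕ} (x : (Fin n → PDist n) × PDist n) : Prop :=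
  (∀ k, IsReal (x.1 k)) ∧ IsReal x.2

end PeriodicOseen

end

open PeriodicOseen

/-!
In Fourier coefficients the system is algebraic up to the advection term, which convolves with the
coefficients of `U`. The Leray projection, onto the vectors orthogonal to the frequency, removes the
pressure. The strain of the mode `v exp(2πi x·ξ)` has zero trace exactly when `v` is orthogonal to
`ξ`, so the relaxed ellipticity condition bounds the viscous symbol below on the divergence-free
vectors, which is all that the projected equation needs.

Since `U` is real and divergence-free, `⟨(U · ∇) u, u⟩` has zero real part, so the projected
operator is coercive on `H¹` and the Lax–Milgram theorem solves the equation there, with an estimate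
that involves the tensor only through the ellipticity constants. Advection loses one derivative
while the Stokes system gains two; moving `(U · ∇) u` to the right-hand side therefore improves the
regularity by one order at a time, up to any `s ≥ 1`.

The operator commutes with complex conjugation because `U` and the tensor are real, so by uniqueness
the solution is real as soon as the data are. A distribution is smooth when its coefficients
decrease faster than every power of the frequency, so smoothness is regularity for all `s`.
-/

noncomputable section

namespace PeriodicOseen

open MeasureTheory
open scoped ContDiff lp

variable {n : ℕ}

/-! ### The Bessel weight -/

section Weight

theorem rho_sq (ξ : Fin n → ℤ) : rho ξ ^ 2 = 1 + ∑ i, (ξ i : ℝ) ^ 2 :=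
  Real.sq_sqrt (by positivity)

theorem one_le_rho (ξ : Fin n → ℤ) : 1 ≤ rho ξ :=
  Real.one_le_sqrt.2 (le_add_of_nonneg_right (Finset.sum_nonneg fun _ _ => sq_nonneg _))

theorem rho_pos (ξ : Fin n → ℤ) : 0 < rho ξ := one_pos.trans_le (one_le_rho ξ)

theorem rho_rpow_pos (ξ : Fin n → ℤ) (s : ℝ) : 0 < rho ξ ^ s :=
  Real.rpow_pos_of_pos (rho_pos ξ) s

theorem rho_neg (ξ : Fin n → ℤ) : rho (-ξ) = rho ξ := by
  simp only [rho, Pi.neg_apply, Int.cast_neg, neg_sq]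

theorem abs_coord_le_rho (ξ : Fin n → ℤ) (i : Fin n) : |(ξ i : ℝ)| ≤ rho ξ := by
  refine abs_le_of_sq_le_sq ?_ (rho_pos ξ).le
  have hcoord : (ξ i : ℝ) ^ 2 ≤ ∑ j, (ξ j : ℝ) ^ 2 :=
    Finset.single_le_sum (f := fun j => (ξ j : ℝ) ^ 2) (fun _ _ => sq_nonneg _)
      (Finset.mem_univ i)
  rw [rho_sq]
  linarith

theorem rpow_rho_le_pow (ξ : Fin n → ℤ) {t : ℝ} {N : ℕ} (h : t ≤ N) :
    rho ξ ^ t ≤ rho ξ ^ N := by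
  rw [← Real.rpow_natCast]
  exact Real.rpow_le_rpow_of_exponent_le (one_le_rho ξ) h

theorem rho_add_le (ξ η : Fin n → ℤ) : rho (ξ + η) ≤ 2 * rho ξ * rho η := by
  refine abs_le_of_sq_le_sq' ?_ (by have := rho_pos ξ; have := rho_pos η; positivity) |>.2
  have hsum : ∑ i, (((ξ + η) i : ℤ) : ℝ) ^ 2
      ≤ 2 * ∑ i, (ξ i : ℝ) ^ 2 + 2 * ∑ i, (η i : ℝ) ^ 2 := by
    rw [Finset.mul_sum, Finset.mul_sum, ← Finset.sum_add_distrib]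
    refine Finset.sum_le_sum fun i _ => ?_
    rw [Pi.add_apply]
    push_cast
    nlinarith only [sq_nonneg ((ξ i : ℝ) - η i)]
  have hξ : 0 ≤ ∑ i, (ξ i : ℝ) ^ 2 := Finset.sum_nonneg fun _ _ => sq_nonneg _
  have hη : 0 ≤ ∑ i, (η i : ℝ) ^ 2 := Finset.sum_nonneg fun _ _ => sq_nonneg _
  rw [mul_pow, mul_pow, rho_sq, rho_sq, rho_sq]
  nlinarith only [hsum, hξ, hη, mul_nonneg hξ hη]

theorem summable_norm_coe_inv_pow (n : ℕ) :
    Summable fun ξ : Fin n → ℤ => ‖fun i => (ξ i : ℝ)‖⁻¹ ^ (n + 1) := by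
  let b := Pi.basisFun ℝ (Fin n)
  have hrank : Module.finrank ℤ (Submodule.span ℤ (Set.range b)) < n + 1 := by
    rw [ZLattice.rank ℝ, Module.finrank_fin_fun]
    exact n.lt_succ_self
  have hcoe (ξ : Fin n → ℤ) :
      (((b.restrictScalars ℤ).equivFun.symm ξ : Submodule.span ℤ (Set.range b)) : Fin n → ℝ)
        = fun i => (ξ i : ℝ) := by
    rw [Module.Basis.equivFun_symm_apply, Submodule.coe_sum]
    funext i
    simp [b, Pi.single_apply]
  refine ((b.restrictScalars ℤ).equivFun.symm.toEquiv.summable_iff.2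
    (ZLattice.summable_norm_pow_inv (Submodule.span ℤ (Set.range b)) (n + 1) hrank)).congr
    fun ξ => ?_
  rw [← hcoe]
  rfl

theorem norm_coe_le_rho (ξ : Fin n → ℤ) : ‖fun i => (ξ i : ℝ)‖ ≤ rho ξ :=
  (pi_norm_le_iff_of_nonneg (rho_pos ξ).le).2 (abs_coord_le_rho ξ)

theorem summable_rho_inv_pow (n : ℕ) : Summable fun ξ : Fin n → ℤ => (rho ξ ^ (n + 1))⁻¹ := by
  refine Summable.of_norm_bounded_eventually (summable_norm_coe_inv_pow n) ?_
  filter_upwards [(Set.finite_singleton (0 : Fin n → ℤ)).compl_mem_cofinite] with ξ hξ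
  have hpos : 0 < ‖fun i => (ξ i : ℝ)‖ := norm_pos_iff.2 fun h =>
    hξ (funext fun i => by simpa using congrFun h i)
  have := rho_pos ξ
  rw [Real.norm_of_nonneg (by positivity), inv_pow]
  exact inv_anti₀ (by positivity) (pow_le_pow_left₀ hpos.le (norm_coe_le_rho ξ) _)

end Weight

/-! ### Exponentials -/

section Exponentials

theorem expo_apply (ξ : Fin n → ℤ) (x : Fin n → ℝ) :
    (expo ξ).1 x = Complex.exp (2 * Real.pi * Complex.I * ∑ i, (x i : ℂ) * (ξ i : ℂ)) := rfl

theorem expo_add (ξ η : Fin n → ℤ) : expo (ξ + η) = expo ξ * expo η := by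
  ext x
  change _ = (expo ξ).1 x * (expo η).1 x
  rw [expo_apply, expo_apply, expo_apply, ← Complex.exp_add]
  congr 1
  simp only [Pi.add_apply, Int.cast_add, mul_add, Finset.sum_add_distrib]

theorem expo_zero : expo (0 : Fin n → ℤ) = 1 := by
  ext x
  change (expo 0).1 x = 1
  simp [expo_apply]

theorem conj_expo (ξ : Fin n → ℤ) (x : Fin n → ℝ) :
    starRingEnd ℂ ((expo ξ).1 x) = (expo (-ξ)).1 x := by
  rw [expo_apply, expo_apply, ← Complex.exp_conj]
  congr 1
  simp only [map_mul, map_sum, Complex.conj_ofReal, Complex.conj_I, map_ofNat, map_intCast,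
    Pi.neg_apply, Int.cast_neg, mul_neg, Finset.sum_neg_distrib, neg_mul]

/-- The linear form `x ↦ x · ξ`. -/
def dotCLM (ξ : Fin n → ℤ) : (Fin n → ℝ) →L[ℝ] ℝ :=
  ∑ i, (ξ i : ℝ) • ContinuousLinearMap.proj i

theorem dotCLM_apply (ξ : Fin n → ℤ) (x : Fin n → ℝ) : dotCLM ξ x = ∑ i, (ξ i : ℝ) * x i := by
  simp [dotCLM]

theorem norm_dotCLM_le (ξ : Fin n → ℤ) : ‖dotCLM ξ‖ ≤ n * rho ξ := by
  refine ContinuousLinearMap.opNorm_le_bound _ (mul_nonneg n.cast_nonneg (rho_pos ξ).le) fun x => ?_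
  rw [dotCLM_apply]
  calc ‖∑ i, (ξ i : ℝ) * x i‖ ≤ ∑ _i : Fin n, rho ξ * ‖x‖ := by
        refine norm_sum_le_of_le _ fun i _ => ?_
        rw [norm_mul]
        exact mul_le_mul (abs_coord_le_rho ξ i) (norm_le_pi_norm x i) (norm_nonneg _)
          (rho_pos ξ).le
    _ = n * rho ξ * ‖x‖ := by simp [mul_assoc]

theorem expo_eq_comp (ξ : Fin n → ℤ) :
    (expo ξ).1 = (fun t : ℝ => Complex.exp (2 * Real.pi * Complex.I * t)) ∘ dotCLM ξ := by
  funext x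
  simp only [expo_apply, Function.comp, dotCLM_apply, Complex.ofReal_sum, Complex.ofReal_mul,
    Complex.ofReal_intCast, mul_comm]

theorem norm_exp_two_pi_I_mul (t : ℝ) : ‖Complex.exp (2 * Real.pi * Complex.I * t)‖ = 1 := by
  have h : 2 * Real.pi * Complex.I * t = ((2 * Real.pi * t : ℝ) : ℂ) * Complex.I := by
    push_cast
    ring
  rw [h, Complex.norm_exp_ofReal_mul_I]

theorem norm_expo (ξ : Fin n → ℤ) (x : Fin n → ℝ) : ‖(expo ξ).1 x‖ = 1 := by
  rw [expo_eq_comp]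
  exact norm_exp_two_pi_I_mul _

theorem hasDerivAt_cexp_const_mul_ofReal (c : ℂ) (t : ℝ) :
    HasDerivAt (fun t : ℝ => Complex.exp (c * t)) (Complex.exp (c * t) * c) t := by
  simpa using ((hasDerivAt_id t).ofReal_comp.const_mul c).cexp

theorem iteratedDeriv_cexp_const_mul_ofReal (c : ℂ) (k : ℕ) :
    iteratedDeriv k (fun t : ℝ => Complex.exp (c * t))
      = fun t : ℝ => c ^ k * Complex.exp (c * t) := by
  induction k with
  | zero => simp
  | succ k ih =>
    rw [iteratedDeriv_succ, ih]
    funext t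
    rw [((hasDerivAt_cexp_const_mul_ofReal c t).const_mul (c ^ k)).deriv]
    ring

/-- A bound for the gradient of `expo ξ` whose `k`-th power bounds the `k`-th derivative; the factor
`n + 1`, instead of `n`, makes it at least `1`, so that its powers increase. -/
def expoBound (ξ : Fin n → ℤ) : ℝ := 2 * Real.pi * (n + 1) * rho ξ

theorem one_le_expoBound (ξ : Fin n → ℤ) : 1 ≤ expoBound ξ :=
  one_le_mul_of_one_le_of_one_le (one_le_mul_of_one_le_of_one_le
    (by linarith [Real.pi_gt_three]) (by simp)) (one_le_rho ξ)

theorem norm_iteratedFDeriv_expo_le (ξ : Fin n → ℤ) (k : ℕ) (x : Fin n → ℝ) :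
    ‖iteratedFDeriv ℝ k (expo ξ).1 x‖ ≤ expoBound ξ ^ k := by
  have hsmooth : ContDiff ℝ ∞ fun t : ℝ => Complex.exp (2 * Real.pi * Complex.I * t) :=
    Complex.contDiff_exp.comp (contDiff_const.mul Complex.ofRealCLM.contDiff)
  have hnorm : ‖iteratedFDeriv ℝ k (fun t : ℝ => Complex.exp (2 * Real.pi * Complex.I * t))
      (dotCLM ξ x)‖ = (2 * Real.pi) ^ k := by
    rw [norm_iteratedFDeriv_eq_norm_iteratedDeriv, iteratedDeriv_cexp_const_mul_ofReal, norm_mul,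
      norm_exp_two_pi_I_mul]
    simp [abs_of_pos Real.pi_pos]
  rw [expo_eq_comp, (dotCLM ξ).iteratedFDeriv_comp_right hsmooth x (by exact_mod_cast le_top)]
  refine (ContinuousMultilinearMap.norm_compContinuousLinearMap_le _ _).trans ?_
  rw [hnorm, Finset.prod_const, Finset.card_univ, Fintype.card_fin, ← mul_pow, expoBound,
    mul_assoc (2 * Real.pi)]
  have hdot : ‖dotCLM ξ‖ ≤ (n + 1) * rho ξ := by
    linarith [norm_dotCLM_le ξ, rho_pos ξ]
  gcongr

end Exponentials

/-! ### Derivatives of smooth periodic functions -/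

section Derivatives

theorem pderivFun_apply (j : Fin n) (φ : PSmooth n) (x : Fin n → ℝ) :
    (pderivFun j φ).1 x = fderiv ℝ φ.1 x (Pi.single j 1) := rfl

theorem psmooth_differentiableAt (φ : PSmooth n) (x : Fin n → ℝ) :
    DifferentiableAt ℝ φ.1 x := φ.2.1.differentiable (by simp) x

theorem psmooth_continuous (φ : PSmooth n) : Continuous φ.1 := φ.2.1.continuous

theorem pderivFun_mul (j : Fin n) (φ ψ : PSmooth n) :
    pderivFun j (φ * ψ) = φ * pderivFun j ψ + pderivFun j φ * ψ := by
  ext x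
  change fderiv ℝ (fun y => φ.1 y * ψ.1 y) x _ =
    φ.1 x * fderiv ℝ ψ.1 x _ + fderiv ℝ φ.1 x _ * ψ.1 x
  rw [fderiv_fun_mul (psmooth_differentiableAt φ x) (psmooth_differentiableAt ψ x)]
  simp only [add_apply, smul_apply, smul_eq_mul, mul_comm (ψ.1 x)]

theorem pderivFun_expo (j : Fin n) (ξ : Fin n → ℤ) :
    pderivFun j (expo ξ) = (2 * Real.pi * Complex.I * ξ j) • expo ξ := by
  ext x
  change fderiv ℝ (expo ξ).1 x (Pi.single j 1) = (2 * Real.pi * Complex.I * ξ j) * (expo ξ).1 x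
  have hchain := ((hasDerivAt_cexp_const_mul_ofReal (2 * Real.pi * Complex.I)
    (dotCLM ξ x)).hasFDerivAt.comp x (dotCLM ξ).hasFDerivAt).fderiv
  rw [expo_eq_comp]
  refine (congrArg (fun L => L (Pi.single j 1)) hchain).trans ?_
  simp only [ContinuousLinearMap.comp_apply, dotCLM_apply, Function.comp, Pi.single_apply,
    mul_ite, mul_one, mul_zero, Finset.sum_ite_eq', Finset.mem_univ, if_true,
    ContinuousLinearMap.toSpanSingleton_apply, Complex.real_smul]
  push_cast
  ring

/-- All derivatives of `φ` of order at most `N` are bounded by `M`: the seminorm bound that occurs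
in the definition of a periodic distribution. -/
def DerivBound (N : ℕ) (φ : PSmooth n) (M : ℝ) : Prop :=
  ∀ k ≤ N, ∀ x, ‖iteratedFDeriv ℝ k φ.1 x‖ ≤ M

namespace DerivBound

variable {N : ℕ} {φ ψ : PSmooth n} {M : ℝ}

theorem norm_le (h : DerivBound N φ M) (x : Fin n → ℝ) : ‖φ.1 x‖ ≤ M := by
  simpa using h 0 (Nat.zero_le _) x

theorem nonneg (h : DerivBound N φ M) : 0 ≤ M :=
  (norm_nonneg _).trans (h 0 (Nat.zero_le _) 0)

theorem mono {N' : ℕ} (h : DerivBound N φ M) (hN : N' ≤ N) : DerivBound N' φ M :=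
  fun k hk => h k (hk.trans hN)

theorem add {M' : ℝ} (h : DerivBound N φ M) (h' : DerivBound N ψ M') :
    DerivBound N (φ + ψ) (M + M') := fun k hk x => by
  change ‖iteratedFDeriv ℝ k (φ.1 + ψ.1) x‖ ≤ _
  rw [iteratedFDeriv_add_apply (φ.2.1.of_le (by exact_mod_cast le_top)).contDiffAt
    (ψ.2.1.of_le (by exact_mod_cast le_top)).contDiffAt]
  exact (norm_add_le _ _).trans (add_le_add (h k hk x) (h' k hk x))

theorem smul (h : DerivBound N φ M) (c : ℂ) : DerivBound N (c • φ) (‖c‖ * M) := fun k hk x => by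
  change ‖iteratedFDeriv ℝ k (c • φ.1) x‖ ≤ _
  rw [iteratedFDeriv_const_smul_apply (φ.2.1.of_le (by exact_mod_cast le_top)).contDiffAt,
    norm_smul]
  exact mul_le_mul_of_nonneg_left (h k hk x) (norm_nonneg _)

theorem sum {ι : Type*} (s : Finset ι) {φ : ι → PSmooth n} {M : ι → ℝ}
    (h : ∀ i ∈ s, DerivBound N (φ i) (M i)) : DerivBound N (∑ i ∈ s, φ i) (∑ i ∈ s, M i) := by
  classical
  induction s using Finset.induction_on with
  | empty =>
    intro k _ x
    change ‖iteratedFDeriv ℝ k (fun _ => 0) x‖ ≤ _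
    rw [iteratedFDeriv_fun_zero, Pi.zero_apply, norm_zero, Finset.sum_empty]
  | insert a s ha ih =>
    rw [Finset.sum_insert ha, Finset.sum_insert ha]
    exact (h a (Finset.mem_insert_self _ _)).add
      (ih fun i hi => h i (Finset.mem_insert_of_mem hi))

protected theorem pderivFun (h : DerivBound (N + 1) φ M) (j : Fin n) :
    DerivBound N (pderivFun j φ) M := fun k hk x => by
  have hk' : ‖iteratedFDeriv ℝ k (fun y => fderiv ℝ φ.1 y (Pi.single j 1)) x‖
      ≤ ‖(Pi.single j 1 : Fin n → ℝ)‖ * ‖iteratedFDeriv ℝ k (fderiv ℝ φ.1) x‖ :=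
    norm_iteratedFDeriv_clm_apply_const
      ((φ.2.1.fderiv_right (m := ∞) (by simp)).contDiffAt) (by exact_mod_cast le_top)
  rw [norm_iteratedFDeriv_fderiv, Pi.norm_single, norm_one, one_mul] at hk'
  exact hk'.trans (h (k + 1) (Nat.succ_le_succ hk) x)

end DerivBound

theorem exists_derivBound (φ : PSmooth n) (N : ℕ) : ∃ M, DerivBound N φ M :=
  let ⟨M, _, h⟩ := bounded_iteratedFDeriv φ N
  ⟨M, h⟩

end Derivatives

/-! ### Fourier coefficients of smooth functions -/

section SmoothCoefficients

/-- The Fourier coefficient `∫_{[0,1]ⁿ} φ(x) exp(-2πi x·ξ) dx` of a smooth periodic function. -/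
def coeff (φ : PSmooth n) (ξ : Fin n → ℤ) : ℂ :=
  ∫ x in Set.Icc (0 : Fin n → ℝ) 1, φ.1 x * (expo (-ξ)).1 x

theorem integrableOn_cube {f : (Fin n → ℝ) → ℂ} (hf : Continuous f) :
    IntegrableOn f (Set.Icc (0 : Fin n → ℝ) 1) :=
  hf.continuousOn.integrableOn_compact isCompact_Icc

theorem integrableOn_mul (φ ψ : PSmooth n) :
    IntegrableOn (fun x => φ.1 x * ψ.1 x) (Set.Icc (0 : Fin n → ℝ) 1) :=
  integrableOn_cube ((psmooth_continuous φ).mul (psmooth_continuous ψ))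

theorem apply_insertNth_one {m : ℕ} (φ : PSmooth (m + 1)) (j : Fin (m + 1)) (x : Fin m → ℝ) :
    φ.1 (j.insertNth 1 x) = φ.1 (j.insertNth 0 x) := by
  rw [← φ.2.2 (Pi.single j 1) (j.insertNth 0 x)]
  refine congrArg φ.1 (funext fun k => ?_)
  refine Fin.succAboveCases j ?_ (fun l => ?_) k <;> simp

theorem integral_pderivFun (j : Fin n) (φ : PSmooth n) :
    ∫ x in Set.Icc (0 : Fin n → ℝ) 1, (pderivFun j φ).1 x = 0 := by
  obtain _ | m := n
  · exact j.elim0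
  let single := ContinuousLinearMap.single ℝ (fun _ : Fin (m + 1) => ℂ) j
  have hdiv (x : Fin (m + 1) → ℝ) :
      ∑ i, (single ∘L fderiv ℝ φ.1 x) (Pi.single i 1) i = (pderivFun j φ).1 x := by
    simp [single, Pi.single_apply, pderivFun_apply]
  have hdivergence := integral_divergence_of_hasFDerivAt_off_countable (0 : Fin (m + 1) → ℝ) 1
    zero_le_one (fun x => single (φ.1 x)) (fun x => single ∘L fderiv ℝ φ.1 x) ∅
    Set.countable_empty (single.continuous.comp (psmooth_continuous φ)).continuousOn
    (fun x _ => single.hasFDerivAt.comp x (psmooth_differentiableAt φ x).hasFDerivAt)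
    (by simpa only [hdiv] using integrableOn_cube (psmooth_continuous _))
  simp only [hdiv] at hdivergence
  rw [hdivergence]
  refine Finset.sum_eq_zero fun i _ => sub_eq_zero.2 ?_
  obtain rfl | hij := eq_or_ne i j
  · simp only [single, Pi.one_apply, Pi.zero_apply, apply_insertNth_one]
  · simp [single, hij]

theorem coeff_pderivFun (j : Fin n) (φ : PSmooth n) (ξ : Fin n → ℤ) :
    coeff (pderivFun j φ) ξ = 2 * Real.pi * Complex.I * ξ j * coeff φ ξ := by
  have hparts := integral_pderivFun j (φ * expo (-ξ))
  have hleibniz (x : Fin n → ℝ) : (pderivFun j (φ * expo (-ξ))).1 x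
      = -(2 * Real.pi * Complex.I * ξ j) * (φ.1 x * (expo (-ξ)).1 x)
        + (pderivFun j φ).1 x * (expo (-ξ)).1 x := by
    rw [pderivFun_mul, pderivFun_expo]
    change φ.1 x * ((2 * Real.pi * Complex.I * ((-ξ) j : ℤ)) * (expo (-ξ)).1 x)
      + (pderivFun j φ).1 x * (expo (-ξ)).1 x = _
    rw [Pi.neg_apply]
    push_cast
    ring
  simp only [hleibniz] at hparts
  rw [integral_add ((integrableOn_mul φ (expo (-ξ))).const_mul _)
    (integrableOn_mul (pderivFun j φ) (expo (-ξ))), integral_const_mul] at hparts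
  unfold coeff
  linear_combination hparts

theorem coeff_add (φ ψ : PSmooth n) (ξ : Fin n → ℤ) :
    coeff (φ + ψ) ξ = coeff φ ξ + coeff ψ ξ := by
  unfold coeff
  rw [← integral_add (integrableOn_mul φ (expo (-ξ))) (integrableOn_mul ψ (expo (-ξ)))]
  exact integral_congr_ae (ae_of_all _ fun x => add_mul _ _ _)

theorem coeff_smul (c : ℂ) (φ : PSmooth n) (ξ : Fin n → ℤ) :
    coeff (c • φ) ξ = c * coeff φ ξ := by
  unfold coeff
  rw [← integral_const_mul]
  exact integral_congr_ae (ae_of_all _ fun x => mul_assoc _ _ _)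

/-- The Fourier coefficient at a fixed frequency, as a linear functional. -/
def coeffLin (ξ : Fin n → ℤ) : PSmooth n →ₗ[ℂ] ℂ where
  toFun φ := coeff φ ξ
  map_add' φ ψ := coeff_add φ ψ ξ
  map_smul' c φ := coeff_smul c φ ξ

/-- The operator `1 - Δ / (4π²)`, normalized so as to multiply Fourier coefficients by `ρ(ξ)²`. -/
def bessel (φ : PSmooth n) : PSmooth n :=
  φ + (-(1 / (4 * Real.pi ^ 2)) : ℂ) • ∑ j, pderivFun j (pderivFun j φ)

theorem coeff_bessel (φ : PSmooth n) (ξ : Fin n → ℤ) :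
    coeff (bessel φ) ξ = (rho ξ : ℂ) ^ 2 * coeff φ ξ := by
  have hlaplace : coeff (∑ j, pderivFun j (pderivFun j φ)) ξ
      = ∑ j, coeff (pderivFun j (pderivFun j φ)) ξ := map_sum (coeffLin ξ) _ _
  have hrho : (rho ξ : ℂ) ^ 2 = 1 + ∑ i, (ξ i : ℂ) ^ 2 := by exact_mod_cast rho_sq ξ
  rw [bessel, coeff_add, coeff_smul, hlaplace]
  simp only [coeff_pderivFun, hrho, add_mul, Finset.sum_mul, one_mul, Finset.mul_sum]
  congr 1
  refine Finset.sum_congr rfl fun j _ => ?_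
  have hpi : (Real.pi : ℂ) ≠ 0 := by exact_mod_cast Real.pi_ne_zero
  field_simp
  rw [Complex.I_sq]
  ring

protected theorem DerivBound.bessel {N : ℕ} {φ : PSmooth n} {M : ℝ} (h : DerivBound (N + 2) φ M) :
    DerivBound N (bessel φ) ((1 + n) * M) := by
  have hlaplace : DerivBound N (∑ j, pderivFun j (pderivFun j φ)) (∑ _j : Fin n, M) :=
    DerivBound.sum Finset.univ fun j _ => DerivBound.pderivFun (DerivBound.pderivFun h j) j
  have hconst : ‖(-(1 / (4 * Real.pi ^ 2)) : ℂ)‖ ≤ 1 := by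
    have hcast : (-(1 / (4 * Real.pi ^ 2)) : ℂ) = ((-(1 / (4 * Real.pi ^ 2)) : ℝ) : ℂ) := by
      push_cast
      ring
    rw [hcast, Complex.norm_real, norm_neg, Real.norm_of_nonneg (by positivity),
      div_le_one (by positivity)]
    nlinarith only [Real.pi_gt_three]
  intro k hk x
  refine ((h.mono (Nat.le_add_right N 2)).add (hlaplace.smul _) k hk x).trans ?_
  rw [Finset.sum_const, Finset.card_univ, Fintype.card_fin, nsmul_eq_mul]
  have := mul_le_mul_of_nonneg_right hconst (mul_nonneg n.cast_nonneg h.nonneg)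
  linarith

theorem norm_coeff_le {φ : PSmooth n} {M : ℝ} (h : ∀ x, ‖φ.1 x‖ ≤ M) (ξ : Fin n → ℤ) :
    ‖coeff φ ξ‖ ≤ M := by
  have hint := norm_setIntegral_le_of_norm_le_const (μ := volume) (s := Set.Icc (0 : Fin n → ℝ) 1)
    (C := M) (f := fun x => φ.1 x * (expo (-ξ)).1 x) isCompact_Icc.measure_lt_top
    (fun x _ => by rw [norm_mul, norm_expo, mul_one]; exact h x)
  simpa [coeff, measureReal_def, Real.volume_Icc_pi] using hint

theorem rho_pow_mul_norm_coeff_le (N : ℕ) {φ : PSmooth n} {M : ℝ} (h : DerivBound (2 * N) φ M)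
    (ξ : Fin n → ℤ) : rho ξ ^ (2 * N) * ‖coeff φ ξ‖ ≤ (1 + n) ^ N * M := by
  induction N generalizing φ M with
  | zero => simpa using norm_coeff_le h.norm_le ξ
  | succ N ih =>
    have hbessel := ih (DerivBound.bessel (N := 2 * N) h)
    rw [coeff_bessel, norm_mul, norm_pow, Complex.norm_real, Real.norm_of_nonneg (rho_pos ξ).le]
      at hbessel
    calc rho ξ ^ (2 * (N + 1)) * ‖coeff φ ξ‖
        = rho ξ ^ (2 * N) * (rho ξ ^ 2 * ‖coeff φ ξ‖) := by ring
      _ ≤ (1 + n) ^ N * ((1 + n) * M) := hbessel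
      _ = (1 + n) ^ (N + 1) * M := by ring

theorem summable_of_rho_pow_mul_le {c : (Fin n → ℤ) → ℝ} (h0 : ∀ ξ, 0 ≤ c ξ) {K : ℝ}
    (h : ∀ ξ, rho ξ ^ (n + 1) * c ξ ≤ K) : Summable c := by
  refine Summable.of_nonneg_of_le h0 (fun ξ => ?_) ((summable_rho_inv_pow n).mul_left K)
  rw [← div_eq_mul_inv, le_div_iff₀ (pow_pos (rho_pos ξ) _), mul_comm]
  exact h ξ

theorem exists_rho_pow_mul_norm_coeff_le (φ : PSmooth n) (N : ℕ) :
    ∃ K, ∀ ξ, rho ξ ^ N * ‖coeff φ ξ‖ ≤ K := by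
  obtain ⟨M, hM⟩ := exists_derivBound φ (2 * N)
  refine ⟨(1 + n) ^ N * M, fun ξ => le_trans ?_ (rho_pow_mul_norm_coeff_le N hM ξ)⟩
  exact mul_le_mul_of_nonneg_right (pow_le_pow_right₀ (one_le_rho ξ) (by omega)) (norm_nonneg _)

theorem summable_rho_pow_mul_norm_coeff (φ : PSmooth n) (N : ℕ) :
    Summable fun ξ => rho ξ ^ N * ‖coeff φ ξ‖ := by
  obtain ⟨K, hK⟩ := exists_rho_pow_mul_norm_coeff_le φ (n + 1 + N)
  refine summable_of_rho_pow_mul_le (fun ξ => by have := rho_pos ξ; positivity) (K := K) fun ξ => ?_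
  rw [← mul_assoc, ← pow_add]
  exact hK ξ

end SmoothCoefficients

/-! ### Fourier series -/

section FourierSeries

variable {ι : Type*} {κ : ι → Fin n → ℤ} {c : ι → ℂ}

theorem norm_iteratedFDeriv_mul_expo_le (c : ℂ) (ξ : Fin n → ℤ) (k : ℕ) (x : Fin n → ℝ) :
    ‖iteratedFDeriv ℝ k (fun x => c * (expo ξ).1 x) x‖ ≤ ‖c‖ * expoBound ξ ^ k := by
  change ‖iteratedFDeriv ℝ k (c • (expo ξ).1) x‖ ≤ _
  rw [iteratedFDeriv_const_smul_apply ((expo ξ).2.1.of_le (by exact_mod_cast le_top)).contDiffAt,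
    norm_smul]
  exact mul_le_mul_of_nonneg_left (norm_iteratedFDeriv_expo_le ξ k x) (norm_nonneg _)

theorem summable_norm_mul_expoBound_pow (h : ∀ N : ℕ, Summable fun i => rho (κ i) ^ N * ‖c i‖)
    (N : ℕ) : Summable fun i => ‖c i‖ * expoBound (κ i) ^ N := by
  refine ((h N).mul_left ((2 * Real.pi * (n + 1)) ^ N)).congr fun i => ?_
  rw [expoBound, mul_pow _ (rho (κ i))]
  ring

/-- The trigonometric series `∑ᵢ cᵢ exp(2πi x·κᵢ)` with rapidly decreasing coefficients, as a smooth
periodic function. The index type is arbitrary so as to cover tails of Fourier series. -/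
def fourierSum (κ : ι → Fin n → ℤ) (c : ι → ℂ)
    (h : ∀ N : ℕ, Summable fun i => rho (κ i) ^ N * ‖c i‖) : PSmooth n :=
  ⟨fun x => ∑' i, c i * (expo (κ i)).1 x,
    contDiff_tsum (N := (⊤ : ℕ∞)) (v := fun k i => ‖c i‖ * expoBound (κ i) ^ k)
      (fun i => contDiff_const.mul (expo (κ i)).2.1)
      (fun k _ => summable_norm_mul_expoBound_pow h k)
      fun _ _ _ _ => norm_iteratedFDeriv_mul_expo_le _ _ _ _,
    fun ξ x => by simp only [(expo _).2.2 ξ x]⟩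

theorem derivBound_fourierSum (h : ∀ N : ℕ, Summable fun i => rho (κ i) ^ N * ‖c i‖) (N : ℕ) :
    DerivBound N (fourierSum κ c h) (∑' i, ‖c i‖ * expoBound (κ i) ^ N) := fun k hk x => by
  change ‖iteratedFDeriv ℝ k (fun x => ∑' i, c i * (expo (κ i)).1 x) x‖ ≤ _
  rw [iteratedFDeriv_tsum_apply (N := (⊤ : ℕ∞)) (v := fun k i => ‖c i‖ * expoBound (κ i) ^ k)
    (fun i => contDiff_const.mul (expo (κ i)).2.1)
    (fun k _ => summable_norm_mul_expoBound_pow h k)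
    (fun _ _ _ _ => norm_iteratedFDeriv_mul_expo_le _ _ _ _) le_top x]
  exact tsum_of_norm_bounded (summable_norm_mul_expoBound_pow h N).hasSum fun i =>
    (norm_iteratedFDeriv_mul_expo_le _ _ _ _).trans
      (mul_le_mul_of_nonneg_left (pow_le_pow_right₀ (one_le_expoBound _) hk) (norm_nonneg _))

/-- The projection of `ℝⁿ` onto the torus, through which Mathlib's Fourier series on the torus are
applied to periodic functions. -/
def toTorus (n : ℕ) : C(Fin n → ℝ, UnitAddTorus (Fin n)) :=
  ⟨fun x i => (x i : UnitAddCircle),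
    continuous_pi fun i => (AddCircle.continuous_mk' 1).comp (continuous_apply i)⟩

theorem isQuotientMap_toTorus (n : ℕ) : Topology.IsQuotientMap (toTorus n) :=
  (IsOpenQuotientMap.piMap (f := fun _ : Fin n => ((↑) : ℝ → UnitAddCircle))
    fun _ => QuotientAddGroup.isOpenQuotientMap_mk).isQuotientMap

theorem exists_int_of_toTorus_eq {x y : Fin n → ℝ} (h : toTorus n x = toTorus n y) :
    ∃ k : Fin n → ℤ, y = fun i => x i + k i := by
  have hcoord (i : Fin n) : ∃ k : ℤ, y i = x i + k := by
    obtain ⟨k, hk⟩ := AddSubgroup.mem_zmultiples_iff.1 (QuotientAddGroup.eq.1 (congrFun h i))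
    refine ⟨k, ?_⟩
    simp only [zsmul_eq_mul, mul_one] at hk
    linarith
  choose k hk using hcoord
  exact ⟨k, funext hk⟩

theorem factorsThrough_toTorus (φ : PSmooth n) :
    Function.FactorsThrough (⟨φ.1, psmooth_continuous φ⟩ : C(Fin n → ℝ, ℂ)) (toTorus n) := by
  intro x y hxy
  obtain ⟨k, rfl⟩ := exists_int_of_toTorus_eq hxy
  exact (φ.2.2 k x).symm

/-- The continuous function on the torus induced by a smooth periodic function. -/
def torusLift (φ : PSmooth n) : C(UnitAddTorus (Fin n), ℂ) :=
  (isQuotientMap_toTorus n).lift ⟨φ.1, psmooth_continuous φ⟩ (factorsThrough_toTorus φ)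

theorem torusLift_toTorus (φ : PSmooth n) (x : Fin n → ℝ) : torusLift φ (toTorus n x) = φ.1 x :=
  DFunLike.congr_fun ((isQuotientMap_toTorus n).lift_comp _ (factorsThrough_toTorus φ)) x

theorem mFourier_toTorus (ξ : Fin n → ℤ) (x : Fin n → ℝ) :
    UnitAddTorus.mFourier ξ (toTorus n x) = (expo ξ).1 x := by
  change ∏ i, fourier (ξ i) (x i : UnitAddCircle) = _
  simp only [fourier_coe_apply]
  rw [← Complex.exp_sum, expo_apply, Finset.mul_sum]
  congr 1
  refine Finset.sum_congr rfl fun i _ => ?_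
  push_cast
  ring

theorem mFourierCoeff_torusLift (φ : PSmooth n) :
    UnitAddTorus.mFourierCoeff (torusLift φ) = coeff φ := by
  funext ξ
  have hcube : {x : Fin n → ℝ | ∀ i, x i ∈ Set.Ioc ((0 : Fin n → ℝ) i) ((0 : Fin n → ℝ) i + 1)}
      = Set.univ.pi fun i => Set.Ioc ((0 : Fin n → ℝ) i) ((1 : Fin n → ℝ) i) := by
    ext x
    simp
  rw [UnitAddTorus.mFourierCoeff_eq_integral _ _ 0, coeff, hcube, volume_pi,
    setIntegral_congr_set Measure.univ_pi_Ioc_ae_eq_Icc]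
  refine integral_congr_ae (ae_of_all _ fun x => ?_)
  change UnitAddTorus.mFourier (-ξ) (toTorus n x) * torusLift φ (toTorus n x) = _
  rw [mFourier_toTorus, torusLift_toTorus, mul_comm]

theorem hasSum_coeff_mul_expo (φ : PSmooth n) (x : Fin n → ℝ) :
    HasSum (fun ζ => coeff φ ζ * (expo ζ).1 x) (φ.1 x) := by
  have hsummable : Summable (UnitAddTorus.mFourierCoeff (torusLift φ)) := by
    rw [mFourierCoeff_torusLift]
    exact Summable.of_norm (by simpa using summable_rho_pow_mul_norm_coeff φ 0)
  simpa only [mFourierCoeff_torusLift, torusLift_toTorus, mFourier_toTorus, smul_eq_mul] using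
    UnitAddTorus.hasSum_mFourier_series_apply_of_summable hsummable (toTorus n x)

theorem summable_rho_pow_mul_norm_coeff_compl (φ : PSmooth n) (F : Finset (Fin n → ℤ)) (N : ℕ) :
    Summable fun ζ : {ζ // ζ ∉ F} => rho ζ.1 ^ N * ‖coeff φ ζ‖ :=
  (summable_rho_pow_mul_norm_coeff φ N).comp_injective Subtype.val_injective

theorem sum_coeff_smul_expo_add_fourierSum (φ : PSmooth n) (F : Finset (Fin n → ℤ)) :
    ∑ ζ ∈ F, coeff φ ζ • expo ζ
      + fourierSum (fun ζ : {ζ // ζ ∉ F} => ζ.1) (fun ζ => coeff φ ζ)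
          (summable_rho_pow_mul_norm_coeff_compl φ F) = φ := by
  ext x
  rw [← (hasSum_coeff_mul_expo φ x).tsum_eq,
    ← (hasSum_coeff_mul_expo φ x).summable.sum_add_tsum_subtype_compl F]
  change (∑ ζ ∈ F, coeff φ ζ • expo ζ : PSmooth n).1 x + ∑' ζ : {ζ // ζ ∉ F}, _ = _
  rw [AddSubmonoidClass.coe_finsetSum, Finset.sum_apply]
  rfl

theorem hasSum_coeff_mul_dist (g : PDist n) (φ : PSmooth n) :
    HasSum (fun ζ => coeff φ ζ * g.1 (expo ζ)) (g.1 φ) := by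
  obtain ⟨N, C, -, hg⟩ := g.2
  have htail (F : Finset (Fin n → ℤ)) : g.1 φ - ∑ ζ ∈ F, coeff φ ζ * g.1 (expo ζ)
      = g.1 (fourierSum (fun ζ : {ζ // ζ ∉ F} => ζ.1) (fun ζ => coeff φ ζ)
          (summable_rho_pow_mul_norm_coeff_compl φ F)) := by
    conv_lhs => rw [← sum_coeff_smul_expo_add_fourierSum φ F, map_add, map_sum]
    simp only [sum_coeff_smul_expo_add_fourierSum, map_smul, smul_eq_mul, add_sub_cancel_left]
  rw [HasSum, SummationFilter.unconditional_filter, tendsto_iff_norm_sub_tendsto_zero]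
  have htendsto := (tendsto_tsum_compl_atTop_zero
    fun ζ => ‖coeff φ ζ‖ * expoBound ζ ^ N).const_mul C
  rw [mul_zero] at htendsto
  refine squeeze_zero (fun _ => norm_nonneg _) (fun F => ?_) htendsto
  rw [norm_sub_rev, htail]
  exact hg _ _ (derivBound_fourierSum _ N)

end FourierSeries

/-! ### Fourier coefficients of distributions -/

section DistributionCoefficients

theorem fourierCoeff_add (g h : PDist n) (ξ : Fin n → ℤ) :
    fourierCoeff (g + h) ξ = fourierCoeff g ξ + fourierCoeff h ξ := rfl

theorem fourierCoeff_neg (g : PDist n) (ξ : Fin n → ℤ) :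
    fourierCoeff (-g) ξ = -fourierCoeff g ξ := rfl

theorem fourierCoeff_smul (c : ℂ) (g : PDist n) (ξ : Fin n → ℤ) :
    fourierCoeff (c • g) ξ = c * fourierCoeff g ξ := rfl

/-- The Fourier coefficient at a fixed frequency, as a linear functional on distributions. -/
def fourierCoeffLin (ξ : Fin n → ℤ) : PDist n →ₗ[ℂ] ℂ where
  toFun g := fourierCoeff g ξ
  map_add' _ _ := rfl
  map_smul' _ _ := rfl

theorem fourierCoeff_sum {ι : Type*} (s : Finset ι) (g : ι → PDist n) (ξ : Fin n → ℤ) :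
    fourierCoeff (∑ i ∈ s, g i) ξ = ∑ i ∈ s, fourierCoeff (g i) ξ :=
  map_sum (fourierCoeffLin ξ) g s

theorem fourierCoeff_injective : Function.Injective (fourierCoeff (n := n)) := by
  refine fun g h hgh => Subtype.ext (LinearMap.ext fun φ => ?_)
  have hexpo (ζ : Fin n → ℤ) : g.1 (expo ζ) = h.1 (expo ζ) := by
    simpa only [fourierCoeff, neg_neg] using congrFun hgh (-ζ)
  have hg := hasSum_coeff_mul_dist g φ
  simp only [hexpo] at hg
  exact hg.unique (hasSum_coeff_mul_dist h φ)

theorem mem_zeroMean_iff (g : PDist n) : g ∈ zeroMean n ↔ fourierCoeff g 0 = 0 := by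
  rw [fourierCoeff, neg_zero, expo_zero]
  rfl

theorem fourierCoeff_pderiv (j : Fin n) (g : PDist n) (ξ : Fin n → ℤ) :
    fourierCoeff (pderiv j g) ξ = 2 * Real.pi * Complex.I * ξ j * fourierCoeff g ξ := by
  change -(g.1 (pderivFun j (expo (-ξ)))) = _ * g.1 (expo (-ξ))
  rw [pderivFun_expo, map_smul, smul_eq_mul, Pi.neg_apply]
  push_cast
  ring

theorem hasSum_fourierCoeff_mulSmooth (ψ : PSmooth n) (g : PDist n) (ξ : Fin n → ℤ) :
    HasSum (fun ζ => coeff ψ ζ * fourierCoeff g (ξ - ζ)) (fourierCoeff (mulSmooth ψ g) ξ) := by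
  have hshift (ζ : Fin n → ℤ) : (mulSmooth (expo (-ξ)) g).1 (expo ζ) = fourierCoeff g (ξ - ζ) := by
    change g.1 (expo (-ξ) * expo ζ) = g.1 _
    rw [← expo_add, neg_sub, neg_add_eq_sub]
  have hcomm : (mulSmooth (expo (-ξ)) g).1 ψ = fourierCoeff (mulSmooth ψ g) ξ :=
    congrArg g.1 (mul_comm _ _)
  simpa only [hshift, hcomm] using hasSum_coeff_mul_dist (mulSmooth (expo (-ξ)) g) ψ

theorem integral_expo_eq_zero {ξ : Fin n → ℤ} (hξ : ξ ≠ 0) :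
    ∫ x in Set.Icc (0 : Fin n → ℝ) 1, (expo ξ).1 x = 0 := by
  obtain ⟨j, hj⟩ := Function.ne_iff.1 hξ
  have hderiv := integral_pderivFun j (expo ξ)
  rw [pderivFun_expo] at hderiv
  change ∫ x in Set.Icc (0 : Fin n → ℝ) 1, (2 * Real.pi * Complex.I * ξ j) * (expo ξ).1 x = 0
    at hderiv
  rw [integral_const_mul] at hderiv
  exact (mul_eq_zero.1 hderiv).resolve_left
    (mul_ne_zero Complex.two_pi_I_ne_zero (Int.cast_ne_zero.2 hj))

theorem coeff_expo (η ζ : Fin n → ℤ) : coeff (expo η) ζ = if ζ = η then 1 else 0 := by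
  have hmul : coeff (expo η) ζ = ∫ x in Set.Icc (0 : Fin n → ℝ) 1, (expo (η - ζ)).1 x := by
    rw [sub_eq_add_neg, expo_add]
    rfl
  rw [hmul]
  split_ifs with h
  · rw [h, sub_self, expo_zero]
    change ∫ _x in Set.Icc (0 : Fin n → ℝ) 1, (1 : ℂ) = 1
    simp [measureReal_def, Real.volume_Icc_pi]
  · exact integral_expo_eq_zero (sub_ne_zero.2 (Ne.symm h))

/-- Polynomial growth of a family indexed by frequencies, which characterizes the Fourier
coefficients of periodic distributions. -/
def PolyBounded (c : (Fin n → ℤ) → ℂ) : Prop :=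
  ∃ (N : ℕ) (K : ℝ), 0 ≤ K ∧ ∀ ξ, ‖c ξ‖ ≤ K * rho ξ ^ N

theorem norm_coeff_mul_le {c : (Fin n → ℤ) → ℂ} {N : ℕ} {K : ℝ} (hK : 0 ≤ K)
    (hc : ∀ ξ, ‖c ξ‖ ≤ K * rho ξ ^ N) {φ : PSmooth n} {M : ℝ}
    (h : DerivBound (2 * (n + 1 + N)) φ M) (ζ : Fin n → ℤ) :
    ‖coeff φ ζ * c (-ζ)‖ ≤ K * ((1 + n) ^ (n + 1 + N) * M) * (rho ζ ^ (n + 1))⁻¹ := by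
  have hgrowth := hc (-ζ)
  have hdecay := rho_pow_mul_norm_coeff_le (n + 1 + N) h ζ
  have hexponent : rho ζ ^ (n + 1 + N) ≤ rho ζ ^ (2 * (n + 1 + N)) :=
    pow_le_pow_right₀ (one_le_rho ζ) (by omega)
  have := rho_pos ζ
  rw [rho_neg] at hgrowth
  rw [← div_eq_mul_inv, le_div_iff₀ (by positivity), norm_mul]
  calc ‖coeff φ ζ‖ * ‖c (-ζ)‖ * rho ζ ^ (n + 1)
      ≤ ‖coeff φ ζ‖ * (K * rho ζ ^ N) * rho ζ ^ (n + 1) := by gcongr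
    _ = K * (rho ζ ^ (n + 1 + N) * ‖coeff φ ζ‖) := by ring
    _ ≤ K * (rho ζ ^ (2 * (n + 1 + N)) * ‖coeff φ ζ‖) := by gcongr
    _ ≤ K * ((1 + n) ^ (n + 1 + N) * M) := by gcongr

theorem PolyBounded.summable {c : (Fin n → ℤ) → ℂ} (hc : PolyBounded c) (φ : PSmooth n) :
    Summable fun ζ => coeff φ ζ * c (-ζ) := by
  obtain ⟨N, K, hK, hc⟩ := hc
  obtain ⟨M, hM⟩ := exists_derivBound φ (2 * (n + 1 + N))
  exact Summable.of_norm_bounded ((summable_rho_inv_pow n).mul_left _) (norm_coeff_mul_le hK hc hM)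

/-- The distribution with prescribed Fourier coefficients of polynomial growth. -/
def ofCoeff (c : (Fin n → ℤ) → ℂ) (hc : PolyBounded c) : PDist n :=
  ⟨{ toFun := fun φ => ∑' ζ, coeff φ ζ * c (-ζ)
     map_add' := fun φ ψ => by
      rw [← (hc.summable φ).tsum_add (hc.summable ψ)]
      simp only [coeff_add, add_mul]
     map_smul' := fun a φ => by
      simp only [coeff_smul, mul_assoc, tsum_mul_left, RingHom.id_apply, smul_eq_mul] }, by
    obtain ⟨N, K, hK, hc⟩ := hc
    refine ⟨2 * (n + 1 + N), K * (1 + n) ^ (n + 1 + N) * ∑' ζ : Fin n → ℤ, (rho ζ ^ (n + 1))⁻¹,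
      mul_nonneg (by positivity) (tsum_nonneg fun ζ => by have := rho_pos ζ; positivity),
      fun φ M hM => ?_⟩
    refine (tsum_of_norm_bounded ((summable_rho_inv_pow n).mul_left _).hasSum
      (norm_coeff_mul_le hK hc (φ := φ) hM)).trans_eq ?_
    rw [tsum_mul_left]
    ring⟩

theorem fourierCoeff_ofCoeff (c : (Fin n → ℤ) → ℂ) (hc : PolyBounded c) :
    fourierCoeff (ofCoeff c hc) = c := by
  funext ξ
  change ∑' ζ, coeff (expo (-ξ)) ζ * c (-ζ) = c ξ
  rw [tsum_eq_single (-ξ) fun ζ hζ => by rw [coeff_expo, if_neg hζ, zero_mul]]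
  simp [coeff_expo]

theorem hasSum_integral_fourierSum_mul {c : (Fin n → ℤ) → ℂ}
    (h : ∀ N : ℕ, Summable fun ξ => rho ξ ^ N * ‖c ξ‖) (φ : PSmooth n) :
    HasSum (fun ζ => c ζ * coeff φ (-ζ))
      (∫ x in Set.Icc (0 : Fin n → ℝ) 1, (fourierSum id c h).1 x * φ.1 x) := by
  obtain ⟨M, hM⟩ := exists_derivBound φ 0
  have hint (ζ : Fin n → ℤ) : IntegrableOn
      (fun x => c ζ * (expo ζ).1 x * φ.1 x) (Set.Icc (0 : Fin n → ℝ) 1) :=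
    integrableOn_cube
      ((continuous_const.mul (psmooth_continuous _)).mul (psmooth_continuous _))
  have hnorm (ζ : Fin n → ℤ) :
      ∫ x in Set.Icc (0 : Fin n → ℝ) 1, ‖c ζ * (expo ζ).1 x * φ.1 x‖ ≤ M * ‖c ζ‖ := by
    have hmono := setIntegral_mono (hint ζ).norm (g := fun _ => M * ‖c ζ‖)
      (integrableOn_const isCompact_Icc.measure_lt_top.ne) fun x => by
        rw [norm_mul, norm_mul, norm_expo, mul_one, mul_comm]
        exact mul_le_mul_of_nonneg_right (hM.norm_le x) (norm_nonneg _)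
    simpa [measureReal_def, Real.volume_Icc_pi] using hmono
  have hsum := hasSum_integral_of_summable_integral_norm hint (Summable.of_nonneg_of_le
    (fun ζ => integral_nonneg fun _ => norm_nonneg _) hnorm (by simpa using (h 0).mul_left M))
  have hterm (ζ : Fin n → ℤ) :
      ∫ x in Set.Icc (0 : Fin n → ℝ) 1, c ζ * (expo ζ).1 x * φ.1 x = c ζ * coeff φ (-ζ) := by
    simp only [coeff, neg_neg, mul_assoc, integral_const_mul, mul_comm (φ.1 _)]
  simp only [hterm, tsum_mul_right] at hsum
  exact hsum

theorem isSmooth_of_rho_pow_mul_norm_fourierCoeff_le {g : PDist n}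
    (hg : ∀ N : ℕ, ∃ K, ∀ ξ, rho ξ ^ N * ‖fourierCoeff g ξ‖ ≤ K) : IsSmooth g := by
  have hsummable (N : ℕ) : Summable fun ζ => rho ζ ^ N * ‖fourierCoeff g ζ‖ := by
    obtain ⟨K, hK⟩ := hg (n + 1 + N)
    refine summable_of_rho_pow_mul_le (fun ξ => by have := rho_pos ξ; positivity) (K := K)
      fun ξ => ?_
    rw [← mul_assoc, ← pow_add]
    exact hK ξ
  refine ⟨fourierSum id (fourierCoeff g) hsummable, fun φ => ?_⟩
  have hpair := hasSum_coeff_mul_dist g φ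
  rw [← (Equiv.neg _).hasSum_iff] at hpair
  refine hpair.unique ?_
  simpa only [Function.comp_def, Equiv.neg_apply, fourierCoeff, mul_comm] using
    hasSum_integral_fourierSum_mul hsummable φ

theorem isSmooth_iff (g : PDist n) :
    IsSmooth g ↔ ∀ N : ℕ, ∃ K, ∀ ξ, rho ξ ^ N * ‖fourierCoeff g ξ‖ ≤ K := by
  refine ⟨?_, isSmooth_of_rho_pow_mul_norm_fourierCoeff_le⟩
  rintro ⟨ψ, hψ⟩ N
  have hcoeff : fourierCoeff g = coeff ψ := funext fun ξ => hψ (expo (-ξ))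
  exact hcoeff ▸ exists_rho_pow_mul_norm_coeff_le ψ N

end DistributionCoefficients

/-! ### Complex conjugation -/

section Conjugation

/-- The complex conjugate of a smooth periodic function. -/
def conjFun (φ : PSmooth n) : PSmooth n :=
  ⟨fun x => (starRingEnd ℂ) (φ.1 x), Complex.conjCLE.contDiff.comp φ.2.1,
    fun ξ x => congrArg _ (φ.2.2 ξ x)⟩

theorem conjFun_conjFun (φ : PSmooth n) : conjFun (conjFun φ) = φ :=
  Subtype.ext (funext fun _ => Complex.conj_conj _)

theorem conjFun_add (φ ψ : PSmooth n) : conjFun (φ + ψ) = conjFun φ + conjFun ψ :=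
  Subtype.ext (funext fun _ => map_add (starRingEnd ℂ) _ _)

theorem conjFun_mul (φ ψ : PSmooth n) : conjFun (φ * ψ) = conjFun φ * conjFun ψ :=
  Subtype.ext (funext fun _ => map_mul (starRingEnd ℂ) _ _)

theorem conjFun_smul (c : ℂ) (φ : PSmooth n) :
    conjFun (c • φ) = (starRingEnd ℂ) c • conjFun φ :=
  Subtype.ext (funext fun _ => map_mul (starRingEnd ℂ) _ _)

theorem conjFun_eq_self {φ : PSmooth n} : conjFun φ = φ ↔ ∀ x, (φ.1 x).im = 0 :=
  Subtype.ext_iff.trans (funext_iff.trans (forall_congr' fun _ => Complex.conj_eq_iff_im))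

theorem conjFun_expo (ξ : Fin n → ℤ) : conjFun (expo ξ) = expo (-ξ) :=
  Subtype.ext (funext (conj_expo ξ))

theorem pderivFun_conjFun (j : Fin n) (φ : PSmooth n) :
    pderivFun j (conjFun φ) = conjFun (pderivFun j φ) := by
  ext x
  change fderiv ℝ (Complex.conjCLE ∘ φ.1) x _ = Complex.conjCLE (fderiv ℝ φ.1 x _)
  rw [ContinuousLinearEquiv.comp_fderiv]
  rfl

protected theorem DerivBound.conjFun {N : ℕ} {φ : PSmooth n} {M : ℝ} (h : DerivBound N φ M) :
    DerivBound N (conjFun φ) M := fun k hk x =>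
  (Complex.conjLIE.norm_iteratedFDeriv_comp_left φ.1 x k).trans_le (h k hk x)

/-- The complex conjugate of a distribution, `⟨ḡ, φ⟩ = conj ⟨g, conj φ⟩`. -/
def conjDist (g : PDist n) : PDist n :=
  ⟨{ toFun := fun φ => (starRingEnd ℂ) (g.1 (conjFun φ))
     map_add' := fun φ ψ => by rw [conjFun_add, map_add, map_add]
     map_smul' := fun c φ => by
      rw [conjFun_smul, map_smul, smul_eq_mul, map_mul, Complex.conj_conj]
      rfl }, by
    obtain ⟨N, C, hC, hg⟩ := g.2
    refine ⟨N, C, hC, fun φ M hM => ?_⟩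
    change ‖(starRingEnd ℂ) (g.1 (conjFun φ))‖ ≤ _
    rw [Complex.norm_conj]
    exact hg _ _ (DerivBound.conjFun hM)⟩

/-- Complex conjugation of distributions, as an additive map. -/
def conjHom (n : ℕ) : PDist n →+ PDist n where
  toFun := conjDist
  map_zero' := Subtype.ext (LinearMap.ext fun _ => map_zero (starRingEnd ℂ))
  map_add' _ _ := Subtype.ext (LinearMap.ext fun _ => map_add (starRingEnd ℂ) _ _)

theorem conjHom_smul (c : ℂ) (g : PDist n) :
    conjHom n (c • g) = (starRingEnd ℂ) c • conjHom n g :=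
  Subtype.ext (LinearMap.ext fun _ => map_mul (starRingEnd ℂ) _ _)

theorem conjHom_pderiv (j : Fin n) (g : PDist n) :
    conjHom n (pderiv j g) = pderiv j (conjHom n g) := by
  refine Subtype.ext (LinearMap.ext fun φ => ?_)
  change (starRingEnd ℂ) (-(g.1 (pderivFun j (conjFun φ)))) =
    -(starRingEnd ℂ) (g.1 (conjFun (pderivFun j φ)))
  rw [pderivFun_conjFun, map_neg]

theorem conjHom_mulSmooth {ψ : PSmooth n} (hψ : ∀ x, (ψ.1 x).im = 0) (g : PDist n) :
    conjHom n (mulSmooth ψ g) = mulSmooth ψ (conjHom n g) := by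
  refine Subtype.ext (LinearMap.ext fun φ => ?_)
  change (starRingEnd ℂ) (g.1 (ψ * conjFun φ)) = (starRingEnd ℂ) (g.1 (conjFun (ψ * φ)))
  rw [conjFun_mul, conjFun_eq_self.2 hψ]

theorem fourierCoeff_conjHom (g : PDist n) (ξ : Fin n → ℤ) :
    fourierCoeff (conjHom n g) ξ = (starRingEnd ℂ) (fourierCoeff g (-ξ)) := by
  change (starRingEnd ℂ) (g.1 (conjFun (expo (-ξ)))) = _
  rw [conjFun_expo]
  rfl

theorem conjHom_eq_self_of_isReal {g : PDist n} (hg : IsReal g) : conjHom n g = g := by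
  refine Subtype.ext (LinearMap.ext fun φ => ?_)
  change (starRingEnd ℂ) (g.1 (conjFun φ)) = g.1 φ
  -- `φ + conj φ` and `i (φ - conj φ)` are real test functions.
  have hre := hg (φ + conjFun φ) (conjFun_eq_self.1 (by
    rw [conjFun_add, conjFun_conjFun, add_comm]))
  have him := hg (Complex.I • (φ + (-1 : ℂ) • conjFun φ)) (conjFun_eq_self.1 (by
    rw [conjFun_smul, conjFun_add, conjFun_smul, conjFun_conjFun, Complex.conj_I]
    simp only [map_neg, map_one]
    module))
  simp only [map_add, map_smul, smul_eq_mul, Complex.add_im, Complex.mul_im, Complex.add_re,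
    Complex.I_re, Complex.I_im, neg_mul, one_mul, Complex.neg_re, zero_mul, zero_add] at hre him
  apply Complex.ext
  · rw [Complex.conj_re]
    linarith
  · rw [Complex.conj_im]
    linarith

theorem isReal_iff (g : PDist n) : IsReal g ↔ conjHom n g = g := by
  refine ⟨conjHom_eq_self_of_isReal, fun h φ hφ => ?_⟩
  have hconj : (starRingEnd ℂ) (g.1 (conjFun φ)) = g.1 φ := congrArg (fun g : PDist n => g.1 φ) h
  rw [conjFun_eq_self.2 hφ] at hconj
  exact Complex.conj_eq_iff_im.1 hconj

theorem coeff_neg_of_real {ψ : PSmooth n} (hψ : ∀ x, (ψ.1 x).im = 0) (ξ : Fin n → ℤ) :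
    coeff ψ (-ξ) = (starRingEnd ℂ) (coeff ψ ξ) := by
  unfold coeff
  rw [← integral_conj]
  refine integral_congr_ae (ae_of_all _ fun x => ?_)
  change _ = (starRingEnd ℂ) (ψ.1 x * (expo (-ξ)).1 x)
  rw [map_mul, Complex.conj_eq_iff_im.2 (hψ x), conj_expo]

end Conjugation

/-! ### Weighted composition operators on square-summable families -/

section WeightedComposition

variable {ι κ E F : Type*} [NormedAddCommGroup E] [NormedAddCommGroup F]

theorem memℓp_two_iff {f : ι → E} : Memℓp f 2 ↔ Summable fun i => ‖f i‖ ^ 2 := by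
  rw [memℓp_gen_iff (by norm_num)]
  simp

theorem norm_sq_eq_tsum (x : ℓ²(ι, E)) : ‖x‖ ^ 2 = ∑' i, ‖x i‖ ^ 2 := by
  simpa using lp.norm_rpow_eq_tsum (p := 2) (by norm_num) x

theorem summable_norm_sq (x : ℓ²(ι, E)) : Summable fun i => ‖x i‖ ^ 2 :=
  memℓp_two_iff.1 (lp.memℓp x)

variable {𝕜 : Type*} [NontriviallyNormedField 𝕜] [NormedSpace 𝕜 E] [NormedSpace 𝕜 F]
  {σ : ι → κ} (hσ : Function.Injective σ) {m : ι → E →L[𝕜] F} {M : ℝ} (hm : ∀ i, ‖m i‖ ≤ M)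

include hm in
theorem norm_apply_comp_sq_le (x : κ → E) (i : ι) :
    ‖m i (x (σ i))‖ ^ 2 ≤ M ^ 2 * ‖x (σ i)‖ ^ 2 := by
  rw [← mul_pow]
  exact pow_le_pow_left₀ (norm_nonneg _) ((m i).le_of_opNorm_le (hm i) _) 2

include hσ hm in
theorem summable_norm_apply_comp_sq (x : ℓ²(κ, E)) : Summable fun i => ‖m i (x (σ i))‖ ^ 2 :=
  Summable.of_nonneg_of_le (fun _ => sq_nonneg _) (norm_apply_comp_sq_le hm x)
    (((summable_norm_sq x).comp_injective hσ).mul_left _)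

include hσ hm in
theorem tsum_norm_apply_comp_sq_le (x : ℓ²(κ, E)) :
    ∑' i, ‖m i (x (σ i))‖ ^ 2 ≤ (M * ‖x‖) ^ 2 := by
  calc ∑' i, ‖m i (x (σ i))‖ ^ 2 ≤ ∑' i, M ^ 2 * ‖x (σ i)‖ ^ 2 :=
        (summable_norm_apply_comp_sq hσ hm x).tsum_le_tsum (norm_apply_comp_sq_le hm x)
          (((summable_norm_sq x).comp_injective hσ).mul_left _)
    _ = M ^ 2 * ∑' i, ‖x (σ i)‖ ^ 2 := tsum_mul_left
    _ ≤ M ^ 2 * ‖x‖ ^ 2 := by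
        rw [norm_sq_eq_tsum]
        exact mul_le_mul_of_nonneg_left (tsum_comp_le_tsum_of_inj (summable_norm_sq x)
          (fun _ => sq_nonneg _) hσ) (sq_nonneg M)
    _ = (M * ‖x‖) ^ 2 := (mul_pow _ _ _).symm

/-- The operator `(T x)(i) = m(i) x(σ(i))` between spaces of square-summable families, for an
injective change of indices `σ` and a bounded family of operators `m`. It covers Fourier multipliers
(`σ = id`) and the multiplication by an exponential (`σ` a translation). -/
def weightedCompOp (hM : 0 ≤ M) : ℓ²(κ, E) →L[𝕜] ℓ²(ι, F) :=
  LinearMap.mkContinuous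
    { toFun := fun x => ⟨fun i => m i (x (σ i)),
        memℓp_two_iff.2 (summable_norm_apply_comp_sq hσ hm x)⟩
      map_add' := fun x y => lp.ext (funext fun i => map_add (m i) _ _)
      map_smul' := fun c x => lp.ext (funext fun i => map_smul (m i) c _) } M fun x => by
    refine le_of_sq_le_sq ?_ (mul_nonneg hM (norm_nonneg x))
    rw [norm_sq_eq_tsum]
    exact tsum_norm_apply_comp_sq_le hσ hm x

theorem norm_weightedCompOp_le (hM : 0 ≤ M) : ‖weightedCompOp hσ hm hM‖ ≤ M :=
  LinearMap.mkContinuous_norm_le _ hM _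

end WeightedComposition

section WeightedSequences

variable {E F G : Type*} [NormedAddCommGroup E] [NormedAddCommGroup F] [NormedAddCommGroup G]

/-- The families of Fourier coefficients with `∑ ρ^{2s} |c|² < ∞`: membership in `H^s_#` seen on
the Fourier side. -/
def HMem (s : ℝ) (c : (Fin n → ℤ) → E) : Prop := Summable fun ξ => rho ξ ^ (2 * s) * ‖c ξ‖ ^ 2

/-- The norm `(∑ ρ^{2s} |c|²)^{1/2}` of `H^s_#` seen on the Fourier side, meaningful for families
satisfying `HMem s`. -/
def hNorm (s : ℝ) (c : (Fin n → ℤ) → E) : ℝ := Real.sqrt (∑' ξ, rho ξ ^ (2 * s) * ‖c ξ‖ ^ 2)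

theorem rho_rpow_mul_sq (s : ℝ) (ξ : Fin n → ℤ) (a : ℝ) :
    (rho ξ ^ s * a) ^ 2 = rho ξ ^ (2 * s) * a ^ 2 := by
  rw [mul_pow, mul_comm 2 s, Real.rpow_mul (rho_pos ξ).le, Real.rpow_two]

theorem hNorm_nonneg (s : ℝ) (c : (Fin n → ℤ) → E) : 0 ≤ hNorm s c := Real.sqrt_nonneg _

theorem hNorm_sq (s : ℝ) (c : (Fin n → ℤ) → E) :
    hNorm s c ^ 2 = ∑' ξ, rho ξ ^ (2 * s) * ‖c ξ‖ ^ 2 :=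
  Real.sq_sqrt (tsum_nonneg fun ξ => mul_nonneg (rho_rpow_pos ξ _).le (sq_nonneg _))

theorem HMem.norm_le {s : ℝ} {c : (Fin n → ℤ) → E} (hc : HMem s c) (ξ : Fin n → ℤ) :
    rho ξ ^ s * ‖c ξ‖ ≤ hNorm s c := by
  refine le_of_sq_le_sq ?_ (hNorm_nonneg _ _)
  rw [hNorm_sq, rho_rpow_mul_sq]
  exact hc.le_tsum ξ fun η _ => mul_nonneg (rho_rpow_pos η _).le (sq_nonneg _)

theorem HMem.of_norm_eq {s : ℝ} {c : (Fin n → ℤ) → E} (x : ℓ²(Fin n → ℤ, F))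
    (hx : ∀ ξ, ‖x ξ‖ = rho ξ ^ s * ‖c ξ‖) : HMem s c :=
  (summable_norm_sq x).congr fun ξ => by rw [hx, rho_rpow_mul_sq]

theorem hNorm_eq_norm {s : ℝ} {c : (Fin n → ℤ) → E} (x : ℓ²(Fin n → ℤ, F))
    (hx : ∀ ξ, ‖x ξ‖ = rho ξ ^ s * ‖c ξ‖) : hNorm s c = ‖x‖ := by
  rw [hNorm, ← Real.sqrt_sq (norm_nonneg x), norm_sq_eq_tsum]
  simp only [hx, rho_rpow_mul_sq]

/-- The family `ρ^s ‖c‖` as an element of `ℓ²`, through which the triangle inequality for `hNorm`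
is inherited from `ℓ²`. -/
def HMem.absLp {s : ℝ} {c : (Fin n → ℤ) → E} (hc : HMem s c) : ℓ²(Fin n → ℤ, ℝ) :=
  ⟨fun ξ => rho ξ ^ s * ‖c ξ‖, memℓp_two_iff.2 <| Summable.congr hc fun ξ => by
    rw [Real.norm_eq_abs, sq_abs, rho_rpow_mul_sq]⟩

theorem HMem.norm_absLp {s : ℝ} {c : (Fin n → ℤ) → E} (hc : HMem s c) : ‖hc.absLp‖ = hNorm s c :=
  (hNorm_eq_norm hc.absLp fun ξ =>
    Real.norm_of_nonneg (mul_nonneg (rho_rpow_pos ξ s).le (norm_nonneg _))).symm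

theorem HMem.of_le_add {s r t a b : ℝ} {c : (Fin n → ℤ) → E} {d : (Fin n → ℤ) → F}
    {e : (Fin n → ℤ) → G} (hc : HMem s c) (hd : HMem r d) (ha : 0 ≤ a) (hb : 0 ≤ b)
    (h : ∀ ξ, rho ξ ^ t * ‖e ξ‖ ≤ a * (rho ξ ^ s * ‖c ξ‖) + b * (rho ξ ^ r * ‖d ξ‖)) :
    HMem t e ∧ hNorm t e ≤ a * hNorm s c + b * hNorm r d := by
  set z : ℓ²(Fin n → ℤ, ℝ) := a • hc.absLp + b • hd.absLp
  have hle : ∀ ξ, rho ξ ^ (2 * t) * ‖e ξ‖ ^ 2 ≤ ‖z ξ‖ ^ 2 := fun ξ => by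
    rw [← rho_rpow_mul_sq, Real.norm_eq_abs, sq_abs]
    exact pow_le_pow_left₀ (mul_nonneg (rho_rpow_pos ξ _).le (norm_nonneg _)) (h ξ) 2
  have he : HMem t e := Summable.of_nonneg_of_le
    (fun ξ => mul_nonneg (rho_rpow_pos ξ _).le (sq_nonneg _)) hle (summable_norm_sq z)
  refine ⟨he, ?_⟩
  calc hNorm t e ≤ ‖z‖ := by
        refine le_of_sq_le_sq ?_ (norm_nonneg _)
        rw [hNorm_sq, norm_sq_eq_tsum]
        exact he.tsum_le_tsum hle (summable_norm_sq z)
    _ ≤ ‖a • hc.absLp‖ + ‖b • hd.absLp‖ := norm_add_le _ _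
    _ = a * hNorm s c + b * hNorm r d := by
        rw [norm_smul, norm_smul, hc.norm_absLp, hd.norm_absLp, Real.norm_of_nonneg ha,
          Real.norm_of_nonneg hb]

theorem HMem.of_le {s t a : ℝ} {c : (Fin n → ℤ) → E} {e : (Fin n → ℤ) → G} (hc : HMem s c)
    (ha : 0 ≤ a) (h : ∀ ξ, rho ξ ^ t * ‖e ξ‖ ≤ a * (rho ξ ^ s * ‖c ξ‖)) :
    HMem t e ∧ hNorm t e ≤ a * hNorm s c := by
  simpa using hc.of_le_add hc ha le_rfl (e := e) (t := t) fun ξ => by simpa using h ξ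

section Operations

variable {s : ℝ} {c d : (Fin n → ℤ) → E}

theorem HMem.add_and_hNorm_add_le (hc : HMem s c) (hd : HMem s d) :
    HMem s (fun ξ => c ξ + d ξ) ∧ hNorm s (fun ξ => c ξ + d ξ) ≤ hNorm s c + hNorm s d := by
  simpa using hc.of_le_add hd zero_le_one zero_le_one (e := fun ξ => c ξ + d ξ) fun ξ => by
    rw [one_mul, one_mul, ← mul_add]
    exact mul_le_mul_of_nonneg_left (norm_add_le _ _) (rho_rpow_pos ξ _).le

theorem HMem.add (hc : HMem s c) (hd : HMem s d) : HMem s fun ξ => c ξ + d ξ :=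
  (hc.add_and_hNorm_add_le hd).1

theorem HMem.hNorm_add_le (hc : HMem s c) (hd : HMem s d) :
    hNorm s (fun ξ => c ξ + d ξ) ≤ hNorm s c + hNorm s d :=
  (hc.add_and_hNorm_add_le hd).2

theorem HMem.neg (hc : HMem s c) : HMem s fun ξ => -c ξ := by
  simpa [HMem] using hc

theorem hNorm_neg (s : ℝ) (c : (Fin n → ℤ) → E) : hNorm s (fun ξ => -c ξ) = hNorm s c := by
  simp only [hNorm, _root_.norm_neg]

theorem HMem.sub (hc : HMem s c) (hd : HMem s d) : HMem s fun ξ => c ξ - d ξ := by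
  simpa only [sub_eq_add_neg] using hc.add hd.neg

theorem HMem.hNorm_sub_le (hc : HMem s c) (hd : HMem s d) :
    hNorm s (fun ξ => c ξ - d ξ) ≤ hNorm s c + hNorm s d := by
  simpa only [sub_eq_add_neg, hNorm_neg] using hc.hNorm_add_le hd.neg

theorem HMem.mono_and_hNorm_le {t : ℝ} (hc : HMem s c) (hts : t ≤ s) :
    HMem t c ∧ hNorm t c ≤ hNorm s c := by
  simpa using hc.of_le zero_le_one (e := c) (t := t) fun ξ => by
    rw [one_mul]
    exact mul_le_mul_of_nonneg_right (Real.rpow_le_rpow_of_exponent_le (one_le_rho ξ) hts)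
      (norm_nonneg _)

theorem HMem.mono {t : ℝ} (hc : HMem s c) (hts : t ≤ s) : HMem t c := (hc.mono_and_hNorm_le hts).1

theorem HMem.hNorm_mono {t : ℝ} (hc : HMem s c) (hts : t ≤ s) : hNorm t c ≤ hNorm s c :=
  (hc.mono_and_hNorm_le hts).2

end Operations

variable [NormedSpace ℂ E]

theorem norm_rho_rpow_smul (s : ℝ) (ξ : Fin n → ℤ) (v : E) :
    ‖((rho ξ ^ s : ℝ) : ℂ) • v‖ = rho ξ ^ s * ‖v‖ := by
  rw [norm_smul, Complex.norm_real, Real.norm_of_nonneg (rho_rpow_pos ξ s).le]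

/-- The isometric identification `c ↦ ρ^s c` of the weighted space with `ℓ²`. -/
def HMem.toLp {s : ℝ} {c : (Fin n → ℤ) → E} (hc : HMem s c) : ℓ²(Fin n → ℤ, E) :=
  ⟨fun ξ => ((rho ξ ^ s : ℝ) : ℂ) • c ξ, memℓp_two_iff.2 <| Summable.congr hc fun ξ => by
    rw [norm_rho_rpow_smul, rho_rpow_mul_sq]⟩

theorem HMem.toLp_apply {s : ℝ} {c : (Fin n → ℤ) → E} (hc : HMem s c) (ξ : Fin n → ℤ) :
    hc.toLp ξ = ((rho ξ ^ s : ℝ) : ℂ) • c ξ := rfl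

theorem HMem.norm_toLp {s : ℝ} {c : (Fin n → ℤ) → E} (hc : HMem s c) :
    ‖hc.toLp‖ = hNorm s c :=
  (hNorm_eq_norm hc.toLp fun ξ => norm_rho_rpow_smul s ξ (c ξ)).symm

end WeightedSequences

/-- Complex vectors with the Euclidean norm. -/
abbrev Vec (n : ℕ) := EuclideanSpace ℂ (Fin n)

section Peetre

theorem rho_rpow_mul_rho_sub_rpow_neg_le_of_nonneg (ξ ζ : Fin n → ℤ) {t : ℝ} (ht : 0 ≤ t) :
    rho ξ ^ t * rho (ξ - ζ) ^ (-t) ≤ (2 * rho ζ) ^ t := by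
  have hle : rho ξ ≤ 2 * rho ζ * rho (ξ - ζ) := by
    simpa only [add_sub_cancel] using rho_add_le ζ (ξ - ζ)
  calc rho ξ ^ t * rho (ξ - ζ) ^ (-t)
      = (rho ξ / rho (ξ - ζ)) ^ t := by
        rw [Real.rpow_neg (rho_pos _).le, ← div_eq_mul_inv,
          ← Real.div_rpow (rho_pos _).le (rho_pos _).le]
    _ ≤ (2 * rho ζ) ^ t :=
        Real.rpow_le_rpow (div_pos (rho_pos _) (rho_pos _)).le
          ((div_le_iff₀ (rho_pos _)).2 hle) ht

/-- Peetre's inequality. -/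
theorem rho_rpow_mul_rho_sub_rpow_neg_le (ξ ζ : Fin n → ℤ) (t : ℝ) :
    rho ξ ^ t * rho (ξ - ζ) ^ (-t) ≤ (2 * rho ζ) ^ |t| := by
  rcases le_total 0 t with ht | ht
  · rw [abs_of_nonneg ht]
    exact rho_rpow_mul_rho_sub_rpow_neg_le_of_nonneg ξ ζ ht
  · have hswap := rho_rpow_mul_rho_sub_rpow_neg_le_of_nonneg (ξ - ζ) (-ζ) (neg_nonneg.2 ht)
    rw [rho_neg, sub_neg_eq_add, sub_add_cancel, neg_neg, mul_comm] at hswap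
    rwa [abs_of_nonpos ht]

end Peetre

theorem norm_smul_id_le (c : ℂ) : ‖c • ContinuousLinearMap.id ℂ (Vec n)‖ ≤ ‖c‖ :=
  ContinuousLinearMap.opNorm_le_bound _ (norm_nonneg _) fun x => norm_smul_le c x

section Advection

variable (U : Fin n → PSmooth n)

/-- The factor `∑ⱼ Ûⱼ(ζ) 2πi ηⱼ` by which the mode `ζ` of `U`, in the operator `U · ∇`, carries the
frequency `η` to `η + ζ`. -/
def advSymbol (ζ η : Fin n → ℤ) : ℂ := ∑ j, coeff (U j) ζ * (2 * Real.pi * Complex.I * η j)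

/-- The constant `2π ∑ⱼ |Ûⱼ(ζ)|` in the bound of `advSymbol U ζ η` by a multiple of `ρ(η)`. -/
def advBound (ζ : Fin n → ℤ) : ℝ := 2 * Real.pi * ∑ j, ‖coeff (U j) ζ‖

theorem advBound_nonneg (ζ : Fin n → ℤ) : 0 ≤ advBound U ζ :=
  mul_nonneg (by positivity) (Finset.sum_nonneg fun _ _ => norm_nonneg _)

theorem norm_two_pi_I_mul_le_rho (η : Fin n → ℤ) (j : Fin n) :
    ‖(2 * Real.pi * Complex.I * η j : ℂ)‖ ≤ 2 * Real.pi * rho η := by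
  calc ‖(2 * Real.pi * Complex.I * η j : ℂ)‖ = 2 * Real.pi * |(η j : ℝ)| := by
        simp [Complex.norm_intCast, abs_of_pos Real.pi_pos]
    _ ≤ 2 * Real.pi * rho η :=
        mul_le_mul_of_nonneg_left (abs_coord_le_rho η j) (by positivity)

theorem norm_advSymbol_le (ζ η : Fin n → ℤ) : ‖advSymbol U ζ η‖ ≤ advBound U ζ * rho η := by
  calc ‖advSymbol U ζ η‖ ≤ ∑ j, ‖coeff (U j) ζ‖ * (2 * Real.pi * rho η) :=
        norm_sum_le_of_le _ fun j _ => (norm_mul_le _ _).trans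
          (mul_le_mul_of_nonneg_left (norm_two_pi_I_mul_le_rho η j) (norm_nonneg _))
    _ = advBound U ζ * rho η := by
        rw [advBound, ← Finset.sum_mul]
        ring

theorem summable_advBound (N : ℕ) : Summable fun ζ => (2 * rho ζ) ^ N * advBound U ζ := by
  have hsum : Summable fun ζ => ∑ j, rho ζ ^ N * ‖coeff (U j) ζ‖ :=
    summable_sum fun j _ => summable_rho_pow_mul_norm_coeff (U j) N
  refine (hsum.mul_left (2 ^ N * (2 * Real.pi))).congr fun ζ => ?_
  rw [advBound, ← Finset.mul_sum, mul_pow]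
  ring

/-- The symbol `advSymbol` conjugated with the weights, so that it acts on `ℓ²` as the advection
operator does from `H^s` to `H^{s-1}`. Here `ξ` is the frequency of the output. -/
def advWeight (s : ℝ) (ζ ξ : Fin n → ℤ) : ℂ :=
  ((rho ξ ^ (s - 1) * rho (ξ - ζ) ^ (-s) : ℝ) : ℂ) * advSymbol U ζ (ξ - ζ)

theorem norm_advWeight_le (s : ℝ) (ζ ξ : Fin n → ℤ) :
    ‖advWeight U s ζ ξ‖ ≤ (2 * rho ζ) ^ ⌈|s - 1|⌉₊ * advBound U ζ := by
  have hweight : 0 ≤ rho ξ ^ (s - 1) * rho (ξ - ζ) ^ (-s) :=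
    (mul_pos (rho_rpow_pos _ _) (rho_rpow_pos _ _)).le
  have hshift : rho (ξ - ζ) ^ (-(s - 1)) = rho (ξ - ζ) ^ (-s) * rho (ξ - ζ) := by
    rw [show -(s - 1) = -s + 1 by ring, Real.rpow_add_one (rho_pos _).ne']
  have hceil : (2 * rho ζ) ^ |s - 1| ≤ (2 * rho ζ) ^ ⌈|s - 1|⌉₊ := by
    rw [← Real.rpow_natCast]
    exact Real.rpow_le_rpow_of_exponent_le (by linarith [one_le_rho ζ]) (Nat.le_ceil _)
  calc ‖advWeight U s ζ ξ‖
      = rho ξ ^ (s - 1) * rho (ξ - ζ) ^ (-s) * ‖advSymbol U ζ (ξ - ζ)‖ := by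
        rw [advWeight, norm_mul, Complex.norm_real, Real.norm_of_nonneg hweight]
    _ ≤ rho ξ ^ (s - 1) * rho (ξ - ζ) ^ (-s) * (advBound U ζ * rho (ξ - ζ)) :=
        mul_le_mul_of_nonneg_left (norm_advSymbol_le U ζ (ξ - ζ)) hweight
    _ = rho ξ ^ (s - 1) * rho (ξ - ζ) ^ (-(s - 1)) * advBound U ζ := by rw [hshift]; ring
    _ ≤ (2 * rho ζ) ^ ⌈|s - 1|⌉₊ * advBound U ζ :=
        mul_le_mul_of_nonneg_right ((rho_rpow_mul_rho_sub_rpow_neg_le ξ ζ (s - 1)).trans hceil)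
          (advBound_nonneg U ζ)

theorem advModeBound_nonneg (s : ℝ) (ζ : Fin n → ℤ) :
    0 ≤ (2 * rho ζ) ^ ⌈|s - 1|⌉₊ * advBound U ζ :=
  mul_nonneg (pow_nonneg (mul_nonneg zero_le_two (rho_pos ζ).le) _) (advBound_nonneg U ζ)

/-- The contribution of the mode `ζ` of `U` to `advOp`: a weighted translation by `ζ`. -/
def advMode (s : ℝ) (ζ : Fin n → ℤ) : ℓ²(Fin n → ℤ, Vec n) →L[ℂ] ℓ²(Fin n → ℤ, Vec n) :=
  weightedCompOp (sub_left_injective (b := ζ))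
    (fun ξ => (norm_smul_id_le (advWeight U s ζ ξ)).trans (norm_advWeight_le U s ζ ξ))
    (advModeBound_nonneg U s ζ)

theorem advMode_apply (s : ℝ) (ζ : Fin n → ℤ) (x : ℓ²(Fin n → ℤ, Vec n)) (ξ : Fin n → ℤ) :
    advMode U s ζ x ξ = advWeight U s ζ ξ • x (ξ - ζ) := rfl

/-- The advection operator `U · ∇` from `H^s` to `H^{s-1}`, both identified with `ℓ²`. -/
def advOp (s : ℝ) : ℓ²(Fin n → ℤ, Vec n) →L[ℂ] ℓ²(Fin n → ℤ, Vec n) := ∑' ζ, advMode U s ζ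

theorem hasSum_advMode (s : ℝ) : HasSum (advMode U s) (advOp U s) :=
  (Summable.of_norm_bounded (summable_advBound U _)
    fun ζ => norm_weightedCompOp_le _ _ (advModeBound_nonneg U s ζ)).hasSum

/-- The advection operator `U · ∇` on families of Fourier coefficients: the convolution of the
coefficients of `U` with those of the gradient. -/
def advSeq (c : (Fin n → ℤ) → Vec n) (ξ : Fin n → ℤ) : Vec n :=
  ∑' ζ, advSymbol U ζ (ξ - ζ) • c (ξ - ζ)

variable {U} {s : ℝ} {c : (Fin n → ℤ) → Vec n}

theorem HMem.advMode_toLp_apply (hc : HMem s c) (ζ ξ : Fin n → ℤ) :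
    advMode U s ζ hc.toLp ξ
      = ((rho ξ ^ (s - 1) : ℝ) : ℂ) • (advSymbol U ζ (ξ - ζ) • c (ξ - ζ)) := by
  have hcancel : ((rho (ξ - ζ) ^ (-s) : ℝ) : ℂ) * ((rho (ξ - ζ) ^ s : ℝ) : ℂ) = 1 := by
    rw [← Complex.ofReal_mul, ← Real.rpow_add (rho_pos _), neg_add_cancel, Real.rpow_zero,
      Complex.ofReal_one]
  rw [advMode_apply, HMem.toLp_apply, smul_smul, smul_smul, advWeight, Complex.ofReal_mul]
  congr 1
  linear_combination (((rho ξ ^ (s - 1) : ℝ) : ℂ) * advSymbol U ζ (ξ - ζ)) * hcancel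

theorem HMem.hasSum_advMode_toLp_apply (hc : HMem s c) (ξ : Fin n → ℤ) :
    HasSum (fun ζ => ((rho ξ ^ (s - 1) : ℝ) : ℂ) • (advSymbol U ζ (ξ - ζ) • c (ξ - ζ)))
      (advOp U s hc.toLp ξ) := by
  have heval : HasSum (fun ζ => advMode U s ζ hc.toLp ξ) (advOp U s hc.toLp ξ) :=
    (hasSum_advMode U s).mapL ((lp.evalCLM ℂ (fun _ : Fin n → ℤ => Vec n) 2 ξ).comp
      (ContinuousLinearMap.apply ℂ _ hc.toLp))
  simpa only [hc.advMode_toLp_apply] using heval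

theorem HMem.hasSum_advSeq (hc : HMem s c) (ξ : Fin n → ℤ) :
    HasSum (fun ζ => advSymbol U ζ (ξ - ζ) • c (ξ - ζ)) (advSeq U c ξ) := by
  have hne : ((rho ξ ^ (s - 1) : ℝ) : ℂ) ≠ 0 :=
    Complex.ofReal_ne_zero.2 (rho_rpow_pos ξ (s - 1)).ne'
  have hsummable := (hc.hasSum_advMode_toLp_apply (U := U) ξ).summable
  exact ((hsummable.const_smul (((rho ξ ^ (s - 1) : ℝ) : ℂ)⁻¹)).congr
    fun ζ => inv_smul_smul₀ hne _).hasSum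

theorem HMem.advOp_toLp_apply (hc : HMem s c) (ξ : Fin n → ℤ) :
    advOp U s hc.toLp ξ = ((rho ξ ^ (s - 1) : ℝ) : ℂ) • advSeq U c ξ :=
  (hc.hasSum_advMode_toLp_apply ξ).unique ((hc.hasSum_advSeq ξ).const_smul _)

theorem HMem.norm_advOp_toLp_apply (hc : HMem s c) (ξ : Fin n → ℤ) :
    ‖advOp U s hc.toLp ξ‖ = rho ξ ^ (s - 1) * ‖advSeq U c ξ‖ := by
  rw [hc.advOp_toLp_apply, norm_rho_rpow_smul]

theorem HMem.advSeq (hc : HMem s c) : HMem (s - 1) (advSeq U c) :=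
  HMem.of_norm_eq _ hc.norm_advOp_toLp_apply

theorem HMem.hNorm_advSeq_le (hc : HMem s c) :
    hNorm (s - 1) (PeriodicOseen.advSeq U c) ≤ ‖advOp U s‖ * hNorm s c := by
  rw [hNorm_eq_norm _ hc.norm_advOp_toLp_apply, ← hc.norm_toLp]
  exact (advOp U s).le_opNorm _

end Advection

section AdvectionAntisymmetry

variable {U : Fin n → PSmooth n} (hU : RealDivFree U)
include hU

theorem advSymbol_self (ζ : Fin n → ℤ) : advSymbol U ζ ζ = 0 := by
  have hdiv : coeffLin ζ (∑ j, pderivFun j (U j)) = 0 := by rw [hU.2, map_zero]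
  rw [← hdiv, map_sum]
  refine Finset.sum_congr rfl fun j _ => ?_
  change _ = coeff (pderivFun j (U j)) ζ
  rw [coeff_pderivFun]
  ring

theorem advSymbol_sub_self (ζ ξ : Fin n → ℤ) : advSymbol U ζ (ξ - ζ) = advSymbol U ζ ξ := by
  have hlinear : advSymbol U ζ (ξ - ζ) = advSymbol U ζ ξ - advSymbol U ζ ζ := by
    simp only [advSymbol, ← Finset.sum_sub_distrib, Pi.sub_apply, Int.cast_sub, mul_sub]
  rw [hlinear, advSymbol_self hU, sub_zero]

theorem conj_advSymbol_neg (ζ η : Fin n → ℤ) :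
    (starRingEnd ℂ) (advSymbol U (-ζ) η) = -advSymbol U ζ η := by
  rw [advSymbol, advSymbol, map_sum, ← Finset.sum_neg_distrib]
  refine Finset.sum_congr rfl fun j _ => ?_
  rw [coeff_neg_of_real (hU.1 j)]
  simp only [map_mul, Complex.conj_conj, Complex.conj_ofReal, Complex.conj_I, map_ofNat,
    map_intCast]
  ring

omit hU in
theorem norm_rho_inv_smul_id_le (ξ : Fin n → ℤ) :
    ‖((rho ξ ^ (-1 : ℝ) : ℝ) : ℂ) • ContinuousLinearMap.id ℂ (Vec n)‖ ≤ 1 := by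
  refine (norm_smul_id_le _).trans ?_
  rw [Complex.norm_real, Real.norm_of_nonneg (rho_rpow_pos ξ _).le]
  exact Real.rpow_le_one_of_one_le_of_nonpos (one_le_rho ξ) (by norm_num)

omit hU in
/-- The embedding of `H¹` into `H⁰`, both identified with `ℓ²`. -/
def embOp (n : ℕ) : ℓ²(Fin n → ℤ, Vec n) →L[ℂ] ℓ²(Fin n → ℤ, Vec n) :=
  weightedCompOp Function.injective_id norm_rho_inv_smul_id_le zero_le_one

omit hU in
theorem embOp_apply (y : ℓ²(Fin n → ℤ, Vec n)) (ξ : Fin n → ℤ) :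
    embOp n y ξ = ((rho ξ ^ (-1 : ℝ) : ℝ) : ℂ) • y ξ := rfl

theorem advMode_one_apply (ζ : Fin n → ℤ) (y : ℓ²(Fin n → ℤ, Vec n)) (ξ : Fin n → ℤ) :
    advMode U 1 ζ y ξ = advSymbol U ζ ξ • embOp n y (ξ - ζ) := by
  rw [advMode_apply, embOp_apply, smul_smul, advWeight, sub_self, Real.rpow_zero, one_mul,
    advSymbol_sub_self hU, mul_comm]

theorem hasSum_inner_embOp_advMode (ζ : Fin n → ℤ) (y : ℓ²(Fin n → ℤ, Vec n)) :
    HasSum (fun ξ => advSymbol U ζ ξ * inner ℂ (embOp n y ξ) (embOp n y (ξ - ζ)))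
      (inner ℂ (embOp n y) (advMode U 1 ζ y)) := by
  simpa only [advMode_one_apply hU, inner_smul_right] using
    lp.hasSum_inner (𝕜 := ℂ) (embOp n y) (advMode U 1 ζ y)

theorem inner_embOp_advMode_neg (ζ : Fin n → ℤ) (y : ℓ²(Fin n → ℤ, Vec n)) :
    inner ℂ (embOp n y) (advMode U 1 (-ζ) y)
      = -(starRingEnd ℂ) (inner ℂ (embOp n y) (advMode U 1 ζ y)) := by
  have hleft := (Equiv.subRight ζ).hasSum_iff.2 (hasSum_inner_embOp_advMode hU (-ζ) y)
  have hright := (Complex.hasSum_conj'.2 (hasSum_inner_embOp_advMode hU ζ y)).neg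
  refine hleft.unique (hright.congr_fun fun ξ => ?_)
  have hconj := conj_advSymbol_neg hU (-ζ) ξ
  have hshift := advSymbol_sub_self hU (-ζ) (ξ - ζ)
  rw [sub_neg_eq_add, sub_add_cancel] at hshift
  rw [neg_neg] at hconj
  simp only [Function.comp, Equiv.subRight_apply, sub_neg_eq_add, sub_add_cancel, map_mul]
  rw [inner_conj_symm, hconj, ← hshift, neg_mul, neg_neg]

theorem re_inner_advOp_embOp (y : ℓ²(Fin n → ℤ, Vec n)) :
    (inner ℂ (advOp U 1 y) (embOp n y)).re = 0 := by
  have hsum : HasSum (fun ζ => inner ℂ (embOp n y) (advMode U 1 ζ y))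
      (inner ℂ (embOp n y) (advOp U 1 y)) :=
    (hasSum_advMode U 1).mapL ((innerSL ℂ (embOp n y)).comp (ContinuousLinearMap.apply ℂ _ y))
  have hsum_neg := (Equiv.neg _).hasSum_iff.2 hsum
  simp only [Function.comp_def, Equiv.neg_apply, inner_embOp_advMode_neg hU] at hsum_neg
  have hantisymm := congrArg Complex.re (hsum_neg.unique (Complex.hasSum_conj'.2 hsum).neg)
  rw [Complex.neg_re, Complex.conj_re] at hantisymm
  rw [← inner_conj_symm, Complex.conj_re]
  linarith

end AdvectionAntisymmetry

section FrequencyVector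

/-- A frequency as a complex vector, so that `2πi ⟪ξ, v⟫` is the symbol of the divergence. -/
def cvec (ξ : Fin n → ℤ) : Vec n := WithLp.toLp 2 fun i => (ξ i : ℂ)

theorem cvec_zero : cvec (0 : Fin n → ℤ) = 0 := by
  ext i
  simp [cvec]

theorem norm_cvec_sq (ξ : Fin n → ℤ) : ‖cvec ξ‖ ^ 2 = ∑ i, (ξ i : ℝ) ^ 2 := by
  rw [EuclideanSpace.norm_sq_eq]
  simp [cvec]

theorem inner_cvec (ξ : Fin n → ℤ) (v : Vec n) : inner ℂ (cvec ξ) v = ∑ i, (ξ i : ℂ) * v i := by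
  rw [PiLp.inner_apply]
  simp [cvec, mul_comm]

theorem norm_cvec_le_rho (ξ : Fin n → ℤ) : ‖cvec ξ‖ ≤ rho ξ := by
  refine le_of_sq_le_sq ?_ (rho_pos ξ).le
  rw [norm_cvec_sq, rho_sq]
  linarith

theorem one_le_norm_cvec_sq {ξ : Fin n → ℤ} (hξ : ξ ≠ 0) : 1 ≤ ‖cvec ξ‖ ^ 2 := by
  obtain ⟨j, hj⟩ := Function.ne_iff.1 hξ
  have hj_sq : (1 : ℝ) ≤ (ξ j : ℝ) ^ 2 := by
    have : 0 < ξ j ^ 2 := sq_pos_of_ne_zero hj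
    exact_mod_cast this
  rw [norm_cvec_sq]
  exact hj_sq.trans (Finset.single_le_sum (f := fun i => (ξ i : ℝ) ^ 2)
    (fun _ _ => sq_nonneg _) (Finset.mem_univ j))

theorem norm_cvec_pos {ξ : Fin n → ℤ} (hξ : ξ ≠ 0) : 0 < ‖cvec ξ‖ :=
  (norm_nonneg _).lt_of_ne' fun hzero => by
    have hone := one_le_norm_cvec_sq hξ
    norm_num [hzero] at hone

theorem rho_sq_le_two_mul_norm_cvec_sq {ξ : Fin n → ℤ} (hξ : ξ ≠ 0) :
    rho ξ ^ 2 ≤ 2 * ‖cvec ξ‖ ^ 2 := by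
  have hone := one_le_norm_cvec_sq hξ
  rw [norm_cvec_sq] at hone ⊢
  rw [rho_sq]
  linarith

theorem rho_le_two_pi_mul_norm_cvec {ξ : Fin n → ℤ} (hξ : ξ ≠ 0) :
    rho ξ ≤ 2 * Real.pi * ‖cvec ξ‖ := by
  have hpi : 1 ≤ Real.pi := by linarith [Real.pi_gt_three]
  have htwo : rho ξ ≤ 2 * ‖cvec ξ‖ := by
    refine le_of_sq_le_sq ?_ (by positivity)
    linarith [rho_sq_le_two_mul_norm_cvec_sq hξ, sq_nonneg ‖cvec ξ‖, mul_pow 2 ‖cvec ξ‖ 2]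
  nlinarith [norm_nonneg (cvec ξ)]

theorem norm_two_pi_I_mul (z : ℂ) : ‖2 * Real.pi * Complex.I * z‖ = 2 * Real.pi * ‖z‖ := by
  simp [abs_of_pos Real.pi_pos]

end FrequencyVector

section LerayProjection

/-- The Leray projection at the frequency `ξ`, onto the vectors orthogonal to `ξ`. At `ξ = 0` it is
set to `0` instead of the identity, so that it also removes the mean. -/
def leray (ξ : Fin n → ℤ) : Vec n →L[ℂ] Vec n :=
  if ξ = 0 then 0 else (ℂ ∙ cvec ξ)ᗮ.starProjection

theorem leray_zero : leray (0 : Fin n → ℤ) = 0 := if_pos rfl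

theorem norm_leray_le (ξ : Fin n → ℤ) : ‖leray ξ‖ ≤ 1 := by
  unfold leray
  split_ifs
  · simp
  · exact Submodule.starProjection_norm_le _

theorem norm_leray_apply_le (ξ : Fin n → ℤ) (v : Vec n) : ‖leray ξ v‖ ≤ ‖v‖ := by
  simpa using (leray ξ).le_of_opNorm_le (norm_leray_le ξ) v

theorem leray_leray (ξ : Fin n → ℤ) (v : Vec n) : leray ξ (leray ξ v) = leray ξ v := by
  unfold leray
  split_ifs
  · simp
  · exact congrArg (fun T => T v) (Submodule.isIdempotentElem_starProjection (K := (ℂ ∙ cvec ξ)ᗮ))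

theorem inner_leray (ξ : Fin n → ℤ) (v w : Vec n) :
    inner ℂ (leray ξ v) w = inner ℂ v (leray ξ w) := by
  unfold leray
  split_ifs
  · simp
  · exact Submodule.inner_starProjection_left_eq_right _ _ _

theorem inner_cvec_leray (ξ : Fin n → ℤ) (v : Vec n) : inner ℂ (cvec ξ) (leray ξ v) = 0 := by
  unfold leray
  split_ifs
  · simp
  · exact Submodule.mem_orthogonal_singleton_iff_inner_right.1
      (Submodule.starProjection_apply_mem _ v)

theorem leray_eq_self {ξ : Fin n → ℤ} (hξ : ξ ≠ 0) {v : Vec n} (hv : inner ℂ (cvec ξ) v = 0) :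
    leray ξ v = v := by
  rw [leray, if_neg hξ, Submodule.starProjection_eq_self_iff]
  exact Submodule.mem_orthogonal_singleton_iff_inner_right.2 hv

theorem leray_cvec (ξ : Fin n → ℤ) : leray ξ (cvec ξ) = 0 := by
  rw [← inner_self_eq_zero (𝕜 := ℂ), inner_leray, leray_leray, inner_cvec_leray]

theorem inner_leray_cvec (ξ : Fin n → ℤ) (v : Vec n) : inner ℂ (leray ξ v) (cvec ξ) = 0 := by
  rw [inner_leray, leray_cvec, inner_zero_right]

theorem inner_leray_sub_leray (ξ : Fin n → ℤ) (v : Vec n) :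
    inner ℂ (leray ξ v) (v - leray ξ v) = 0 := by
  rw [inner_leray, map_sub, leray_leray, sub_self, inner_zero_right]

theorem norm_sq_eq_norm_leray_sq_add (ξ : Fin n → ℤ) (v : Vec n) :
    ‖v‖ ^ 2 = ‖leray ξ v‖ ^ 2 + ‖v - leray ξ v‖ ^ 2 := by
  simpa only [add_sub_cancel, ← sq] using
    norm_add_sq_eq_norm_sq_add_norm_sq_of_inner_eq_zero _ _ (inner_leray_sub_leray ξ v)

theorem re_inner_sub_leray (ξ : Fin n → ℤ) (v : Vec n) :
    (inner ℂ v (v - leray ξ v)).re = ‖v - leray ξ v‖ ^ 2 := by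
  rw [← inner_self_eq_norm_sq (𝕜 := ℂ), inner_sub_left v, inner_leray_sub_leray, sub_zero]
  rfl

theorem sub_leray {ξ : Fin n → ℤ} (hξ : ξ ≠ 0) (v : Vec n) :
    v - leray ξ v = (inner ℂ (cvec ξ) v / (‖cvec ξ‖ : ℂ) ^ 2) • cvec ξ := by
  have hne : (‖cvec ξ‖ : ℂ) ^ 2 ≠ 0 :=
    pow_ne_zero 2 (Complex.ofReal_ne_zero.2 (norm_cvec_pos hξ).ne')
  have horth : inner ℂ (cvec ξ) (v - (inner ℂ (cvec ξ) v / (‖cvec ξ‖ : ℂ) ^ 2) • cvec ξ) = 0 := by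
    rw [inner_sub_right, inner_smul_right, inner_self_eq_norm_sq_to_K]
    simp only [Complex.coe_algebraMap]
    rw [div_mul_cancel₀ _ hne, sub_self]
  have hproj := leray_eq_self hξ horth
  rw [map_sub, map_smul, leray_cvec, smul_zero, sub_zero] at hproj
  rw [hproj, sub_sub_cancel]

theorem rho_mul_norm_sub_leray_le {ξ : Fin n → ℤ} (hξ : ξ ≠ 0) (v : Vec n) :
    rho ξ * ‖v - leray ξ v‖ ≤ ‖2 * Real.pi * Complex.I * inner ℂ (cvec ξ) v‖ := by
  have hpos := norm_cvec_pos hξ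
  have hnorm : ‖v - leray ξ v‖ = ‖inner ℂ (cvec ξ) v‖ / ‖cvec ξ‖ := by
    rw [sub_leray hξ, norm_smul, norm_div, norm_pow, Complex.norm_real, norm_norm]
    field_simp
  rw [hnorm, norm_two_pi_I_mul, mul_div_assoc', div_le_iff₀ hpos]
  calc rho ξ * ‖inner ℂ (cvec ξ) v‖ ≤ 2 * Real.pi * ‖cvec ξ‖ * ‖inner ℂ (cvec ξ) v‖ :=
        mul_le_mul_of_nonneg_right (rho_le_two_pi_mul_norm_cvec hξ) (norm_nonneg _)
    _ = 2 * Real.pi * ‖inner ℂ (cvec ξ) v‖ * ‖cvec ξ‖ := by ring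

end LerayProjection

section StokesAtOneFrequency

/-- A second-order Fourier multiplier that is bounded, and elliptic on divergence-free vectors: all
that the argument uses of the viscous operator `-𝔏`. -/
structure IsEllipticSymbol (A : (Fin n → ℤ) → Vec n →L[ℂ] Vec n) (c₁ a₂ : ℝ) : Prop where
  pos : 0 < c₁
  nonneg : 0 ≤ a₂
  norm_le : ∀ ξ v, ‖A ξ v‖ ≤ a₂ * rho ξ ^ 2 * ‖v‖
  coercive : ∀ ξ, ξ ≠ 0 → ∀ v, inner ℂ (cvec ξ) v = 0 →
    c₁ * rho ξ ^ 2 * ‖v‖ ^ 2 ≤ (inner ℂ v (A ξ v)).re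

/-- The constant in the estimate of the velocity in the Stokes system. -/
def stokesVelocityConst (c₁ a₂ : ℝ) : ℝ := c₁⁻¹ * (1 + a₂) + 1

/-- The constant in the estimate of the velocity and the pressure in the Stokes system. -/
def stokesConst (c₁ a₂ : ℝ) : ℝ := 1 + (1 + a₂) * stokesVelocityConst c₁ a₂

namespace IsEllipticSymbol

variable {A : (Fin n → ℤ) → Vec n →L[ℂ] Vec n} {c₁ a₂ : ℝ} (hA : IsEllipticSymbol A c₁ a₂)
include hA

theorem stokesVelocityConst_pos : 0 < stokesVelocityConst c₁ a₂ := by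
  have := hA.pos
  have := hA.nonneg
  unfold stokesVelocityConst
  positivity

theorem stokesConst_pos : 0 < stokesConst c₁ a₂ := by
  have := hA.nonneg
  have := hA.stokesVelocityConst_pos
  unfold stokesConst
  positivity

variable {ξ : Fin n → ℤ} (hξ : ξ ≠ 0) {u f : Vec n} {p g : ℂ}
  (hmomentum : A ξ u + (2 * Real.pi * Complex.I * p) • cvec ξ = f)
  (hdiv : 2 * Real.pi * Complex.I * inner ℂ (cvec ξ) u = g)
include hξ hmomentum

theorem mul_norm_leray_le :
    c₁ * (rho ξ ^ 2 * ‖leray ξ u‖) ≤ ‖f‖ + a₂ * rho ξ ^ 2 * ‖u - leray ξ u‖ := by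
  set w := leray ξ u with hw
  have htest : inner ℂ w (A ξ w) = inner ℂ w (f - A ξ (u - w)) := by
    rw [← hmomentum, map_sub, ← sub_eq_zero, ← inner_sub_right]
    simp only [inner_sub_right, inner_add_right, inner_smul_right, hw, inner_leray_cvec]
    ring
  have henergy : ‖w‖ * (c₁ * (rho ξ ^ 2 * ‖w‖)) ≤ ‖w‖ * (‖f‖ + a₂ * rho ξ ^ 2 * ‖u - w‖) :=
    calc ‖w‖ * (c₁ * (rho ξ ^ 2 * ‖w‖)) = c₁ * rho ξ ^ 2 * ‖w‖ ^ 2 := by ring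
      _ ≤ (inner ℂ w (A ξ w)).re := hA.coercive ξ hξ w (inner_cvec_leray ξ u)
      _ ≤ ‖w‖ * ‖f - A ξ (u - w)‖ := by
          rw [htest]
          exact (Complex.re_le_norm _).trans (norm_inner_le_norm _ _)
      _ ≤ ‖w‖ * (‖f‖ + a₂ * rho ξ ^ 2 * ‖u - w‖) := mul_le_mul_of_nonneg_left
          ((norm_sub_le _ _).trans (add_le_add_right (hA.norm_le ξ (u - w)) _)) (norm_nonneg _)
  rcases (norm_nonneg w).eq_or_lt with hzero | hpos
  · have := hA.nonneg
    rw [← hzero, mul_zero, mul_zero]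
    positivity
  · exact le_of_mul_le_mul_left henergy hpos

include hdiv

theorem rho_sq_mul_norm_velocity_le :
    rho ξ ^ 2 * ‖u‖ ≤ stokesVelocityConst c₁ a₂ * (‖f‖ + rho ξ * ‖g‖) := by
  have hc := hA.pos
  have ha := hA.nonneg
  have hρ := (rho_pos ξ).le
  have hproj := rho_mul_norm_sub_leray_le hξ u
  rw [hdiv] at hproj
  have hgradient : rho ξ ^ 2 * ‖u - leray ξ u‖ ≤ rho ξ * ‖g‖ := by
    rw [sq, mul_assoc]
    exact mul_le_mul_of_nonneg_left hproj hρ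
  have hsolenoidal : rho ξ ^ 2 * ‖leray ξ u‖ ≤ c₁⁻¹ * (1 + a₂) * (‖f‖ + rho ξ * ‖g‖) := by
    rw [mul_assoc, le_inv_mul_iff₀ hc]
    have hleray := hA.mul_norm_leray_le hξ hmomentum
    have hgradient_mul := mul_le_mul_of_nonneg_left hgradient ha
    linarith [mul_nonneg ha (norm_nonneg f), mul_nonneg hρ (norm_nonneg g)]
  have htriangle : ‖u‖ ≤ ‖leray ξ u‖ + ‖u - leray ξ u‖ := by
    simpa only [add_sub_cancel] using norm_add_le (leray ξ u) (u - leray ξ u)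
  calc rho ξ ^ 2 * ‖u‖ ≤ rho ξ ^ 2 * (‖leray ξ u‖ + ‖u - leray ξ u‖) :=
        mul_le_mul_of_nonneg_left htriangle (sq_nonneg _)
    _ = rho ξ ^ 2 * ‖leray ξ u‖ + rho ξ ^ 2 * ‖u - leray ξ u‖ := mul_add _ _ _
    _ ≤ c₁⁻¹ * (1 + a₂) * (‖f‖ + rho ξ * ‖g‖) + (‖f‖ + rho ξ * ‖g‖) :=
        add_le_add hsolenoidal (hgradient.trans (le_add_of_nonneg_left (norm_nonneg f)))
    _ = stokesVelocityConst c₁ a₂ * (‖f‖ + rho ξ * ‖g‖) := by unfold stokesVelocityConst; ring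

theorem stokes_le :
    rho ξ ^ 2 * ‖u‖ ≤ stokesConst c₁ a₂ * (‖f‖ + rho ξ * ‖g‖) ∧
      rho ξ * ‖p‖ ≤ stokesConst c₁ a₂ * (‖f‖ + rho ξ * ‖g‖) := by
  have ha := hA.nonneg
  have hconst := hA.stokesVelocityConst_pos.le
  have hvelocity := hA.rho_sq_mul_norm_velocity_le hξ hmomentum hdiv
  have hpressure : 2 * Real.pi * ‖cvec ξ‖ * ‖p‖ = ‖f - A ξ u‖ := by
    rw [← hmomentum, add_sub_cancel_left, norm_smul, norm_two_pi_I_mul, mul_right_comm]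
  set X := ‖f‖ + rho ξ * ‖g‖
  have hfX : ‖f‖ ≤ X := le_add_of_nonneg_right (mul_nonneg (rho_pos ξ).le (norm_nonneg _))
  have hX_nonneg : 0 ≤ X := (norm_nonneg f).trans hfX
  constructor
  · refine hvelocity.trans (mul_le_mul_of_nonneg_right ?_ hX_nonneg)
    unfold stokesConst
    nlinarith [mul_nonneg ha hconst]
  · calc rho ξ * ‖p‖ ≤ 2 * Real.pi * ‖cvec ξ‖ * ‖p‖ :=
          mul_le_mul_of_nonneg_right (rho_le_two_pi_mul_norm_cvec hξ) (norm_nonneg _)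
      _ ≤ ‖f‖ + ‖A ξ u‖ := hpressure.le.trans (norm_sub_le _ _)
      _ ≤ X + a₂ * (rho ξ ^ 2 * ‖u‖) := by linarith [hA.norm_le ξ u]
      _ ≤ X + a₂ * (stokesVelocityConst c₁ a₂ * X) := by gcongr
      _ ≤ stokesConst c₁ a₂ * X := by
          unfold stokesConst
          nlinarith [mul_nonneg hconst hX_nonneg]

end IsEllipticSymbol

end StokesAtOneFrequency

section TensorSymbol

variable {ι E F : Type*} [AddCommGroup E] [Module ℝ E] [AddCommGroup F] [Module ℝ F]

/-- The symbol of the strain `E(u)`, without the factor `2πi`, at the frequency `η`. -/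
def strainSymbol (η : ι → ℝ) (p : ι → E) : Matrix ι ι E :=
  Matrix.of fun j β => (1 / 2 : ℝ) • (η j • p β + η β • p j)

theorem strainSymbol_apply (η : ι → ℝ) (p : ι → E) (j β : ι) :
    strainSymbol η p j β = (1 / 2 : ℝ) • (η j • p β + η β • p j) := rfl

variable [Fintype ι] (a : ι → ι → ι → ι → ℝ)

/-- The symbol of `-𝔏`, without the factor `4π²`. The values of `p` are taken in any real vector
space, so that the symbol commutes with real and imaginary parts. -/
def tensorSymbol (η : ι → ℝ) (p : ι → E) (k : ι) : E :=
  ∑ α, η α • ∑ j, ∑ β, a k j α β • strainSymbol η p j β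

theorem tensorSymbol_add (η : ι → ℝ) (p q : ι → E) (k : ι) :
    tensorSymbol a η (p + q) k = tensorSymbol a η p k + tensorSymbol a η q k := by
  simp only [tensorSymbol, strainSymbol_apply, Pi.add_apply, smul_add, Finset.sum_add_distrib]
  abel

theorem tensorSymbol_map (L : E →ₗ[ℝ] F) (η : ι → ℝ) (p : ι → E) (k : ι) :
    tensorSymbol a η (fun i => L (p i)) k = L (tensorSymbol a η p k) := by
  simp only [tensorSymbol, strainSymbol_apply, map_sum, map_smul, map_add]

end TensorSymbol

section TensorSymbolBound

variable {ι E : Type*} [NormedAddCommGroup E] [NormedSpace ℝ E] {η : ι → ℝ} {p : ι → E} {R M : ℝ}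

theorem norm_strainSymbol_le (hη : ∀ i, |η i| ≤ R) (hp : ∀ i, ‖p i‖ ≤ M) (j β : ι) :
    ‖strainSymbol η p j β‖ ≤ R * M := by
  have hprod : ∀ i l, ‖η i • p l‖ ≤ R * M := fun i l => by
    rw [norm_smul]
    exact mul_le_mul (hη i) (hp l) (norm_nonneg _) ((abs_nonneg _).trans (hη i))
  rw [strainSymbol_apply, norm_smul, Real.norm_of_nonneg (by norm_num)]
  linarith [norm_add_le_of_le (hprod j β) (hprod β j)]

variable [Fintype ι]

theorem abs_tensor_le (a : ι → ι → ι → ι → ℝ) (k j α β : ι) : |a k j α β| ≤ ‖a‖ :=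
  (norm_le_pi_norm (a k j α) β).trans <| (norm_le_pi_norm (a k j) α).trans <|
    (norm_le_pi_norm (a k) j).trans (norm_le_pi_norm a k)

theorem norm_tensorSymbol_le (a : ι → ι → ι → ι → ℝ) (hη : ∀ i, |η i| ≤ R) (hp : ∀ i, ‖p i‖ ≤ M)
    (k : ι) : ‖tensorSymbol a η p k‖ ≤ Fintype.card ι ^ 3 * ‖a‖ * (R ^ 2 * M) := by
  have hterm : ∀ α j β, ‖a k j α β • strainSymbol η p j β‖ ≤ ‖a‖ * (R * M) := fun α j β => by
    rw [norm_smul]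
    exact mul_le_mul (abs_tensor_le a k j α β) (norm_strainSymbol_le hη hp j β) (norm_nonneg _)
      (norm_nonneg _)
  have hrow : ∀ α, ‖η α • ∑ j, ∑ β, a k j α β • strainSymbol η p j β‖
      ≤ R * (Fintype.card ι * (Fintype.card ι * (‖a‖ * (R * M)))) := fun α => by
    rw [norm_smul]
    refine mul_le_mul (hη α) ?_ (norm_nonneg _) ((abs_nonneg _).trans (hη α))
    refine (norm_sum_le_of_le _ fun j _ => norm_sum_le_of_le _ fun β _ => hterm α j β).trans_eq ?_
    simp only [Finset.sum_const, Finset.card_univ, nsmul_eq_mul]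
  refine (norm_sum_le_of_le _ fun α _ => hrow α).trans_eq ?_
  simp only [Finset.sum_const, Finset.card_univ, nsmul_eq_mul]
  ring

end TensorSymbolBound

section TensorSymbolCoercivity

variable {ι : Type*}

theorem strainSymbol_transpose (η p : ι → ℝ) : (strainSymbol η p).transpose = strainSymbol η p := by
  ext k α
  rw [Matrix.transpose_apply, strainSymbol_apply, strainSymbol_apply, add_comm]

variable [Fintype ι]

theorem sum_strainSymbol_mul {X : ι → ι → ℝ} (hX : ∀ k α, X k α = X α k) (η p : ι → ℝ) :
    ∑ k, ∑ α, strainSymbol η p k α * X k α = ∑ k, p k * ∑ α, η α * X k α := by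
  have hswap : ∑ k, ∑ α, η k * p α * X k α = ∑ k, ∑ α, η α * p k * X k α := by
    rw [Finset.sum_comm]
    exact Finset.sum_congr rfl fun k _ => Finset.sum_congr rfl fun α _ => by rw [hX]
  calc ∑ k, ∑ α, strainSymbol η p k α * X k α
      = (∑ k, ∑ α, η k * p α * X k α + ∑ k, ∑ α, η α * p k * X k α) / 2 := by
        simp only [← Finset.sum_add_distrib, Finset.sum_div, strainSymbol_apply, smul_eq_mul]
        exact Finset.sum_congr rfl fun k _ => Finset.sum_congr rfl fun α _ => by ring
    _ = ∑ k, ∑ α, η α * p k * X k α := by rw [hswap, add_self_div_two]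
    _ = ∑ k, p k * ∑ α, η α * X k α := by
        simp only [Finset.mul_sum]
        exact Finset.sum_congr rfl fun k _ => Finset.sum_congr rfl fun α _ => by ring

theorem sum_strainSymbol_sq {η p : ι → ℝ} (horth : ∑ k, η k * p k = 0) :
    ∑ k, ∑ α, strainSymbol η p k α ^ 2 = (∑ k, η k ^ 2) * (∑ k, p k ^ 2) / 2 := by
  have hsquare : ∀ k α, strainSymbol η p k α ^ 2
      = η k ^ 2 * p α ^ 2 / 4 + p k ^ 2 * η α ^ 2 / 4 + (η k * p k) * (η α * p α) / 2 :=
    fun k α => by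
      rw [strainSymbol_apply]
      simp only [smul_eq_mul]
      ring
  simp only [hsquare, Finset.sum_add_distrib, ← Finset.sum_div, ← Finset.sum_mul_sum, horth]
  ring

theorem strainSymbol_trace {η p : ι → ℝ} (horth : ∑ k, η k * p k = 0) :
    (strainSymbol η p).trace = 0 := by
  simp only [Matrix.trace, Matrix.diag_apply, strainSymbol_apply, smul_eq_mul, ← Finset.mul_sum,
    Finset.sum_add_distrib, horth, add_zero, mul_zero]

variable {a : Fin n → Fin n → Fin n → Fin n → ℝ}

theorem sum_mul_tensorSymbol (ha : TensorSymmetric a) (η p : Fin n → ℝ) :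
    ∑ k, p k * tensorSymbol a η p k =
      ∑ k, ∑ j, ∑ α, ∑ β, a k j α β * strainSymbol η p k α * strainSymbol η p j β := by
  have hsymm : ∀ k α, ∑ j, ∑ β, a k j α β * strainSymbol η p j β =
      ∑ j, ∑ β, a α j k β * strainSymbol η p j β := fun k α =>
    Finset.sum_congr rfl fun j _ => Finset.sum_congr rfl fun β _ => by rw [(ha k j α β).1]
  calc ∑ k, p k * tensorSymbol a η p k
      = ∑ k, ∑ α, strainSymbol η p k α * ∑ j, ∑ β, a k j α β * strainSymbol η p j β :=
        (sum_strainSymbol_mul hsymm η p).symm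
    _ = ∑ k, ∑ j, ∑ α, ∑ β, a k j α β * strainSymbol η p k α * strainSymbol η p j β := by
        refine Finset.sum_congr rfl fun k _ => ?_
        rw [Finset.sum_comm]
        simp only [Finset.mul_sum, mul_left_comm, mul_assoc]

theorem tensorSymbol_coercive (ha : TensorSymmetric a) {CA : ℝ} (hell : TensorElliptic a CA)
    {η p : Fin n → ℝ} (horth : ∑ k, η k * p k = 0) :
    (∑ k, η k ^ 2) * (∑ k, p k ^ 2) / 2 ≤ CA * ∑ k, p k * tensorSymbol a η p k := by
  rw [sum_mul_tensorSymbol ha, ← sum_strainSymbol_sq horth]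
  exact hell _ (strainSymbol_transpose η p) (strainSymbol_trace horth)

end TensorSymbolCoercivity

section ViscousSymbol

theorem norm_le_sqrt_card_mul {𝕜 ι : Type*} [RCLike 𝕜] [Fintype ι] {v : EuclideanSpace 𝕜 ι} {c : ℝ}
    (hc : 0 ≤ c) (hv : ∀ i, ‖v i‖ ≤ c) : ‖v‖ ≤ √(Fintype.card ι) * c := by
  rw [EuclideanSpace.norm_eq, ← Real.sqrt_sq hc, ← Real.sqrt_mul (Nat.cast_nonneg _)]
  refine Real.sqrt_le_sqrt ((Finset.sum_le_card_nsmul _ _ (c ^ 2) fun i _ =>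
    pow_le_pow_left₀ (norm_nonneg _) (hv i) 2).trans_eq ?_)
  rw [Finset.card_univ, nsmul_eq_mul]

variable (a : Fin n → Fin n → Fin n → Fin n → ℝ)

/-- The symbol of `-𝔏`. -/
def viscSymbol (ξ : Fin n → ℤ) : Vec n →L[ℂ] Vec n :=
  LinearMap.toContinuousLinearMap
    { toFun v := WithLp.toLp 2 fun k => (4 * Real.pi ^ 2) • tensorSymbol a (fun i => ξ i) v k
      map_add' v w := by
        ext k
        rw [PiLp.add_apply, ← smul_add, ← tensorSymbol_add]
        rfl
      map_smul' c v := by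
        ext k
        exact (congrArg _ (tensorSymbol_map a (LinearMap.mulLeft ℝ c) _ v k)).trans
          (smul_comm _ c _) }

theorem viscSymbol_apply (ξ : Fin n → ℤ) (v : Vec n) (k : Fin n) :
    viscSymbol a ξ v k = (4 * Real.pi ^ 2) • tensorSymbol a (fun i => ξ i) v k := rfl

/-- The constant in the bound of the symbol of `-𝔏` in terms of the norm of the tensor. -/
def viscBound (n : ℕ) (A₀ : ℝ) : ℝ := √n * (4 * Real.pi ^ 2 * (n ^ 3 * A₀))

theorem viscBound_nonneg (n : ℕ) {A₀ : ℝ} (hA₀ : 0 ≤ A₀) : 0 ≤ viscBound n A₀ := by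
  unfold viscBound
  positivity

theorem norm_viscSymbol_le (ξ : Fin n → ℤ) (v : Vec n) :
    ‖viscSymbol a ξ v‖ ≤ viscBound n ‖a‖ * rho ξ ^ 2 * ‖v‖ := by
  have hcomponent : ∀ k, ‖viscSymbol a ξ v k‖ ≤
      4 * Real.pi ^ 2 * (n ^ 3 * ‖a‖ * (rho ξ ^ 2 * ‖v‖)) := fun k => by
    rw [viscSymbol_apply, norm_smul, Real.norm_of_nonneg (by positivity)]
    have hsymbol := norm_tensorSymbol_le a (abs_coord_le_rho ξ) (PiLp.norm_apply_le v) k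
    rw [Fintype.card_fin] at hsymbol
    exact mul_le_mul_of_nonneg_left hsymbol (by positivity)
  refine (norm_le_sqrt_card_mul (by positivity) hcomponent).trans_eq ?_
  rw [Fintype.card_fin, viscBound]
  ring

theorem re_inner_viscSymbol (ξ : Fin n → ℤ) (v : Vec n) :
    (inner ℂ v (viscSymbol a ξ v)).re = 4 * Real.pi ^ 2 *
      (∑ k, (v k).re * tensorSymbol a (fun i => ξ i) (fun i => (v i).re) k +
        ∑ k, (v k).im * tensorSymbol a (fun i => ξ i) (fun i => (v i).im) k) := by
  rw [PiLp.inner_apply, Complex.re_sum, ← Finset.sum_add_distrib, Finset.mul_sum]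
  refine Finset.sum_congr rfl fun k _ => ?_
  have hre := tensorSymbol_map a Complex.reLm (fun i => ξ i) v k
  have him := tensorSymbol_map a Complex.imLm (fun i => ξ i) v k
  simp only [Complex.reLm_coe, Complex.imLm_coe] at hre him
  rw [viscSymbol_apply, hre, him, RCLike.inner_apply, Complex.mul_re, Complex.conj_re,
    Complex.conj_im, Complex.smul_re, Complex.smul_im, smul_eq_mul, smul_eq_mul]
  ring

theorem norm_sq_eq_sum_re_sq_add_sum_im_sq {ι : Type*} [Fintype ι] (v : EuclideanSpace ℂ ι) :
    ‖v‖ ^ 2 = ∑ k, (v k).re ^ 2 + ∑ k, (v k).im ^ 2 := by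
  simp only [EuclideanSpace.norm_sq_eq, Complex.sq_norm, Complex.normSq_apply, ← sq,
    Finset.sum_add_distrib]

variable {a}

theorem isEllipticSymbol_viscSymbol (ha : TensorSymmetric a) {CA : ℝ} (hCA : 0 < CA)
    (hell : TensorElliptic a CA) :
    IsEllipticSymbol (viscSymbol a) (Real.pi ^ 2 / CA) (viscBound n ‖a‖) where
  pos := div_pos (pow_pos Real.pi_pos 2) hCA
  nonneg := viscBound_nonneg n (norm_nonneg a)
  norm_le := norm_viscSymbol_le a
  coercive ξ hξ v hv := by
    have hsum : ∑ i, (ξ i : ℝ) • v i = 0 := by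
      simpa only [inner_cvec, Complex.real_smul, Complex.ofReal_intCast] using hv
    have hre : ∑ i, (ξ i : ℝ) * (v i).re = 0 := by
      simpa only [map_sum, map_smul, map_zero, Complex.reLm_coe, smul_eq_mul]
        using congrArg Complex.reLm hsum
    have him : ∑ i, (ξ i : ℝ) * (v i).im = 0 := by
      simpa only [map_sum, map_smul, map_zero, Complex.imLm_coe, smul_eq_mul]
        using congrArg Complex.imLm hsum
    rw [re_inner_viscSymbol, div_mul_eq_mul_div, div_mul_eq_mul_div, div_le_iff₀ hCA,
      norm_sq_eq_sum_re_sq_add_sum_im_sq]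
    set Q := ∑ k, (v k).re ^ 2 + ∑ k, (v k).im ^ 2 with hQ
    have : 0 ≤ Q := by positivity
    have hcoercive := add_le_add (tensorSymbol_coercive ha hell hre)
      (tensorSymbol_coercive ha hell him)
    rw [← add_div, ← mul_add, ← mul_add, ← norm_cvec_sq, ← hQ] at hcoercive
    calc Real.pi ^ 2 * rho ξ ^ 2 * Q ≤ Real.pi ^ 2 * (2 * ‖cvec ξ‖ ^ 2) * Q := by
          gcongr
          exact rho_sq_le_two_mul_norm_cvec_sq hξ
      _ = 4 * Real.pi ^ 2 * (‖cvec ξ‖ ^ 2 * Q / 2) := by ring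
      _ ≤ 4 * Real.pi ^ 2 * _ := mul_le_mul_of_nonneg_left hcoercive (by positivity)
      _ = _ := by ring

end ViscousSymbol

/-! ### The energy operator -/

section Energy

variable (n) in
/-- The projection onto divergence-free square-summable families of Fourier coefficients. -/
def lerayOp : ℓ²(Fin n → ℤ, Vec n) →L[ℂ] ℓ²(Fin n → ℤ, Vec n) :=
  weightedCompOp Function.injective_id norm_leray_le zero_le_one

theorem lerayOp_apply (x : ℓ²(Fin n → ℤ, Vec n)) (ξ : Fin n → ℤ) :
    lerayOp n x ξ = leray ξ (x ξ) := rfl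

theorem norm_lerayOp_apply_le (x : ℓ²(Fin n → ℤ, Vec n)) : ‖lerayOp n x‖ ≤ ‖x‖ := by
  simpa only [one_mul] using (lerayOp n).le_of_opNorm_le (norm_weightedCompOp_le _ _ _) x

theorem inner_lerayOp (x y : ℓ²(Fin n → ℤ, Vec n)) :
    inner ℂ x (lerayOp n y) = inner ℂ (lerayOp n x) y := by
  rw [lp.inner_eq_tsum, lp.inner_eq_tsum]
  exact tsum_congr fun ξ => (inner_leray ξ (x ξ) (y ξ)).symm

theorem inner_embOp (x y : ℓ²(Fin n → ℤ, Vec n)) :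
    inner ℂ x (embOp n y) = inner ℂ (embOp n x) y := by
  rw [lp.inner_eq_tsum, lp.inner_eq_tsum]
  refine tsum_congr fun ξ => ?_
  rw [embOp_apply, embOp_apply, inner_smul_left (x ξ), inner_smul_right (x ξ),
    Complex.conj_ofReal]

/-- The symbol `P A P / ρ² + (1 - P)`, with `P` the Leray projection: the viscous part of the
energy form on `H¹`, made invertible on gradients. -/
def energySymbol (A : (Fin n → ℤ) → Vec n →L[ℂ] Vec n) (ξ : Fin n → ℤ) : Vec n →L[ℂ] Vec n :=
  (((rho ξ ^ 2)⁻¹ : ℝ) : ℂ) • (leray ξ ∘L A ξ ∘L leray ξ)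
    + (ContinuousLinearMap.id ℂ _ - leray ξ)

variable {A : (Fin n → ℤ) → Vec n →L[ℂ] Vec n} {c₁ a₂ : ℝ}

theorem energySymbol_apply (ξ : Fin n → ℤ) (v : Vec n) :
    energySymbol A ξ v
      = (((rho ξ ^ 2)⁻¹ : ℝ) : ℂ) • leray ξ (A ξ (leray ξ v)) + (v - leray ξ v) := rfl

namespace IsEllipticSymbol

variable (hA : IsEllipticSymbol A c₁ a₂)
include hA

theorem add_two_nonneg : 0 ≤ a₂ + 2 := add_nonneg hA.nonneg zero_le_two

theorem norm_energySymbol_le (ξ : Fin n → ℤ) : ‖energySymbol A ξ‖ ≤ a₂ + 2 := by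
  have := hA.nonneg
  have := rho_pos ξ
  refine ContinuousLinearMap.opNorm_le_bound _ hA.add_two_nonneg fun v => ?_
  have hsolenoidal : ‖(((rho ξ ^ 2)⁻¹ : ℝ) : ℂ) • leray ξ (A ξ (leray ξ v))‖ ≤ a₂ * ‖v‖ := by
    rw [norm_smul, Complex.norm_real, Real.norm_of_nonneg (by positivity),
      inv_mul_le_iff₀ (by positivity)]
    calc ‖leray ξ (A ξ (leray ξ v))‖ ≤ a₂ * rho ξ ^ 2 * ‖leray ξ v‖ :=
          (norm_leray_apply_le _ _).trans (hA.norm_le _ _)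
      _ ≤ a₂ * rho ξ ^ 2 * ‖v‖ := by
          gcongr
          exact norm_leray_apply_le _ _
      _ = rho ξ ^ 2 * (a₂ * ‖v‖) := by ring
  have hgradient : ‖v - leray ξ v‖ ≤ ‖v‖ + ‖v‖ :=
    (norm_sub_le _ _).trans (add_le_add_right (norm_leray_apply_le ξ v) _)
  calc ‖energySymbol A ξ v‖ ≤ a₂ * ‖v‖ + (‖v‖ + ‖v‖) :=
        norm_add_le_of_le hsolenoidal hgradient
    _ = (a₂ + 2) * ‖v‖ := by ring

theorem mul_norm_leray_sq_le (ξ : Fin n → ℤ) (v : Vec n) :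
    c₁ * ‖leray ξ v‖ ^ 2 ≤ (rho ξ ^ 2)⁻¹ * (inner ℂ (leray ξ v) (A ξ (leray ξ v))).re := by
  rcases eq_or_ne ξ 0 with rfl | hξ
  · simp only [leray_zero, zero_apply, norm_zero, inner_zero_left,
      Complex.zero_re, ne_eq, OfNat.ofNat_ne_zero, not_false_eq_true, zero_pow, mul_zero, le_refl]
  · rw [le_inv_mul_iff₀ (pow_pos (rho_pos ξ) 2), mul_left_comm, ← mul_assoc]
    exact hA.coercive ξ hξ _ (inner_cvec_leray ξ v)

theorem energySymbol_coercive (ξ : Fin n → ℤ) (v : Vec n) :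
    min c₁ 1 * ‖v‖ ^ 2 ≤ (inner ℂ v (energySymbol A ξ v)).re := by
  have hsolenoidal : min c₁ 1 * ‖leray ξ v‖ ^ 2 ≤ c₁ * ‖leray ξ v‖ ^ 2 :=
    mul_le_mul_of_nonneg_right (min_le_left _ _) (sq_nonneg _)
  have hgradient : min c₁ 1 * ‖v - leray ξ v‖ ^ 2 ≤ 1 * ‖v - leray ξ v‖ ^ 2 :=
    mul_le_mul_of_nonneg_right (min_le_right _ _) (sq_nonneg _)
  rw [energySymbol_apply, inner_add_right, inner_smul_right, ← inner_leray, Complex.add_re,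
    Complex.re_ofReal_mul, re_inner_sub_leray, norm_sq_eq_norm_leray_sq_add ξ v]
  linarith [hA.mul_norm_leray_sq_le ξ v]

omit hA in
/-- The viscous part of `energyOp`. -/
def viscousOp (hA : IsEllipticSymbol A c₁ a₂) :
    ℓ²(Fin n → ℤ, Vec n) →L[ℂ] ℓ²(Fin n → ℤ, Vec n) :=
  weightedCompOp Function.injective_id hA.norm_energySymbol_le hA.add_two_nonneg

theorem viscousOp_coercive (x : ℓ²(Fin n → ℤ, Vec n)) :
    min c₁ 1 * ‖x‖ ^ 2 ≤ (inner ℂ x (hA.viscousOp x)).re := by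
  have hsum : HasSum (fun ξ => (inner ℂ (x ξ) (energySymbol A ξ (x ξ))).re)
      (inner ℂ x (hA.viscousOp x)).re :=
    Complex.hasSum_re (lp.hasSum_inner (𝕜 := ℂ) x (hA.viscousOp x))
  rw [norm_sq_eq_tsum, ← hsum.tsum_eq, ← tsum_mul_left]
  exact ((summable_norm_sq x).mul_left _).tsum_le_tsum
    (fun ξ => hA.energySymbol_coercive ξ (x ξ)) hsum.summable

end IsEllipticSymbol

/-- The operator `P (A + U · ∇) P + (1 - P)` of the energy form, on `H¹` identified with `ℓ²`. Its
inverse solves the divergence-free system. -/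
def energyOp (U : Fin n → PSmooth n) (hA : IsEllipticSymbol A c₁ a₂) :
    ℓ²(Fin n → ℤ, Vec n) →L[ℂ] ℓ²(Fin n → ℤ, Vec n) :=
  hA.viscousOp + lerayOp n ∘L embOp n ∘L advOp U 1 ∘L lerayOp n

variable {U : Fin n → PSmooth n}

theorem energyOp_apply (hA : IsEllipticSymbol A c₁ a₂) (x : ℓ²(Fin n → ℤ, Vec n))
    (ξ : Fin n → ℤ) :
    energyOp U hA x ξ = energySymbol A ξ (x ξ)
      + leray ξ (((rho ξ ^ (-1 : ℝ) : ℝ) : ℂ) • advOp U 1 (lerayOp n x) ξ) := rfl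

variable (hU : RealDivFree U) (hA : IsEllipticSymbol A c₁ a₂)
include hU

theorem energyOp_coercive (x : ℓ²(Fin n → ℤ, Vec n)) :
    min c₁ 1 * ‖x‖ ^ 2 ≤ (inner ℂ x (energyOp U hA x)).re := by
  have hadvection : (inner ℂ x (lerayOp n (embOp n (advOp U 1 (lerayOp n x))))).re = 0 := by
    rw [inner_lerayOp, inner_embOp, ← inner_conj_symm, Complex.conj_re, re_inner_advOp_embOp hU]
  have hsplit : energyOp U hA x
      = hA.viscousOp x + lerayOp n (embOp n (advOp U 1 (lerayOp n x))) := rfl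
  rw [hsplit, inner_add_right, Complex.add_re, hadvection, add_zero]
  exact hA.viscousOp_coercive x

theorem le_norm_energyOp (x : ℓ²(Fin n → ℤ, Vec n)) : min c₁ 1 * ‖x‖ ≤ ‖energyOp U hA x‖ := by
  have hcoercive := (energyOp_coercive hU hA x).trans
    ((Complex.re_le_norm _).trans (norm_inner_le_norm _ _))
  rcases (norm_nonneg x).eq_or_lt with hzero | hpos
  · rw [← hzero, mul_zero]
    exact norm_nonneg _
  · refine le_of_mul_le_mul_left ?_ hpos
    linarith

theorem energyOp_surjective : Function.Surjective (energyOp U hA) := by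
  have hpos : 0 < min c₁ 1 := lt_min hA.pos one_pos
  refine (ContinuousLinearMap.isUnit_iff_bijective.1
    (ContinuousLinearMap.isUnit_of_forall_le_norm_inner_map (energyOp U hA)
      (c := ⟨min c₁ 1, hpos.le⟩) hpos fun x => ?_)).2
  rw [← norm_inner_symm, mul_comm]
  exact (energyOp_coercive hU hA x).trans (Complex.re_le_norm _)

end Energy

/-! ### The Oseen system for Fourier coefficients -/

section System

/-- The operator `A + U · ∇` on families of Fourier coefficients. -/
def oseenSeq (A : (Fin n → ℤ) → Vec n →L[ℂ] Vec n) (U : Fin n → PSmooth n)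
    (u : (Fin n → ℤ) → Vec n) (ξ : Fin n → ℤ) : Vec n := A ξ (u ξ) + advSeq U u ξ

/-- The Oseen system for the families of Fourier coefficients of the velocity `u`, the pressure `p`
and the data `f`, `g`. -/
def Solves (A : (Fin n → ℤ) → Vec n →L[ℂ] Vec n) (U : Fin n → PSmooth n)
    (u : (Fin n → ℤ) → Vec n) (p : (Fin n → ℤ) → ℂ) (f : (Fin n → ℤ) → Vec n)
    (g : (Fin n → ℤ) → ℂ) : Prop :=
  ∀ ξ, oseenSeq A U u ξ + (2 * Real.pi * Complex.I * p ξ) • cvec ξ = f ξ ∧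
    2 * Real.pi * Complex.I * inner ℂ (cvec ξ) (u ξ) = g ξ

variable {A : (Fin n → ℤ) → Vec n →L[ℂ] Vec n} {c₁ a₂ s : ℝ} {U : Fin n → PSmooth n}
  {u v f : (Fin n → ℤ) → Vec n} {p g : (Fin n → ℤ) → ℂ}

theorem oseenSeq_add (hu : HMem s u) (hv : HMem s v) (ξ : Fin n → ℤ) :
    oseenSeq A U (fun ξ => u ξ + v ξ) ξ = oseenSeq A U u ξ + oseenSeq A U v ξ := by
  have hadvection : advSeq U (fun ξ => u ξ + v ξ) ξ = advSeq U u ξ + advSeq U v ξ := by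
    rw [← ((hu.hasSum_advSeq ξ).add (hv.hasSum_advSeq ξ)).tsum_eq]
    exact tsum_congr fun ζ => smul_add _ _ _
  rw [oseenSeq, hadvection, map_add, oseenSeq, oseenSeq]
  abel

theorem oseenSeq_zero (hU : RealDivFree U) (hu : u 0 = 0) : oseenSeq A U u 0 = 0 := by
  have hadvection : advSeq U u 0 = 0 := by
    refine (tsum_congr fun ζ => ?_).trans tsum_zero
    rw [advSymbol_sub_self hU, advSymbol]
    simp only [Pi.zero_apply, Int.cast_zero, mul_zero, Finset.sum_const_zero, zero_smul]
  rw [oseenSeq, hadvection, hu, map_zero, add_zero]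

theorem rho_rpow_sub_one_mul (ξ : Fin n → ℤ) (s : ℝ) :
    rho ξ ^ (s - 1) * rho ξ = rho ξ ^ s := by
  rw [← Real.rpow_add_one (rho_pos ξ).ne', sub_add_cancel]

theorem rho_rpow_sub_two_mul (ξ : Fin n → ℤ) (s : ℝ) :
    rho ξ ^ (s - 2) * rho ξ = rho ξ ^ (s - 1) := by
  rw [← rho_rpow_sub_one_mul ξ (s - 1), sub_sub, one_add_one_eq_two]

theorem rho_rpow_sub_two_mul_sq (ξ : Fin n → ℤ) (s : ℝ) :
    rho ξ ^ (s - 2) * rho ξ ^ 2 = rho ξ ^ s := by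
  rw [sq, ← mul_assoc, rho_rpow_sub_two_mul, rho_rpow_sub_one_mul]

namespace IsEllipticSymbol

variable (hA : IsEllipticSymbol A c₁ a₂)
include hA

theorem hMem_symbol (hu : HMem s u) :
    HMem (s - 2) (fun ξ => A ξ (u ξ)) ∧ hNorm (s - 2) (fun ξ => A ξ (u ξ)) ≤ a₂ * hNorm s u :=
  hu.of_le hA.nonneg fun ξ => by
    calc rho ξ ^ (s - 2) * ‖A ξ (u ξ)‖ ≤ rho ξ ^ (s - 2) * (a₂ * rho ξ ^ 2 * ‖u ξ‖) :=
          mul_le_mul_of_nonneg_left (hA.norm_le ξ (u ξ)) (rho_rpow_pos ξ _).le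
      _ = a₂ * (rho ξ ^ s * ‖u ξ‖) := by
          rw [← rho_rpow_sub_two_mul_sq ξ s]
          ring

theorem hMem_oseenSeq (hu : HMem s u) : HMem (s - 2) (oseenSeq A U u) :=
  (hA.hMem_symbol hu).1.add (hu.advSeq.mono (by linarith))

theorem hNorm_oseenSeq_le (hu : HMem s u) :
    hNorm (s - 2) (oseenSeq A U u) ≤ (a₂ + ‖advOp U s‖) * hNorm s u := by
  have hle : s - 2 ≤ s - 1 := by linarith
  calc hNorm (s - 2) (oseenSeq A U u)
      ≤ hNorm (s - 2) (fun ξ => A ξ (u ξ)) + hNorm (s - 2) (advSeq U u) :=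
        (hA.hMem_symbol hu).1.hNorm_add_le (hu.advSeq.mono hle)
    _ ≤ a₂ * hNorm s u + ‖advOp U s‖ * hNorm s u :=
        add_le_add (hA.hMem_symbol hu).2 ((hu.advSeq.hNorm_mono hle).trans hu.hNorm_advSeq_le)
    _ = (a₂ + ‖advOp U s‖) * hNorm s u := (add_mul _ _ _).symm

end IsEllipticSymbol

end System

section StokesEstimate

theorem HMem.of_le_mul_add {E F G : Type*} [NormedAddCommGroup E] [NormedAddCommGroup F]
    [NormedAddCommGroup G] {s t C : ℝ} {e : (Fin n → ℤ) → E} {f : (Fin n → ℤ) → F}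
    {g : (Fin n → ℤ) → G} (hf : HMem (s - 2) f) (hg : HMem (s - 1) g) (hC : 0 ≤ C)
    (hle : ∀ ξ, rho ξ ^ t * ‖e ξ‖ ≤ rho ξ ^ (s - 2) * (C * (‖f ξ‖ + rho ξ * ‖g ξ‖))) :
    HMem t e ∧ hNorm t e ≤ C * (hNorm (s - 2) f + hNorm (s - 1) g) := by
  rw [mul_add]
  refine hf.of_le_add hg hC hC fun ξ => (hle ξ).trans_eq ?_
  rw [← rho_rpow_sub_two_mul ξ s]
  ring

variable {A : (Fin n → ℤ) → Vec n →L[ℂ] Vec n} {c₁ a₂ s : ℝ} {u f : (Fin n → ℤ) → Vec n}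
  {p g : (Fin n → ℤ) → ℂ}

theorem IsEllipticSymbol.hMem_and_hNorm_le_of_stokes (hA : IsEllipticSymbol A c₁ a₂)
    (hmomentum : ∀ ξ, A ξ (u ξ) + (2 * Real.pi * Complex.I * p ξ) • cvec ξ = f ξ)
    (hdiv : ∀ ξ, 2 * Real.pi * Complex.I * inner ℂ (cvec ξ) (u ξ) = g ξ)
    (hu : u 0 = 0) (hp : p 0 = 0) (hf : HMem (s - 2) f) (hg : HMem (s - 1) g) :
    (HMem s u ∧ hNorm s u ≤ stokesConst c₁ a₂ * (hNorm (s - 2) f + hNorm (s - 1) g)) ∧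
      HMem (s - 1) p ∧
        hNorm (s - 1) p ≤ stokesConst c₁ a₂ * (hNorm (s - 2) f + hNorm (s - 1) g) := by
  have hconst := hA.stokesConst_pos
  have hright_nonneg (ξ : Fin n → ℤ) :
      0 ≤ rho ξ ^ (s - 2) * (stokesConst c₁ a₂ * (‖f ξ‖ + rho ξ * ‖g ξ‖)) := by
    have := rho_pos ξ
    positivity
  constructor <;> refine hf.of_le_mul_add hg hconst.le fun ξ => ?_ <;>
    rcases eq_or_ne ξ 0 with rfl | hξ
  · simpa only [hu, norm_zero, mul_zero] using hright_nonneg 0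
  · rw [← rho_rpow_sub_two_mul_sq, mul_assoc]
    exact mul_le_mul_of_nonneg_left (hA.stokes_le hξ (hmomentum ξ) (hdiv ξ)).1
      (rho_rpow_pos ξ _).le
  · simpa only [hp, norm_zero, mul_zero] using hright_nonneg 0
  · rw [← rho_rpow_sub_two_mul, mul_assoc]
    exact mul_le_mul_of_nonneg_left (hA.stokes_le hξ (hmomentum ξ) (hdiv ξ)).2
      (rho_rpow_pos ξ _).le

variable {U : Fin n → PSmooth n}

/-- With the advection term moved to the right-hand side the velocity solves a Stokes system, so it
gains up to one derivative. -/
theorem Solves.hMem_and_hNorm_le (h : Solves A U u p f g) (hA : IsEllipticSymbol A c₁ a₂)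
    (hu₀ : u 0 = 0) (hp₀ : p 0 = 0) {t : ℝ} (hst : s - 1 ≤ t) (hf : HMem (s - 2) f)
    (hg : HMem (s - 1) g) (hu : HMem t u) :
    HMem s u ∧ HMem (s - 1) p ∧ hNorm s u + hNorm (s - 1) p
      ≤ 2 * stokesConst c₁ a₂
        * (hNorm (s - 2) f + ‖advOp U t‖ * hNorm t u + hNorm (s - 1) g) := by
  have hle : s - 2 ≤ t - 1 := by linarith
  have hadvection : HMem (s - 2) (advSeq U u) := hu.advSeq.mono hle
  have hright : hNorm (s - 2) (fun ξ => f ξ - advSeq U u ξ)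
      ≤ hNorm (s - 2) f + ‖advOp U t‖ * hNorm t u :=
    (hf.hNorm_sub_le hadvection).trans
      (add_le_add_right ((hu.advSeq.hNorm_mono hle).trans hu.hNorm_advSeq_le) _)
  obtain ⟨⟨hu_mem, hu_le⟩, hp_mem, hp_le⟩ := hA.hMem_and_hNorm_le_of_stokes
    (fun ξ => eq_sub_of_add_eq ((add_right_comm _ _ _).trans (h ξ).1)) (fun ξ => (h ξ).2) hu₀ hp₀
    (hf.sub hadvection) hg
  refine ⟨hu_mem, hp_mem, (add_le_add hu_le hp_le).trans ?_⟩
  rw [← two_mul, ← mul_assoc]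
  exact mul_le_mul_of_nonneg_left (add_le_add_left hright _)
    (mul_nonneg zero_le_two hA.stokesConst_pos.le)

end StokesEstimate

section ProjectedEquation

theorem exists_toLp_eq {E : Type*} [NormedAddCommGroup E] [NormedSpace ℂ E] (s : ℝ)
    (x : ℓ²(Fin n → ℤ, E)) : ∃ (c : (Fin n → ℤ) → E) (hc : HMem s c), hc.toLp = x := by
  have hx (ξ : Fin n → ℤ) : ((rho ξ ^ s : ℝ) : ℂ) • ((rho ξ ^ (-s) : ℝ) : ℂ) • x ξ = x ξ := by
    rw [smul_smul, ← Complex.ofReal_mul, ← Real.rpow_add (rho_pos ξ), add_neg_cancel,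
      Real.rpow_zero, Complex.ofReal_one, one_smul]
  exact ⟨fun ξ => ((rho ξ ^ (-s) : ℝ) : ℂ) • x ξ,
    HMem.of_norm_eq x fun ξ => by rw [← norm_rho_rpow_smul, hx], lp.ext (funext hx)⟩

variable {A : (Fin n → ℤ) → Vec n →L[ℂ] Vec n} {c₁ a₂ : ℝ} {U : Fin n → PSmooth n}
  (hA : IsEllipticSymbol A c₁ a₂)

theorem lerayOp_eq_self_of_energyOp_eq {x y : ℓ²(Fin n → ℤ, Vec n)}
    (hxy : energyOp U hA x = lerayOp n y) : lerayOp n x = x := by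
  refine lp.ext (funext fun ξ => ?_)
  have hξ : energyOp U hA x ξ = lerayOp n y ξ := by rw [hxy]
  rw [energyOp_apply, energySymbol_apply, lerayOp_apply] at hξ
  rw [lerayOp_apply]
  have hproj := congrArg (leray ξ) hξ
  simp only [map_add, map_sub, map_smul, leray_leray, sub_self, add_zero] at hξ hproj
  rw [add_right_comm, hproj, add_eq_left, sub_eq_zero] at hξ
  exact hξ.symm

variable {w r : (Fin n → ℤ) → Vec n}

theorem HMem.lerayOp_toLp (hw : HMem 1 w) (hproj : ∀ ξ, leray ξ (w ξ) = w ξ) :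
    lerayOp n hw.toLp = hw.toLp := lp.ext <| funext fun ξ => by
  rw [lerayOp_apply, hw.toLp_apply, map_smul, hproj]

theorem energyOp_toLp_apply (hw : HMem 1 w) (hproj : ∀ ξ, leray ξ (w ξ) = w ξ)
    (ξ : Fin n → ℤ) :
    energyOp U hA hw.toLp ξ = ((rho ξ ^ (-1 : ℝ) : ℝ) : ℂ) • leray ξ (oseenSeq A U w ξ) := by
  have hweight : (rho ξ ^ 2)⁻¹ * rho ξ = rho ξ ^ (-1 : ℝ) := by
    have := rho_pos ξ
    rw [Real.rpow_neg_one]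
    field_simp
  rw [energyOp_apply, hw.lerayOp_toLp hproj, hw.advOp_toLp_apply, energySymbol_apply,
    hw.toLp_apply, sub_self, Real.rpow_zero, Complex.ofReal_one, one_smul, Real.rpow_one, oseenSeq]
  simp only [map_smul, hproj, sub_self, add_zero, smul_smul, ← Complex.ofReal_mul, hweight,
    map_add, smul_add]

theorem energyOp_toLp_eq_iff (hw : HMem 1 w) (hproj : ∀ ξ, leray ξ (w ξ) = w ξ)
    (hr : HMem (-1) r) :
    energyOp U hA hw.toLp = lerayOp n hr.toLp ↔
      ∀ ξ, leray ξ (oseenSeq A U w ξ) = leray ξ (r ξ) := by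
  have hne (ξ : Fin n → ℤ) : ((rho ξ ^ (-1 : ℝ) : ℝ) : ℂ) ≠ 0 :=
    Complex.ofReal_ne_zero.2 (rho_rpow_pos ξ _).ne'
  rw [lp.ext_iff, funext_iff]
  refine forall_congr' fun ξ => ?_
  rw [energyOp_toLp_apply hA hw hproj, lerayOp_apply, hr.toLp_apply, map_smul,
    (smul_right_injective _ (hne ξ)).eq_iff]

variable (hU : RealDivFree U)
include hA hU

theorem hNorm_le_of_leray_oseenSeq_eq (hw : HMem 1 w) (hproj : ∀ ξ, leray ξ (w ξ) = w ξ)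
    (hr : HMem (-1) r) (heq : ∀ ξ, leray ξ (oseenSeq A U w ξ) = leray ξ (r ξ)) :
    hNorm 1 w ≤ (min c₁ 1)⁻¹ * hNorm (-1) r := by
  rw [inv_mul_eq_div, le_div_iff₀ (lt_min hA.pos one_pos), mul_comm, ← hw.norm_toLp,
    ← hr.norm_toLp]
  refine (le_norm_energyOp hU hA _).trans ?_
  rw [(energyOp_toLp_eq_iff hA hw hproj hr).2 heq]
  exact norm_lerayOp_apply_le _

theorem exists_leray_oseenSeq_eq (hr : HMem (-1) r) :
    ∃ w, HMem 1 w ∧ (∀ ξ, leray ξ (w ξ) = w ξ) ∧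
      ∀ ξ, leray ξ (oseenSeq A U w ξ) = leray ξ (r ξ) := by
  obtain ⟨x, hx⟩ := energyOp_surjective hU hA (lerayOp n hr.toLp)
  obtain ⟨w, hw, rfl⟩ := exists_toLp_eq 1 x
  have hproj (ξ : Fin n → ℤ) : leray ξ (w ξ) = w ξ := by
    have hξ : lerayOp n hw.toLp ξ = hw.toLp ξ := by rw [lerayOp_eq_self_of_energyOp_eq hA hx]
    rw [lerayOp_apply, hw.toLp_apply, map_smul] at hξ
    exact smul_right_injective _ (Complex.ofReal_ne_zero.2 (rho_rpow_pos ξ 1).ne') hξ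
  exact ⟨w, hw, hproj, (energyOp_toLp_eq_iff hA hw hproj hr).1 hx⟩

end ProjectedEquation

/-! ### Solvability and estimates for Fourier coefficients -/

section GradientPart

variable {s : ℝ} {u : (Fin n → ℤ) → Vec n} {g : (Fin n → ℤ) → ℂ}

theorem hMem_leray (hu : HMem s u) : HMem s fun ξ => leray ξ (u ξ) :=
  (hu.of_le zero_le_one fun ξ => by
    rw [one_mul]
    exact mul_le_mul_of_nonneg_left (norm_leray_apply_le _ _) (rho_rpow_pos ξ s).le).1

theorem hMem_sub_leray (hu₀ : u 0 = 0) (hg : HMem (s - 1) g)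
    (hdiv : ∀ ξ, 2 * Real.pi * Complex.I * inner ℂ (cvec ξ) (u ξ) = g ξ) :
    HMem s (fun ξ => u ξ - leray ξ (u ξ)) ∧
      hNorm s (fun ξ => u ξ - leray ξ (u ξ)) ≤ hNorm (s - 1) g := by
  rw [← one_mul (hNorm (s - 1) g)]
  refine hg.of_le zero_le_one fun ξ => ?_
  rw [one_mul]
  rcases eq_or_ne ξ 0 with rfl | hξ
  · rw [hu₀, map_zero, sub_zero, norm_zero, mul_zero]
    exact mul_nonneg (rho_rpow_pos _ _).le (norm_nonneg _)
  · rw [← rho_rpow_sub_one_mul, mul_assoc, ← hdiv ξ]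
    exact mul_le_mul_of_nonneg_left (rho_mul_norm_sub_leray_le hξ (u ξ)) (rho_rpow_pos ξ _).le

/-- The value at the frequency `ξ` of the potential whose gradient is the gradient part of a field
with the value `F` there. -/
def gradientPotential (ξ : Fin n → ℤ) (F : Vec n) : ℂ :=
  inner ℂ (cvec ξ) F / (2 * Real.pi * Complex.I) / (‖cvec ξ‖ : ℂ) ^ 2

/-- The value at the frequency `ξ` of the gradient field whose divergence has the value `z`
there. -/
def gradientOfDiv (ξ : Fin n → ℤ) (z : ℂ) : Vec n :=
  (z / (2 * Real.pi * Complex.I) / (‖cvec ξ‖ : ℂ) ^ 2) • cvec ξ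

theorem gradientPotential_zero (F : Vec n) : gradientPotential 0 F = 0 := by
  rw [gradientPotential, cvec_zero, inner_zero_left, zero_div, zero_div]

theorem gradientPotential_smul_cvec {ξ : Fin n → ℤ} (hξ : ξ ≠ 0) (F : Vec n) :
    (2 * Real.pi * Complex.I * gradientPotential ξ F) • cvec ξ = F - leray ξ F := by
  rw [sub_leray hξ, gradientPotential, mul_div_assoc', mul_div_cancel₀ _ Complex.two_pi_I_ne_zero]

theorem gradientOfDiv_zero (z : ℂ) : gradientOfDiv (0 : Fin n → ℤ) z = 0 := by
  rw [gradientOfDiv, cvec_zero, smul_zero]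

theorem leray_gradientOfDiv (ξ : Fin n → ℤ) (z : ℂ) : leray ξ (gradientOfDiv ξ z) = 0 := by
  rw [gradientOfDiv, map_smul, leray_cvec, smul_zero]

theorem inner_cvec_gradientOfDiv {ξ : Fin n → ℤ} (hξ : ξ ≠ 0) (z : ℂ) :
    2 * Real.pi * Complex.I * inner ℂ (cvec ξ) (gradientOfDiv ξ z) = z := by
  have hne : (‖cvec ξ‖ : ℂ) ^ 2 ≠ 0 :=
    pow_ne_zero 2 (Complex.ofReal_ne_zero.2 (norm_cvec_pos hξ).ne')
  rw [gradientOfDiv, inner_smul_right, inner_self_eq_norm_sq_to_K]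
  simp only [Complex.coe_algebraMap]
  rw [div_mul_cancel₀ _ hne, mul_div_cancel₀ _ Complex.two_pi_I_ne_zero]

end GradientPart

section EnergySpace

variable {A : (Fin n → ℤ) → Vec n →L[ℂ] Vec n} {c₁ a₂ : ℝ} {U : Fin n → PSmooth n}
  (hA : IsEllipticSymbol A c₁ a₂) {u v f : (Fin n → ℤ) → Vec n} {p g : (Fin n → ℤ) → ℂ}

include hA in
theorem IsEllipticSymbol.hMem_sub_oseenSeq (hf : HMem (-1) f) (hv : HMem 1 v) :
    HMem (-1) (fun ξ => f ξ - oseenSeq A U v ξ) ∧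
      hNorm (-1) (fun ξ => f ξ - oseenSeq A U v ξ)
        ≤ hNorm (-1) f + (a₂ + ‖advOp U 1‖) * hNorm 1 v := by
  have hmem : HMem (1 - 2) (oseenSeq A U v) := hA.hMem_oseenSeq hv
  have hle : hNorm (1 - 2) (oseenSeq A U v) ≤ (a₂ + ‖advOp U 1‖) * hNorm 1 v :=
    hA.hNorm_oseenSeq_le hv
  rw [show (1 - 2 : ℝ) = -1 by norm_num] at hmem hle
  exact ⟨hf.sub hmem, (hf.hNorm_sub_le hmem).trans (add_le_add_right hle _)⟩

theorem Solves.leray_oseenSeq (h : Solves A U u p f g) (ξ : Fin n → ℤ) :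
    leray ξ (oseenSeq A U u ξ) = leray ξ (f ξ) := by
  rw [← (h ξ).1, map_add, map_smul, leray_cvec, smul_zero, add_zero]

/-- The constant of the a priori estimate in `H¹`. -/
def energyConst (U : Fin n → PSmooth n) (c₁ a₂ : ℝ) : ℝ :=
  (min c₁ 1)⁻¹ * (1 + (a₂ + ‖advOp U 1‖)) + 1

theorem energyConst_pos (hc₁ : 0 < c₁) (ha₂ : 0 ≤ a₂) : 0 < energyConst U c₁ a₂ := by
  have : 0 < min c₁ 1 := lt_min hc₁ one_pos
  unfold energyConst
  positivity

variable (hU : RealDivFree U)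
include hU hA

theorem Solves.hNorm_velocity_le (h : Solves A U u p f g) (hu₀ : u 0 = 0) (hu : HMem 1 u)
    (hf : HMem (-1) f) (hg : HMem 0 g) :
    hNorm 1 u ≤ energyConst U c₁ a₂ * (hNorm (-1) f + hNorm 0 g) := by
  set w : (Fin n → ℤ) → Vec n := fun ξ => leray ξ (u ξ)
  set v : (Fin n → ℤ) → Vec n := fun ξ => u ξ - w ξ
  have hw : HMem 1 w := hMem_leray hu
  obtain ⟨hv, hv_le⟩ : HMem 1 v ∧ hNorm 1 v ≤ hNorm 0 g := by
    have hgradient := hMem_sub_leray (s := 1) (g := g) hu₀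
    rw [sub_self] at hgradient
    exact hgradient hg fun ξ => (h ξ).2
  obtain ⟨hr, hr_le⟩ := hA.hMem_sub_oseenSeq (U := U) hf hv
  have hu_eq : u = fun ξ => w ξ + v ξ := funext fun ξ => (add_sub_cancel (w ξ) (u ξ)).symm
  have hprojected (ξ : Fin n → ℤ) :
      leray ξ (oseenSeq A U w ξ) = leray ξ (f ξ - oseenSeq A U v ξ) := by
    rw [map_sub, ← h.leray_oseenSeq ξ, hu_eq, oseenSeq_add hw hv, map_add, add_sub_cancel_right]
  have hw_le := hNorm_le_of_leray_oseenSeq_eq hA hU hw (fun ξ => leray_leray ξ _) hr hprojected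
  set X := hNorm (-1) f + hNorm 0 g
  have hfX : hNorm (-1) f ≤ X := le_add_of_nonneg_right (hNorm_nonneg _ _)
  have hvX : hNorm 1 v ≤ X := hv_le.trans (le_add_of_nonneg_left (hNorm_nonneg _ _))
  have := hA.nonneg
  have : 0 < min c₁ 1 := lt_min hA.pos one_pos
  calc hNorm 1 u ≤ hNorm 1 w + hNorm 1 v := by
        rw [hu_eq]
        exact hw.hNorm_add_le hv
    _ ≤ (min c₁ 1)⁻¹ * (X + (a₂ + ‖advOp U 1‖) * X) + X := by
        refine add_le_add (hw_le.trans ?_) hvX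
        gcongr
        exact hr_le.trans (by gcongr)
    _ = energyConst U c₁ a₂ * X := by
        unfold energyConst
        ring

theorem exists_solves_one (hf : HMem (-1) f) (hg : HMem 0 g) (hf₀ : f 0 = 0) (hg₀ : g 0 = 0) :
    ∃ (u : (Fin n → ℤ) → Vec n) (p : (Fin n → ℤ) → ℂ),
      HMem 1 u ∧ u 0 = 0 ∧ p 0 = 0 ∧ Solves A U u p f g := by
  set v : (Fin n → ℤ) → Vec n := fun ξ => gradientOfDiv ξ (g ξ)
  have hv_div (ξ : Fin n → ℤ) : 2 * Real.pi * Complex.I * inner ℂ (cvec ξ) (v ξ) = g ξ := by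
    rcases eq_or_ne ξ 0 with rfl | hξ
    · rw [cvec_zero, inner_zero_left, mul_zero, hg₀]
    · exact inner_cvec_gradientOfDiv hξ _
  have hv : HMem 1 v := by
    have hgradient := (hMem_sub_leray (s := 1) (gradientOfDiv_zero _) (by rwa [sub_self]) hv_div).1
    simpa only [v, leray_gradientOfDiv, sub_zero] using hgradient
  have hr := (hA.hMem_sub_oseenSeq (U := U) hf hv).1
  obtain ⟨w, hw, hw_proj, hw_eq⟩ := exists_leray_oseenSeq_eq hA hU hr
  set u : (Fin n → ℤ) → Vec n := fun ξ => w ξ + v ξ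
  have hu₀ : u 0 = 0 := by
    change w 0 + gradientOfDiv 0 (g 0) = 0
    rw [← hw_proj, leray_zero, zero_apply, gradientOfDiv_zero, add_zero]
  have hresidual (ξ : Fin n → ℤ) : leray ξ (f ξ - oseenSeq A U u ξ) = 0 := by
    rw [oseenSeq_add hw hv, add_comm, ← sub_sub, map_sub, ← hw_eq, sub_self]
  refine ⟨u, fun ξ => gradientPotential ξ (f ξ - oseenSeq A U u ξ), hw.add hv, hu₀,
    gradientPotential_zero _, fun ξ => ⟨?_, ?_⟩⟩
  · rcases eq_or_ne ξ 0 with rfl | hξ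
    · rw [oseenSeq_zero hU hu₀, cvec_zero, smul_zero, add_zero, hf₀]
    · rw [gradientPotential_smul_cvec hξ, hresidual, sub_zero, add_sub_cancel]
  · rw [inner_add_right, ← hw_proj, inner_cvec_leray, zero_add, hv_div]

end EnergySpace

section AllOrders

variable {A : (Fin n → ℤ) → Vec n →L[ℂ] Vec n} {c₁ a₂ s : ℝ} {U : Fin n → PSmooth n}

theorem Solves.regularity_step (hA : IsEllipticSymbol A c₁ a₂) {u f : (Fin n → ℤ) → Vec n}
    {p g : (Fin n → ℤ) → ℂ} (h : Solves A U u p f g) (hu₀ : u 0 = 0) (hp₀ : p 0 = 0) {t C : ℝ}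
    (hst : s - 1 ≤ t) (hf : HMem (s - 2) f) (hg : HMem (s - 1) g) (hu : HMem t u)
    (hu_le : hNorm t u ≤ C * (hNorm (s - 2) f + hNorm (s - 1) g)) :
    HMem s u ∧ HMem (s - 1) p ∧ hNorm s u + hNorm (s - 1) p
      ≤ 2 * stokesConst c₁ a₂ * (1 + ‖advOp U t‖ * C) * (hNorm (s - 2) f + hNorm (s - 1) g) := by
  obtain ⟨hu_mem, hp_mem, hle⟩ := h.hMem_and_hNorm_le hA hu₀ hp₀ hst hf hg hu
  refine ⟨hu_mem, hp_mem, hle.trans ?_⟩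
  have hconst := hA.stokesConst_pos
  rw [mul_assoc (2 * stokesConst c₁ a₂)]
  gcongr
  linarith [mul_le_mul_of_nonneg_left hu_le (norm_nonneg (advOp U t))]

theorem exists_regularity_bound (hU : RealDivFree U) (hc₁ : 0 < c₁) (ha₂ : 0 ≤ a₂) (m : ℕ) :
    ∀ s : ℝ, 1 ≤ s → s ≤ 2 + m → ∃ C, 0 < C ∧
      ∀ A : (Fin n → ℤ) → Vec n →L[ℂ] Vec n, IsEllipticSymbol A c₁ a₂ →
        ∀ (u : (Fin n → ℤ) → Vec n) (p : (Fin n → ℤ) → ℂ) (f : (Fin n → ℤ) → Vec n)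
          (g : (Fin n → ℤ) → ℂ),
        Solves A U u p f g → u 0 = 0 → p 0 = 0 → HMem 1 u → HMem (s - 2) f → HMem (s - 1) g →
        HMem s u ∧ HMem (s - 1) p ∧
          hNorm s u + hNorm (s - 1) p ≤ C * (hNorm (s - 2) f + hNorm (s - 1) g) := by
  have hσ : 0 < stokesConst c₁ a₂ := by
    unfold stokesConst stokesVelocityConst
    positivity
  induction m with
  | zero =>
    intro s hs hs_le
    have hE := energyConst_pos (U := U) hc₁ ha₂
    refine ⟨2 * stokesConst c₁ a₂ * (1 + ‖advOp U 1‖ * energyConst U c₁ a₂), by positivity,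
      fun A hA u p f g h hu₀ hp₀ hu hf hg => ?_⟩
    have hf_le : -1 ≤ s - 2 := by linarith
    have hg_le : 0 ≤ s - 1 := by linarith
    refine h.regularity_step hA hu₀ hp₀ ?_ hf hg hu
      ((h.hNorm_velocity_le hA hU hu₀ hu (hf.mono hf_le) (hg.mono hg_le)).trans ?_)
    · push_cast at hs_le
      linarith
    · exact mul_le_mul_of_nonneg_left (add_le_add (hf.hNorm_mono hf_le) (hg.hNorm_mono hg_le)) hE.le
  | succ m ih =>
    intro s hs hs_le
    push_cast at hs_le
    set t := max (s - 1) 1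
    have hts : t ≤ s := max_le (by linarith) hs
    obtain ⟨C, hC, hbound⟩ := ih t (le_max_right _ _)
      (max_le (by linarith) (by linarith [m.cast_nonneg (α := ℝ)]))
    refine ⟨2 * stokesConst c₁ a₂ * (1 + ‖advOp U t‖ * C), by positivity,
      fun A hA u p f g h hu₀ hp₀ hu hf hg => ?_⟩
    have hf_le : t - 2 ≤ s - 2 := by linarith
    have hg_le : t - 1 ≤ s - 1 := by linarith
    obtain ⟨hu_mem, -, hle⟩ := hbound A hA u p f g h hu₀ hp₀ hu (hf.mono hf_le) (hg.mono hg_le)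
    refine h.regularity_step hA hu₀ hp₀ (le_max_left _ _) hf hg hu_mem
      ((le_add_of_nonneg_right (hNorm_nonneg _ _)).trans (hle.trans ?_))
    exact mul_le_mul_of_nonneg_left (add_le_add (hf.hNorm_mono hf_le) (hg.hNorm_mono hg_le)) hC.le

theorem exists_solves (hU : RealDivFree U) (hA : IsEllipticSymbol A c₁ a₂) (hs : 1 ≤ s)
    {f : (Fin n → ℤ) → Vec n} {g : (Fin n → ℤ) → ℂ} (hf : HMem (s - 2) f) (hg : HMem (s - 1) g)
    (hf₀ : f 0 = 0) (hg₀ : g 0 = 0) :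
    ∃ (u : (Fin n → ℤ) → Vec n) (p : (Fin n → ℤ) → ℂ),
      HMem s u ∧ HMem (s - 1) p ∧ u 0 = 0 ∧ p 0 = 0 ∧ Solves A U u p f g := by
  obtain ⟨u, p, hu, hu₀, hp₀, h⟩ := exists_solves_one hA hU
    (hf.mono (by linarith)) (hg.mono (by linarith)) hf₀ hg₀
  obtain ⟨C, -, hbound⟩ := exists_regularity_bound hU hA.pos hA.nonneg ⌈s⌉₊ s hs
    ((Nat.le_ceil s).trans (le_add_of_nonneg_left zero_le_two))
  obtain ⟨hu_mem, hp_mem, -⟩ := hbound A hA u p f g h hu₀ hp₀ hu hf hg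
  exact ⟨u, p, hu_mem, hp_mem, hu₀, hp₀, h⟩

theorem exists_hNorm_le (hU : RealDivFree U) (hc₁ : 0 < c₁) (ha₂ : 0 ≤ a₂) (hs : 1 ≤ s) :
    ∃ C, 0 < C ∧ ∀ A : (Fin n → ℤ) → Vec n →L[ℂ] Vec n, IsEllipticSymbol A c₁ a₂ →
      ∀ (u : (Fin n → ℤ) → Vec n) (p : (Fin n → ℤ) → ℂ) (f : (Fin n → ℤ) → Vec n)
        (g : (Fin n → ℤ) → ℂ),
      Solves A U u p f g → u 0 = 0 → p 0 = 0 → HMem s u → HMem (s - 2) f → HMem (s - 1) g →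
      hNorm s u + hNorm (s - 1) p ≤ C * (hNorm (s - 2) f + hNorm (s - 1) g) := by
  obtain ⟨C, hC, hbound⟩ := exists_regularity_bound hU hc₁ ha₂ ⌈s⌉₊ s hs
    ((Nat.le_ceil s).trans (le_add_of_nonneg_left zero_le_two))
  exact ⟨C, hC, fun A hA u p f g h hu₀ hp₀ hu hf hg =>
    (hbound A hA u p f g h hu₀ hp₀ (hu.mono hs) hf hg).2.2⟩

end AllOrders

/-! ### The Oseen system for distributions -/

section VectorCoefficients

/-- The family of Fourier coefficients of a vector distribution. -/
def vecCoeff (u : Fin n → PDist n) (ξ : Fin n → ℤ) : Vec n :=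
  WithLp.toLp 2 fun k => fourierCoeff (u k) ξ

theorem vecCoeff_apply (u : Fin n → PDist n) (ξ : Fin n → ℤ) (k : Fin n) :
    vecCoeff u ξ k = fourierCoeff (u k) ξ := rfl

theorem vecCoeff_injective : Function.Injective (vecCoeff (n := n)) := fun _ _ h =>
  funext fun k => fourierCoeff_injective <| funext fun ξ =>
    congrArg (fun w : Vec n => w k) (congrFun h ξ)

theorem vecCoeff_eq_zero_iff {u : Fin n → PDist n} {ξ : Fin n → ℤ} :
    vecCoeff u ξ = 0 ↔ ∀ k, fourierCoeff (u k) ξ = 0 := by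
  rw [PiLp.ext_iff]
  rfl

variable {s : ℝ} {u : Fin n → PDist n}

theorem rho_rpow_mul_norm_vecCoeff_sq (s : ℝ) (u : Fin n → PDist n) (ξ : Fin n → ℤ) :
    rho ξ ^ (2 * s) * ‖vecCoeff u ξ‖ ^ 2 = ∑ k, rho ξ ^ (2 * s) * ‖fourierCoeff (u k) ξ‖ ^ 2 := by
  rw [EuclideanSpace.norm_sq_eq, Finset.mul_sum]
  rfl

theorem hMem_vecCoeff_iff : HMem s (vecCoeff u) ↔ ∀ k, HMem s (fourierCoeff (u k)) := by
  refine ⟨fun h k => ?_, fun h =>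
    (summable_sum fun k _ => h k).congr fun ξ => (rho_rpow_mul_norm_vecCoeff_sq s u ξ).symm⟩
  refine (h.of_le zero_le_one fun ξ => ?_).1
  rw [one_mul]
  exact mul_le_mul_of_nonneg_left (PiLp.norm_apply_le (vecCoeff u ξ) k) (rho_rpow_pos ξ s).le

theorem mem_Hdot_iff {g : PDist n} :
    g ∈ Hdot n s ↔ HMem s (fourierCoeff g) ∧ fourierCoeff g 0 = 0 :=
  and_congr Iff.rfl (mem_zeroMean_iff g)

theorem mem_HdotVec_iff : u ∈ HdotVec n s ↔ HMem s (vecCoeff u) ∧ vecCoeff u 0 = 0 := by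
  rw [hMem_vecCoeff_iff, vecCoeff_eq_zero_iff, ← forall_and]
  simp only [HdotVec, Submodule.mem_pi, Set.mem_univ, true_implies, mem_Hdot_iff]

theorem normHVec_eq_hNorm (hu : HMem s (vecCoeff u)) : normHVec s u = hNorm s (vecCoeff u) := by
  simp only [normHVec, hNorm, normSqH, rho_rpow_mul_norm_vecCoeff_sq]
  rw [Summable.tsum_finsetSum fun k _ => hMem_vecCoeff_iff.1 hu k]

theorem HMem.polyBounded {E : Type*} [NormedAddCommGroup E] {c : (Fin n → ℤ) → E}
    {d : (Fin n → ℤ) → ℂ} (hc : HMem s c) (hd : ∀ ξ, ‖d ξ‖ ≤ ‖c ξ‖) : PolyBounded d := by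
  refine ⟨⌈-s⌉₊, hNorm s c, hNorm_nonneg _ _, fun ξ => (hd ξ).trans ?_⟩
  calc ‖c ξ‖ = rho ξ ^ s * ‖c ξ‖ * rho ξ ^ (-s) := by
        rw [mul_right_comm, ← Real.rpow_add (rho_pos ξ), add_neg_cancel, Real.rpow_zero, one_mul]
    _ ≤ hNorm s c * rho ξ ^ ⌈-s⌉₊ :=
        mul_le_mul (hc.norm_le ξ) (rpow_rho_le_pow ξ (Nat.le_ceil (-s))) (rho_rpow_pos ξ _).le
          (hNorm_nonneg _ _)

theorem exists_fourierCoeff_eq {c : (Fin n → ℤ) → ℂ} (hc : HMem s c) :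
    ∃ g : PDist n, fourierCoeff g = c :=
  ⟨ofCoeff c (hc.polyBounded fun _ => le_rfl), fourierCoeff_ofCoeff c _⟩

theorem exists_vecCoeff_eq {c : (Fin n → ℤ) → Vec n} (hc : HMem s c) :
    ∃ u : Fin n → PDist n, vecCoeff u = c := by
  have hbounded (k : Fin n) : PolyBounded fun ξ => c ξ k :=
    hc.polyBounded fun ξ => PiLp.norm_apply_le (c ξ) k
  refine ⟨fun k => ofCoeff _ (hbounded k), funext fun ξ => ?_⟩
  ext k
  exact congrFun (fourierCoeff_ofCoeff _ (hbounded k)) ξ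

end VectorCoefficients

section OseenCoefficients

variable (a : Fin n → Fin n → Fin n → Fin n → ℝ) {U : Fin n → PSmooth n}

theorem fourierCoeff_strain (u : Fin n → PDist n) (j β : Fin n) (ξ : Fin n → ℤ) :
    fourierCoeff (strain u j β) ξ =
      2 * Real.pi * Complex.I * strainSymbol (fun i => (ξ i : ℝ)) (vecCoeff u ξ) j β := by
  simp only [strain, fourierCoeff_smul, fourierCoeff_add, fourierCoeff_pderiv, strainSymbol_apply,
    vecCoeff_apply, Complex.real_smul]
  push_cast
  ring

theorem fourierCoeff_viscous (u : Fin n → PDist n) (k : Fin n) (ξ : Fin n → ℤ) :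
    fourierCoeff (viscous a u k) ξ = -viscSymbol a ξ (vecCoeff u ξ) k := by
  simp only [viscSymbol_apply, tensorSymbol, viscous, fourierCoeff_sum, fourierCoeff_pderiv,
    fourierCoeff_smul, fourierCoeff_strain, Complex.real_smul, Finset.mul_sum,
    ← Finset.sum_neg_distrib]
  refine Finset.sum_congr rfl fun α _ => Finset.sum_congr rfl fun j _ =>
    Finset.sum_congr rfl fun β _ => ?_
  push_cast
  linear_combination (4 * Real.pi ^ 2 * ξ α * a k j α β
    * strainSymbol (fun i => (ξ i : ℝ)) (vecCoeff u ξ) j β) * Complex.I_sq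

theorem fourierCoeff_advect {s : ℝ} {u : Fin n → PDist n} (hu : HMem s (vecCoeff u)) (k : Fin n)
    (ξ : Fin n → ℤ) : fourierCoeff (advect U u k) ξ = advSeq U (vecCoeff u) ξ k := by
  have hproduct : HasSum (fun ζ => ∑ j, coeff (U j) ζ * fourierCoeff (pderiv j (u k)) (ξ - ζ))
      (fourierCoeff (advect U u k) ξ) := by
    rw [advect, fourierCoeff_sum]
    exact hasSum_sum fun j _ => hasSum_fourierCoeff_mulSmooth (U j) (pderiv j (u k)) ξ
  refine hproduct.unique (((hu.hasSum_advSeq (U := U) ξ).mapL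
    (EuclideanSpace.proj (𝕜 := ℂ) k)).congr_fun fun ζ => ?_)
  change _ = advSymbol U ζ (ξ - ζ) * fourierCoeff (u k) (ξ - ζ)
  rw [advSymbol, Finset.sum_mul]
  exact Finset.sum_congr rfl fun j _ => by rw [fourierCoeff_pderiv, ← mul_assoc]

variable {s : ℝ} {x : (Fin n → PDist n) × PDist n}

theorem vecCoeff_oseen_fst (hx : HMem s (vecCoeff x.1)) (ξ : Fin n → ℤ) :
    vecCoeff (oseen a U x).1 ξ = oseenSeq (viscSymbol a) U (vecCoeff x.1) ξ
      + (2 * Real.pi * Complex.I * fourierCoeff x.2 ξ) • cvec ξ := by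
  ext k
  change fourierCoeff (-viscous a x.1 k + pderiv k x.2 + advect U x.1 k) ξ
    = viscSymbol a ξ (vecCoeff x.1 ξ) k + advSeq U (vecCoeff x.1) ξ k
      + (2 * Real.pi * Complex.I * fourierCoeff x.2 ξ) * ξ k
  rw [fourierCoeff_add, fourierCoeff_add, fourierCoeff_neg, fourierCoeff_viscous,
    fourierCoeff_advect hx, fourierCoeff_pderiv]
  ring

theorem fourierCoeff_oseen_snd (x : (Fin n → PDist n) × PDist n) (ξ : Fin n → ℤ) :
    fourierCoeff (oseen a U x).2 ξ =
      2 * Real.pi * Complex.I * inner ℂ (cvec ξ) (vecCoeff x.1 ξ) := by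
  change fourierCoeff (∑ j, pderiv j (x.1 j)) ξ = _
  rw [fourierCoeff_sum, inner_cvec, Finset.mul_sum]
  refine Finset.sum_congr rfl fun j _ => ?_
  rw [fourierCoeff_pderiv, vecCoeff_apply, mul_assoc]

theorem oseen_eq_iff_solves (hx : HMem s (vecCoeff x.1)) {y : (Fin n → PDist n) × PDist n} :
    oseen a U x = y ↔ Solves (viscSymbol a) U (vecCoeff x.1) (fourierCoeff x.2) (vecCoeff y.1)
      (fourierCoeff y.2) := by
  rw [Prod.ext_iff, ← vecCoeff_injective.eq_iff, ← fourierCoeff_injective.eq_iff, funext_iff,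
    funext_iff, ← forall_and]
  simp only [vecCoeff_oseen_fst a hx, fourierCoeff_oseen_snd]
  rfl

end OseenCoefficients

section DataBounds

variable {s : ℝ} {u : (Fin n → ℤ) → Vec n} {p : (Fin n → ℤ) → ℂ}

theorem HMem.gradient (hp : HMem (s - 1) p) :
    HMem (s - 2) (fun ξ => (2 * Real.pi * Complex.I * p ξ) • cvec ξ) ∧
      hNorm (s - 2) (fun ξ => (2 * Real.pi * Complex.I * p ξ) • cvec ξ)
        ≤ 2 * Real.pi * hNorm (s - 1) p := by
  refine hp.of_le Real.two_pi_pos.le fun ξ => ?_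
  have := rho_rpow_pos ξ (s - 2)
  rw [norm_smul, norm_two_pi_I_mul]
  calc rho ξ ^ (s - 2) * (2 * Real.pi * ‖p ξ‖ * ‖cvec ξ‖)
      ≤ rho ξ ^ (s - 2) * (2 * Real.pi * ‖p ξ‖ * rho ξ) := by
        gcongr
        exact norm_cvec_le_rho ξ
    _ = 2 * Real.pi * (rho ξ ^ (s - 1) * ‖p ξ‖) := by
        rw [← rho_rpow_sub_two_mul ξ s]
        ring

theorem HMem.divergence (hu : HMem s u) :
    HMem (s - 1) (fun ξ => 2 * Real.pi * Complex.I * inner ℂ (cvec ξ) (u ξ)) ∧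
      hNorm (s - 1) (fun ξ => 2 * Real.pi * Complex.I * inner ℂ (cvec ξ) (u ξ))
        ≤ 2 * Real.pi * hNorm s u := by
  refine hu.of_le Real.two_pi_pos.le fun ξ => ?_
  have := rho_rpow_pos ξ (s - 1)
  rw [norm_two_pi_I_mul]
  calc rho ξ ^ (s - 1) * (2 * Real.pi * ‖inner ℂ (cvec ξ) (u ξ)‖)
      ≤ rho ξ ^ (s - 1) * (2 * Real.pi * (rho ξ * ‖u ξ‖)) := by
        gcongr
        exact (norm_inner_le_norm _ _).trans (by gcongr; exact norm_cvec_le_rho ξ)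
    _ = 2 * Real.pi * (rho ξ ^ s * ‖u ξ‖) := by
        rw [← rho_rpow_sub_one_mul ξ s]
        ring

variable {A : (Fin n → ℤ) → Vec n →L[ℂ] Vec n} {c₁ a₂ : ℝ} {U : Fin n → PSmooth n}
  {f : (Fin n → ℤ) → Vec n} {g : (Fin n → ℤ) → ℂ} (h : Solves A U u p f g)
include h

theorem Solves.zero_data (hU : RealDivFree U) (hu₀ : u 0 = 0) : f 0 = 0 ∧ g 0 = 0 := by
  rw [← (h 0).1, ← (h 0).2, oseenSeq_zero hU hu₀, cvec_zero, smul_zero, add_zero, inner_zero_left,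
    mul_zero]
  exact ⟨rfl, rfl⟩

variable (hA : IsEllipticSymbol A c₁ a₂) (hu : HMem s u) (hp : HMem (s - 1) p)
include hA hu hp

theorem Solves.hMem_data : HMem (s - 2) f ∧ HMem (s - 1) g := by
  rw [← funext fun ξ => (h ξ).1, ← funext fun ξ => (h ξ).2]
  exact ⟨(hA.hMem_oseenSeq hu).add hp.gradient.1, hu.divergence.1⟩

theorem Solves.hNorm_data_le :
    hNorm (s - 2) f + hNorm (s - 1) g
      ≤ (a₂ + ‖advOp U s‖ + 2 * Real.pi) * (hNorm s u + hNorm (s - 1) p) := by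
  rw [← funext fun ξ => (h ξ).1, ← funext fun ξ => (h ξ).2]
  have hnonneg : 0 ≤ (a₂ + ‖advOp U s‖) * hNorm (s - 1) p :=
    mul_nonneg (add_nonneg hA.nonneg (norm_nonneg _)) (hNorm_nonneg _ _)
  linarith [(hA.hMem_oseenSeq (U := U) hu).hNorm_add_le hp.gradient.1,
    hA.hNorm_oseenSeq_le (U := U) hu, hp.gradient.2, hu.divergence.2]

end DataBounds

section PairSpace

variable {s t : ℝ} {x y : (Fin n → PDist n) × PDist n}

theorem mem_PairSpace_iff :
    x ∈ PairSpace n s t ↔ (HMem s (vecCoeff x.1) ∧ vecCoeff x.1 0 = 0) ∧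
      HMem t (fourierCoeff x.2) ∧ fourierCoeff x.2 0 = 0 := by
  rw [← mem_HdotVec_iff, ← mem_Hdot_iff]
  rfl

theorem PairSpace_mono {s' t' : ℝ} (hs : s ≤ s') (ht : t ≤ t') :
    PairSpace n s' t' ≤ PairSpace n s t := fun x hx => by
  rw [mem_PairSpace_iff] at hx ⊢
  exact ⟨⟨hx.1.1.mono hs, hx.1.2⟩, hx.2.1.mono ht, hx.2.2⟩

theorem pairNorm_eq (hx : x ∈ PairSpace n s t) :
    pairNorm s t x = hNorm s (vecCoeff x.1) + hNorm t (fourierCoeff x.2) := by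
  rw [pairNorm, normHVec_eq_hNorm (mem_PairSpace_iff.1 hx).1.1]
  rfl

theorem hNorm_le_zero_iff {E : Type*} [NormedAddCommGroup E] {c : (Fin n → ℤ) → E}
    (hc : HMem s c) : hNorm s c ≤ 0 ↔ c = 0 := by
  refine ⟨fun h => funext fun ξ => ?_, fun h => ?_⟩
  · exact norm_le_zero_iff.1
      (nonpos_of_mul_nonpos_right ((hc.norm_le ξ).trans h) (rho_rpow_pos ξ s))
  · simp [hNorm, h]

theorem pairNorm_le_zero_iff (hx : x ∈ PairSpace n s t) : pairNorm s t x ≤ 0 ↔ x = 0 := by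
  obtain ⟨⟨hu, -⟩, hp, -⟩ := mem_PairSpace_iff.1 hx
  have hu_nonneg := hNorm_nonneg s (vecCoeff x.1)
  have hp_nonneg := hNorm_nonneg t (fourierCoeff x.2)
  have hzero : x = 0 ↔ vecCoeff x.1 = 0 ∧ fourierCoeff x.2 = 0 := by
    rw [Prod.ext_iff, ← vecCoeff_injective.eq_iff, ← fourierCoeff_injective.eq_iff]
    rfl
  rw [pairNorm_eq hx, hzero, ← hNorm_le_zero_iff hu, ← hNorm_le_zero_iff hp]
  constructor
  · intro h
    constructor <;> linarith
  · rintro ⟨h, h'⟩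
    linarith

end PairSpace

section Isomorphism

variable {a : Fin n → Fin n → Fin n → Fin n → ℝ} {U : Fin n → PSmooth n} {c₁ a₂ s : ℝ}
  {x y : (Fin n → PDist n) × PDist n}

theorem solves_oseen (hx : x ∈ PairSpace n s (s - 1)) :
    Solves (viscSymbol a) U (vecCoeff x.1) (fourierCoeff x.2) (vecCoeff (oseen a U x).1)
      (fourierCoeff (oseen a U x).2) :=
  (oseen_eq_iff_solves a (mem_PairSpace_iff.1 hx).1.1).1 rfl

theorem oseen_mem_PairSpace (hU : RealDivFree U) (hA : IsEllipticSymbol (viscSymbol a) c₁ a₂)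
    (hx : x ∈ PairSpace n s (s - 1)) : oseen a U x ∈ PairSpace n (s - 2) (s - 1) := by
  obtain ⟨⟨hu, hu₀⟩, hp, -⟩ := mem_PairSpace_iff.1 hx
  obtain ⟨hf, hg⟩ := (solves_oseen hx).hMem_data hA hu hp
  obtain ⟨hf₀, hg₀⟩ := (solves_oseen (a := a) hx).zero_data hU hu₀
  exact mem_PairSpace_iff.2 ⟨⟨hf, hf₀⟩, hg, hg₀⟩

theorem pairNorm_oseen_le (hU : RealDivFree U) (hA : IsEllipticSymbol (viscSymbol a) c₁ a₂)
    (hx : x ∈ PairSpace n s (s - 1)) : pairNorm (s - 2) (s - 1) (oseen a U x)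
      ≤ (a₂ + ‖advOp U s‖ + 2 * Real.pi) * pairNorm s (s - 1) x := by
  obtain ⟨⟨hu, -⟩, hp, -⟩ := mem_PairSpace_iff.1 hx
  rw [pairNorm_eq hx, pairNorm_eq (oseen_mem_PairSpace hU hA hx)]
  exact (solves_oseen hx).hNorm_data_le hA hu hp

theorem exists_pairNorm_le (hU : RealDivFree U) (hc₁ : 0 < c₁) (ha₂ : 0 ≤ a₂) (hs : 1 ≤ s) :
    ∃ C, 0 < C ∧ ∀ a : Fin n → Fin n → Fin n → Fin n → ℝ,
      IsEllipticSymbol (viscSymbol a) c₁ a₂ → ∀ x ∈ PairSpace n s (s - 1),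
        pairNorm s (s - 1) x ≤ C * pairNorm (s - 2) (s - 1) (oseen a U x) := by
  obtain ⟨C, hC, hbound⟩ := exists_hNorm_le hU hc₁ ha₂ hs
  refine ⟨C, hC, fun a hA x hx => ?_⟩
  have hy := oseen_mem_PairSpace hU hA hx
  obtain ⟨⟨hu, hu₀⟩, -, hp₀⟩ := mem_PairSpace_iff.1 hx
  obtain ⟨⟨hf, -⟩, hg, -⟩ := mem_PairSpace_iff.1 hy
  rw [pairNorm_eq hx, pairNorm_eq hy]
  exact hbound _ hA _ _ _ _ (solves_oseen hx) hu₀ hp₀ hu hf hg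

variable (hU : RealDivFree U) (hA : IsEllipticSymbol (viscSymbol a) c₁ a₂) (hs : 1 ≤ s)
include hU hA hs

theorem exists_oseen_eq (hy : y ∈ PairSpace n (s - 2) (s - 1)) :
    ∃ x ∈ PairSpace n s (s - 1), oseen a U x = y := by
  obtain ⟨⟨hf, hf₀⟩, hg, hg₀⟩ := mem_PairSpace_iff.1 hy
  obtain ⟨u, p, hu, hp, hu₀, hp₀, h⟩ := exists_solves hU hA hs hf hg hf₀ hg₀
  obtain ⟨v, rfl⟩ := exists_vecCoeff_eq hu
  obtain ⟨q, rfl⟩ := exists_fourierCoeff_eq hp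
  have hmem : (v, q) ∈ PairSpace n s (s - 1) := mem_PairSpace_iff.2 ⟨⟨hu, hu₀⟩, hp, hp₀⟩
  have heq : oseen a U (v, q) = y := (oseen_eq_iff_solves (x := (v, q)) a hu).2 h
  exact ⟨(v, q), hmem, heq⟩

theorem oseen_injOn : Set.InjOn (oseen a U) (PairSpace n s (s - 1)) := fun x hx y hy hxy => by
  obtain ⟨C, hC, hbound⟩ := exists_pairNorm_le hU hA.pos hA.nonneg hs
  have hmem : x - y ∈ PairSpace n s (s - 1) := Submodule.sub_mem _ hx hy
  have hzero : oseen a U (x - y) = 0 := by rw [map_sub, hxy, sub_self]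
  have hnorm : pairNorm (s - 2) (s - 1) (0 : (Fin n → PDist n) × PDist n) ≤ 0 :=
    (pairNorm_le_zero_iff (zero_mem _)).2 rfl
  refine sub_eq_zero.1 ((pairNorm_le_zero_iff hmem).1 ((hbound a hA _ hmem).trans ?_))
  rw [hzero]
  exact mul_nonpos_of_nonneg_of_nonpos hC.le hnorm

/-- The isomorphism `S_U` between the spaces of solutions and of data. -/
def oseenEquiv : PairSpace n s (s - 1) ≃ₗ[ℂ] PairSpace n (s - 2) (s - 1) :=
  LinearEquiv.ofBijective
    ((oseen a U).restrict fun _ => oseen_mem_PairSpace hU hA)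
    ⟨fun x y hxy => Subtype.ext (oseen_injOn hU hA hs x.2 y.2 (congrArg Subtype.val hxy)),
      fun y => by
        obtain ⟨x, hx, hxy⟩ := exists_oseen_eq hU hA hs y.2
        exact ⟨⟨x, hx⟩, Subtype.ext hxy⟩⟩

theorem oseenEquiv_apply (x : PairSpace n s (s - 1)) :
    (oseenEquiv hU hA hs x : (Fin n → PDist n) × PDist n) = oseen a U x := rfl

theorem oseen_oseenEquiv_symm (y : PairSpace n (s - 2) (s - 1)) :
    oseen a U ((oseenEquiv hU hA hs).symm y) = y :=
  congrArg Subtype.val ((oseenEquiv hU hA hs).apply_symm_apply y)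

end Isomorphism

section Conjugation

/-- The complex conjugate of a pair. -/
def conjPair (x : (Fin n → PDist n) × PDist n) : (Fin n → PDist n) × PDist n :=
  (fun k => conjHom n (x.1 k), conjHom n x.2)

theorem realPair_iff (x : (Fin n → PDist n) × PDist n) : RealPair x ↔ conjPair x = x := by
  simp only [RealPair, conjPair, isReal_iff, Prod.ext_iff, funext_iff]

theorem conjHom_viscous (a : Fin n → Fin n → Fin n → Fin n → ℝ) (u : Fin n → PDist n)
    (k : Fin n) : conjHom n (viscous a u k) = viscous a (fun k => conjHom n (u k)) k := by
  simp only [viscous, strain, map_sum, conjHom_pderiv, conjHom_smul, map_add,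
    Complex.conj_ofReal, map_div₀, map_one, map_ofNat]

theorem conjHom_advect {U : Fin n → PSmooth n} (hU : ∀ j x, ((U j).1 x).im = 0)
    (u : Fin n → PDist n) (k : Fin n) :
    conjHom n (advect U u k) = advect U (fun k => conjHom n (u k)) k := by
  simp only [advect, map_sum, conjHom_mulSmooth (hU _), conjHom_pderiv]

theorem oseen_conjPair (a : Fin n → Fin n → Fin n → Fin n → ℝ) {U : Fin n → PSmooth n}
    (hU : ∀ j x, ((U j).1 x).im = 0) (x : (Fin n → PDist n) × PDist n) :
    oseen a U (conjPair x) = conjPair (oseen a U x) := by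
  refine Prod.ext (funext fun k => ?_) ?_
  · change -viscous a (fun k => conjHom n (x.1 k)) k + pderiv k (conjHom n x.2)
      + advect U (fun k => conjHom n (x.1 k)) k
      = conjHom n (-viscous a x.1 k + pderiv k x.2 + advect U x.1 k)
    rw [map_add, map_add, map_neg, conjHom_viscous, conjHom_advect hU, conjHom_pderiv]
  · change ∑ j, pderiv j (conjHom n (x.1 j)) = conjHom n (∑ j, pderiv j (x.1 j))
    simp only [map_sum, conjHom_pderiv]

theorem conjHom_mem_Hdot {s : ℝ} {g : PDist n} (hg : g ∈ Hdot n s) : conjHom n g ∈ Hdot n s := by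
  rw [mem_Hdot_iff] at hg ⊢
  refine ⟨((Equiv.neg (Fin n → ℤ)).summable_iff.2 hg.1).congr fun ξ => ?_, ?_⟩
  · change rho (-ξ) ^ (2 * s) * ‖fourierCoeff g (-ξ)‖ ^ 2 = _
    rw [rho_neg, fourierCoeff_conjHom, Complex.norm_conj]
  · rw [fourierCoeff_conjHom, neg_zero, hg.2, map_zero]

theorem conjPair_mem_PairSpace {s t : ℝ} {x : (Fin n → PDist n) × PDist n}
    (hx : x ∈ PairSpace n s t) : conjPair x ∈ PairSpace n s t :=
  ⟨fun k hk => conjHom_mem_Hdot (hx.1 k hk), conjHom_mem_Hdot hx.2⟩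

theorem realPair_oseen_iff {a : Fin n → Fin n → Fin n → Fin n → ℝ} {U : Fin n → PSmooth n}
    {c₁ a₂ s : ℝ} (hU : RealDivFree U) (hA : IsEllipticSymbol (viscSymbol a) c₁ a₂) (hs : 1 ≤ s)
    {x : (Fin n → PDist n) × PDist n} (hx : x ∈ PairSpace n s (s - 1)) :
    RealPair (oseen a U x) ↔ RealPair x := by
  rw [realPair_iff, realPair_iff, ← oseen_conjPair a hU.1]
  exact (oseen_injOn hU hA hs).eq_iff (conjPair_mem_PairSpace hx) hx

end Conjugation

section Smoothness

theorem IsSmooth.hMem {g : PDist n} (hg : IsSmooth g) (s : ℝ) : HMem s (fourierCoeff g) := by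
  obtain ⟨K, hK⟩ := (isSmooth_iff g).1 hg (n + 1 + ⌈s⌉₊)
  refine summable_of_rho_pow_mul_le
    (fun ξ => mul_nonneg (rho_rpow_pos ξ _).le (sq_nonneg _)) (K := K ^ 2) fun ξ => ?_
  have hρ := rho_pos ξ
  have := rho_rpow_pos ξ s
  calc rho ξ ^ (n + 1) * (rho ξ ^ (2 * s) * ‖fourierCoeff g ξ‖ ^ 2)
      ≤ (rho ξ ^ (n + 1)) ^ 2 * (rho ξ ^ (2 * s) * ‖fourierCoeff g ξ‖ ^ 2) := by
        have := rho_rpow_pos ξ (2 * s)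
        gcongr
        exact le_self_pow₀ (one_le_pow₀ (one_le_rho ξ)) two_ne_zero
    _ = (rho ξ ^ (n + 1) * (rho ξ ^ s * ‖fourierCoeff g ξ‖)) ^ 2 := by
        rw [mul_pow, rho_rpow_mul_sq]
    _ ≤ (rho ξ ^ (n + 1) * (rho ξ ^ ⌈s⌉₊ * ‖fourierCoeff g ξ‖)) ^ 2 := by
        gcongr
        exact rpow_rho_le_pow ξ (Nat.le_ceil s)
    _ ≤ K ^ 2 := by
        rw [← mul_assoc, ← pow_add]
        exact pow_le_pow_left₀ (by positivity) (hK ξ) 2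

theorem isSmooth_of_hMem {g : PDist n} {s : ℝ} (h : ∀ r, s ≤ r → HMem r (fourierCoeff g)) :
    IsSmooth g := by
  refine (isSmooth_iff g).2 fun N => ⟨hNorm (max s N) (fourierCoeff g), fun ξ => ?_⟩
  refine (mul_le_mul_of_nonneg_right ?_ (norm_nonneg _)).trans
    ((h (max s N) (le_max_left _ _)).norm_le ξ)
  rw [← Real.rpow_natCast]
  exact Real.rpow_le_rpow_of_exponent_le (one_le_rho ξ) (le_max_right _ _)

theorem SmoothPair.mem_PairSpace {y : (Fin n → PDist n) × PDist n} (hy : SmoothPair y) (s t : ℝ) :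
    y ∈ PairSpace n s t :=
  ⟨fun k _ => ⟨(hy.1 k).1.hMem s, (hy.1 k).2⟩, hy.2.1.hMem t, hy.2.2⟩

theorem smoothPair_of_mem_PairSpace {x : (Fin n → PDist n) × PDist n} {s : ℝ}
    (h : ∀ r, s ≤ r → x ∈ PairSpace n r (r - 1)) : SmoothPair x := by
  obtain ⟨hu, hp⟩ := h s le_rfl
  refine ⟨fun k => ⟨isSmooth_of_hMem fun r hr => ((h r hr).1 k trivial).1, (hu k trivial).2⟩,
    isSmooth_of_hMem fun r (hr : s - 1 ≤ r) => ?_, hp.2⟩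
  have hmem := (h (r + 1) (sub_le_iff_le_add.1 hr)).2.1
  rwa [add_sub_cancel_right] at hmem

theorem smoothPair_of_smoothPair_oseen {a : Fin n → Fin n → Fin n → Fin n → ℝ}
    {U : Fin n → PSmooth n} {c₁ a₂ s : ℝ} (hU : RealDivFree U)
    (hA : IsEllipticSymbol (viscSymbol a) c₁ a₂) (hs : 1 ≤ s)
    {x : (Fin n → PDist n) × PDist n} (hx : x ∈ PairSpace n s (s - 1))
    (h : SmoothPair (oseen a U x)) : SmoothPair x :=
  smoothPair_of_mem_PairSpace fun r hr => by
    obtain ⟨z, hz, hzx⟩ := exists_oseen_eq hU hA (hs.trans hr) (h.mem_PairSpace _ _)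
    exact oseen_injOn hU hA hs (PairSpace_mono hr (sub_le_sub_right hr 1) hz) hx hzx ▸ hz

end Smoothness

end PeriodicOseen

end

theorem mainTheorem9 (n : ℕ) (hn : 2 ≤ n) (U : Fin n → PSmooth n) (hU : RealDivFree U)
    (s : ℝ) (hs : 1 ≤ s) (CA : ℝ) (hCA : 0 < CA) (A₀ : ℝ) :
    -- the constant depends only on `n`, `U`, `s`, `CA` and on the norm `A₀` of the tensor
    ∃ C : ℝ, 0 < C ∧
      -- `‖a‖` is the maximum of the `|a k j α β|`
      ∀ a : Fin n → Fin n → Fin n → Fin n → ℝ, TensorSymmetric a → TensorElliptic a CA → ‖a‖ = A₀ →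
        -- unique solvability, with the estimate
        (∀ f ∈ HdotVec n (s - 2), ∀ g ∈ Hdot n (s - 1),
          (∃! x : (Fin n → PDist n) × PDist n,
            (x.1 ∈ HdotVec n s ∧ x.2 ∈ Hdot n (s - 1)) ∧ oseen a U x = (f, g)) ∧
          ∀ u ∈ HdotVec n s, ∀ p ∈ Hdot n (s - 1), oseen a U (u, p) = (f, g) →
            normHVec s u + normH (s - 1) p ≤ C * (normHVec (s - 2) f + normH (s - 1) g)) ∧
        -- `S_U` is an isomorphism: a linear bijection, bounded together with its inverse
        (∃ T : PairSpace n s (s - 1) ≃ₗ[ℂ] PairSpace n (s - 2) (s - 1),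
          (∀ x, (T x).1 = oseen a U x.1) ∧
          (∃ K : ℝ, ∀ x, pairNorm (s - 2) (s - 1) (T x).1 ≤ K * pairNorm s (s - 1) x.1) ∧
          (∃ K : ℝ, ∀ y, pairNorm s (s - 1) (T.symm y).1 ≤ K * pairNorm (s - 2) (s - 1) y.1)) ∧
        -- the same holds in the spaces of real distributions
        (∀ x ∈ PairSpace n s (s - 1), RealPair x ↔ RealPair (oseen a U x)) ∧
        -- smooth data give smooth solutions
        (∀ y : (Fin n → PDist n) × PDist n, SmoothPair y →
          (∃ x ∈ PairSpace n s (s - 1), oseen a U x = y) ∧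
          ∀ x ∈ PairSpace n s (s - 1), oseen a U x = y → SmoothPair x) := by
  have hc₁ : 0 < Real.pi ^ 2 / CA := div_pos (pow_pos Real.pi_pos 2) hCA
  obtain ⟨C, hC, hbound⟩ := exists_pairNorm_le hU hc₁ (viscBound_nonneg n (abs_nonneg A₀)) hs
  refine ⟨C, hC, fun a ha hell hnorm => ?_⟩
  have hA : IsEllipticSymbol (viscSymbol a) (Real.pi ^ 2 / CA) (viscBound n |A₀|) := by
    rw [← hnorm, abs_of_nonneg (norm_nonneg a)]
    exact isEllipticSymbol_viscSymbol ha hCA hell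
  refine ⟨fun f hf g hg => ⟨?_, fun u hu p hp h =>
      (hbound a hA (u, p) ⟨hu, hp⟩).trans_eq (by rw [h]; rfl)⟩,
    ⟨oseenEquiv hU hA hs, oseenEquiv_apply hU hA hs,
      ⟨_, fun x => pairNorm_oseen_le hU hA x.2⟩, C, fun y => ?_⟩,
    fun x hx => (realPair_oseen_iff hU hA hs hx).symm,
    fun y hy => ⟨exists_oseen_eq hU hA hs (hy.mem_PairSpace _ _),
      fun x hx h => smoothPair_of_smoothPair_oseen hU hA hs hx (h ▸ hy)⟩⟩
  · obtain ⟨x, hx, hxy⟩ := exists_oseen_eq hU hA hs (y := (f, g)) ⟨hf, hg⟩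
    exact ⟨x, ⟨hx, hxy⟩, fun z hz => oseen_injOn hU hA hs hz.1 hx (hz.2.trans hxy.symm)⟩
  · have hsymm := hbound a hA _ ((oseenEquiv hU hA hs).symm y).2
    rwa [oseen_oseenEquiv_symm] at hsymm
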